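/- Let $n\ge 0$ and let $R$ be a nonzero commutative ring with nine elements $\beta,\alpha_1,\alpha_2,\alpha_3,\gamma_{12},\gamma_3,\delta_1,\delta_2,\delta_3\in R$ (for example $R=\mathbb C$, or the polynomial ring over $\mathbb C$ in nine indeterminates). A $\mathrm{dGh}^2_n$-diagram is drawn on a rectangle with $n$ nodes on the left side, $n$ nodes on the right side, and with the top and bottom sides as boundaries. It consists of non-crossing strings, each joining a node to another node or to a boundary, at most one string being attached to each node, together with finitely many dots, called ghosts, on the boundaries away from the string endpoints, such that on each boundary the number of ghosts plus the number of string endpoints is even. Two diagrams are equal if their strings join the same nodes to each other or to the same boundary and if in each domain (a part of a boundary between adjacent string endpoints or corners) their numbers of ghosts agree modulo $2$. The product $xy$ of two diagrams is obtained by concatenating them, with $x$ on the left. It is $0$ if a string meets an empty node. Otherwise number the ghosts and string endpoints along each boundary from left to right, starting from $1$; remove each loop, with a factor $\beta$; remove each boundary arc (a string with both ends on boundaries), leaving a ghost at each of its endpoints, with a factor determined by the parities of the numbers of its endpoints: for an arc with both ends on the top boundary the factor is $\alpha_1$ if (left end, right end) is (odd, even), $\alpha_2$ if it is (even, odd), and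 $\alpha_3$ if the parities are equal; for an arc with both ends on the bottom boundary it is $\delta_1,\delta_2,\delta_3$ in the same three cases; for an arc from the top to the bottom boundary it is $\gamma_{12}$ if the parities differ and $\gamma_3$ if they are equal. Finally the middle line is removed. The dilute ghost algebra $\mathrm{dGh}^2_n$ is the free $R$-module on all these diagrams with this product extended bilinearly. The ghost algebra $\mathrm{Gh}^2_n$ is spanned by the diagrams in which every node has a string attached, the one-boundary dilute ghost algebra $\mathrm{dGh}^1_n$ by the diagrams with no string attached to the bottom boundary, and the one-boundary ghost algebra $\mathrm{Gh}^1_n$ by the diagrams with both properties. Then $\mathrm{Gh}^2_n$, $\mathrm{Gh}^1_n$ and $\mathrm{dGh}^1_n$ are associative algebras. More precisely, $\mathrm{dGh}^2_n$ is closed under the product and associative, and $\mathrm{Gh}^2_n$, $\mathrm{Gh}^1_n$, $\mathrm{dGh}^1_n$ are linear subspaces of $\mathrm{dGh}^2_n$ that are closed under the product and on which the product is associative. The subalgebra $\mathrm{dGh}^1_n$ is unital, that is, it contains a multiplicative identity of $\mathrm{dGh}^2_n$; for $n\ge 1$, the subalgebras $\mathrm{Gh}^2_n$ and $\mathrm{Gh}^1_n$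 do not contain one. -/

import Mathlib

namespace GhostAlgebra

noncomputable section

open Classical

/-! ### Drawings on the rectangle -/

/-- The two boundaries of the rectangle. -/
inductive Side
  | top
  | bottom

/-- The `2n` nodes: `Sum.inl i` is the node at height `i` on the left side, `Sum.inr i` the node at
height `i` on the right side. Nodes are numbered from top to bottom. -/
abbrev Node (n : ℕ) := Fin n ⊕ Fin n

/-- What a node is joined to by the string attached to it, if there is such a string. -/
inductive Link (n : ℕ)
  | empty
  | node (q : Node n)
  | boundary (s : Side)

/-- Combinatorial data of a drawing. `link` says what each node is joined to. `word s` lists, from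
left to right, the marks on the boundary `s`: `none` is a ghost, and `some p` is the endpoint of the
string that joins the node `p` to this boundary. Only the data satisfying `RawDiagram.IsDiagram`
below are diagrams. -/
@[ext]
structure RawDiagram (n : ℕ) where
  link : Node n → Link n
  word : Side → List (Option (Node n))

namespace RawDiagram

variable {n : ℕ}

/-- A point on the perimeter of the rectangle where a string may end: a node, or the endpoint on the
boundary `s` of the string that starts at a node. -/
abbrev PerimeterPoint (n : ℕ) := Node n ⊕ (Side × Node n)

/-- All string endpoints, and all nodes, in clockwise order around the perimeter: up the left side,
along the top boundary from left to right, down the right side, and along the bottom boundary from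
right to left. -/
def perimeter (d : RawDiagram n) : List (PerimeterPoint n) :=
  (List.finRange n).reverse.map (fun i => Sum.inl (Sum.inl i)) ++
  (d.word Side.top).reduceOption.map (fun p => Sum.inr (Side.top, p)) ++
  (List.finRange n).map (fun i => Sum.inl (Sum.inr i)) ++
  (d.word Side.bottom).reduceOption.reverse.map (fun p => Sum.inr (Side.bottom, p))

/-- Two points on the perimeter are the two ends of one string. -/
def SameString (d : RawDiagram n) : PerimeterPoint n → PerimeterPoint n → Prop
  | Sum.inl p, Sum.inl q => d.link p = Link.node q
  | Sum.inl p, Sum.inr (s, q) => p = q ∧ d.link p = Link.boundary s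
  | Sum.inr (s, q), Sum.inl p => p = q ∧ d.link p = Link.boundary s
  | Sum.inr _, Sum.inr _ => False

/-- No two strings cross: there are no four points `a`, `b`, `c`, `e` in this order on the perimeter
with `a` joined to `c` and `b` joined to `e`. -/
def NonCrossing (d : RawDiagram n) : Prop :=
  ∀ a b c e : PerimeterPoint n, [a, b, c, e].Sublist d.perimeter →
    d.SameString a c → ¬ d.SameString b e

/-- The diagrams of the two-boundary dilute ghost algebra, each drawn in the unique way that has at
most one ghost in each domain. -/
structure IsDiagram (d : RawDiagram n) : Prop where
  /-- a string does not join a node to itself -/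
  link_ne : ∀ p, d.link p ≠ Link.node p
  /-- a string from `p` to `q` is a string from `q` to `p` -/
  link_symm : ∀ p q, d.link p = Link.node q → d.link q = Link.node p
  /-- the string endpoints on a boundary are those of the strings joined to it -/
  mem_word : ∀ s p, some p ∈ d.word s ↔ d.link p = Link.boundary s
  /-- every string has only one endpoint on a boundary -/
  nodup : ∀ s, (d.word s).reduceOption.Nodup
  /-- the number of ghosts and string endpoints on each boundary is even -/
  even : ∀ s, Even (d.word s).length
  /-- there is at most one ghost in each domain -/
  reduced : ∀ s, (d.word s).IsChain (fun a b => ¬ (a = none ∧ b = none))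
  nonCrossing : d.NonCrossing

/-- Every node has a string attached to it. -/
def NoEmptyNode (d : RawDiagram n) : Prop := ∀ p, d.link p ≠ Link.empty

/-- No string is attached to the bottom boundary. -/
def NoBottomString (d : RawDiagram n) : Prop := ∀ p, d.link p ≠ Link.boundary Side.bottom

end RawDiagram

/-! ### Concatenation -/

/-- Put a mark in front of a boundary word; two adjacent ghosts cancel. -/
def pushMark {α : Type*} : Option α → List (Option α) → List (Option α)
  | none, none :: w => w
  | m, w => m :: w

/-- Remove pairs of ghosts in the same domain until every domain has at most one. -/
def reduceGhosts {α : Type*} (w : List (Option α)) : List (Option α) :=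
  w.foldr pushMark []

/-- The nodes of the concatenation of two diagrams `x` (on the left) and `y` (on the right):
`Sum.inl p` is the node `p` of `x`, and `Sum.inr p` is the node `p` of `y`. The right node `i` of
`x` and the left node `i` of `y` are at the same place. -/
abbrev CNode (n : ℕ) := Node n ⊕ Node n

section Concatenation

variable {n : ℕ} (x y : RawDiagram n)

/-- What a node of the concatenation is joined to within its own factor. -/
def cLink : CNode n → Link n
  | Sum.inl p => x.link p
  | Sum.inr p => y.link p

/-- The nodes of the concatenation that are on its middle line. -/
def IsMiddle : CNode n → Prop
  | Sum.inl (Sum.inr _) => True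
  | Sum.inr (Sum.inl _) => True
  | _ => False

/-- The nodes on the left and right sides of the concatenation. -/
def outer : Node n → CNode n
  | Sum.inl i => Sum.inl (Sum.inl i)
  | Sum.inr i => Sum.inr (Sum.inr i)

/-- Two nodes of the concatenation are joined by a string of one of the two factors, or are at the
same place on the middle line. -/
inductive Step : CNode n → CNode n → Prop
  | left {p q : Node n} : x.link p = Link.node q → Step (Sum.inl p) (Sum.inl q)
  | right {p q : Node n} : y.link p = Link.node q → Step (Sum.inr p) (Sum.inr q)
  | glue (i : Fin n) : Step (Sum.inl (Sum.inr i)) (Sum.inr (Sum.inl i))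

/-- The graph whose connected components are the strings of the concatenation (and the empty
nodes). -/
def stringGraph : SimpleGraph (CNode n) := SimpleGraph.fromRel (Step x y)

/-- The marks on the boundary `s` of the concatenation, from left to right. -/
def cWord (s : Side) : List (Option (CNode n)) :=
  (x.word s).map (Option.map Sum.inl) ++ (y.word s).map (Option.map Sum.inr)

/-- A string of one factor meets an empty node of the other one. -/
def MeetsEmpty : Prop :=
  ∃ i : Fin n, ¬ (x.link (Sum.inr i) = Link.empty ↔ y.link (Sum.inl i) = Link.empty)

/-- The number of loops of the concatenation: a loop is a string that only passes through nodes on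
the middle line and has no end. -/
def loopCount : ℕ :=
  Nat.card {c : (stringGraph x y).ConnectedComponent //
    ∀ v ∈ c.supp, IsMiddle v ∧ ∃ q, cLink x y v = Link.node q}

/-- The number, counted from 1 on the left, of the string endpoint `v` among the ghosts and string
endpoints on the boundary `s` of the concatenation. -/
def endNumber (s : Side) (v : CNode n) : ℕ := (cWord x y s).idxOf (some v) + 1

/-- The diagram obtained from the concatenation by removing the loops and the boundary arcs, leaving
a ghost at each endpoint of each boundary arc, and then removing pairs of ghosts in one domain. -/
def concat : RawDiagram n where
  link p :=
    if h : ∃ q, q ≠ p ∧ (stringGraph x y).Reachable (outer p) (outer q) then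
      Link.node h.choose
    else if h : ∃ s, ∃ v, some v ∈ cWord x y s ∧ (stringGraph x y).Reachable (outer p) v then
      Link.boundary h.choose
    else Link.empty
  word s :=
    reduceGhosts ((cWord x y s).map fun m => m.bind fun v =>
      if h : ∃ p, (stringGraph x y).Reachable (outer p) v then some h.choose else none)

end Concatenation

/-! ### Parameters and multiplication -/

/-- The nine parameters. -/
structure Params (R : Type*) where
  β : R
  α₁ : R
  α₂ : R
  α₃ : R
  γ₁₂ : R
  γ₃ : R
  δ₁ : R
  δ₂ : R
  δ₃ : R

section Multiplication

variable {R : Type*} [CommRing R] (P : Params R) {n : ℕ}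

/-- The parameter of a boundary arc with both ends on the boundary `s`, the left one having number
`i` and the right one having number `j`. -/
def Params.sameSide (s : Side) (i j : ℕ) : R :=
  match s with
  | Side.top => if Odd i ∧ Even j then P.α₁ else if Even i ∧ Odd j then P.α₂ else P.α₃
  | Side.bottom => if Odd i ∧ Even j then P.δ₁ else if Even i ∧ Odd j then P.δ₂ else P.δ₃

/-- The parameter of a boundary arc with number `i` at the top boundary and number `j` at the bottom
boundary. -/
def Params.acrossSides (i j : ℕ) : R :=
  if (Odd i ∧ Even j) ∨ (Even i ∧ Odd j) then P.γ₁₂ else P.γ₃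

/-- The product of the parameters of all boundary arcs of the concatenation of `x` and `y` that have
both ends on the boundary `s`. -/
def sameSideFactor (x y : RawDiagram n) (s : Side) : R :=
  ∏ u : CNode n, ∏ v : CNode n,
    if some u ∈ cWord x y s ∧ some v ∈ cWord x y s ∧ (stringGraph x y).Reachable u v ∧
        endNumber x y s u < endNumber x y s v
    then P.sameSide s (endNumber x y s u) (endNumber x y s v) else 1

/-- The product of the parameters of all boundary arcs of the concatenation of `x` and `y` that join
the top boundary to the bottom boundary. -/
def acrossFactor (x y : RawDiagram n) : R :=
  ∏ u : CNode n, ∏ v : CNode n,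
    if some u ∈ cWord x y Side.top ∧ some v ∈ cWord x y Side.bottom ∧
        (stringGraph x y).Reachable u v
    then P.acrossSides (endNumber x y Side.top u) (endNumber x y Side.bottom v) else 1

/-- The product of all parameters that replace the removed loops and boundary arcs. -/
def factor (x y : RawDiagram n) : R :=
  P.β ^ loopCount x y * sameSideFactor P x y Side.top * sameSideFactor P x y Side.bottom *
    acrossFactor P x y

/-- The product of two diagrams. -/
def mulDiagram (x y : RawDiagram n) : RawDiagram n →₀ R :=
  if MeetsEmpty x y then 0 else Finsupp.single (concat x y) (factor P x y)

/-- The bilinear extension of the product of diagrams. -/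
def mul (a b : RawDiagram n →₀ R) : RawDiagram n →₀ R :=
  a.sum fun x r => b.sum fun y t => (r * t) • mulDiagram P x y

end Multiplication

/-! ### The four algebras -/

section Algebras

variable (R : Type*) [CommRing R] (n : ℕ)

/-- The dilute ghost algebra: the free module on all diagrams. -/
def dGh2 : Submodule R (RawDiagram n →₀ R) :=
  Finsupp.supported R R {d | d.IsDiagram}

/-- The ghost algebra: the free module on the diagrams in which every node has a string. -/
def Gh2 : Submodule R (RawDiagram n →₀ R) :=
  Finsupp.supported R R {d | d.IsDiagram ∧ d.NoEmptyNode}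

/-- The one-boundary dilute ghost algebra: the free module on the diagrams without strings attached
to the bottom boundary. -/
def dGh1 : Submodule R (RawDiagram n →₀ R) :=
  Finsupp.supported R R {d | d.IsDiagram ∧ d.NoBottomString}

/-- The one-boundary ghost algebra: the free module on the diagrams in which every node has a
string, and no string is attached to the bottom boundary. -/
def Gh1 : Submodule R (RawDiagram n →₀ R) :=
  Finsupp.supported R R {d | d.IsDiagram ∧ d.NoEmptyNode ∧ d.NoBottomString}

end Algebras

section Properties

variable {R : Type*} [CommRing R] (P : Params R) {n : ℕ}

/-- The product of two elements of `B` is in `B`. -/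
def MulClosed (B : Submodule R (RawDiagram n →₀ R)) : Prop :=
  ∀ a ∈ B, ∀ b ∈ B, mul P a b ∈ B

/-- The multiplication is associative on `B`. -/
def MulAssociative (B : Submodule R (RawDiagram n →₀ R)) : Prop :=
  ∀ a ∈ B, ∀ b ∈ B, ∀ c ∈ B, mul P (mul P a b) c = mul P a (mul P b c)

/-- `B` is closed under the multiplication, and the multiplication is associative on `B`. -/
def IsAssociativeAlgebra (B : Submodule R (RawDiagram n →₀ R)) : Prop :=
  MulClosed P B ∧ MulAssociative P B

/-- `B` is a linear subspace of `A` that is closed under the multiplication. -/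
def IsSubalgebraOf (B A : Submodule R (RawDiagram n →₀ R)) : Prop :=
  B ≤ A ∧ MulClosed P B

/-- `B` contains a multiplicative identity of `A`. -/
def ContainsIdentityOf (B A : Submodule R (RawDiagram n →₀ R)) : Prop :=
  ∃ e ∈ B, e ∈ A ∧ ∀ a ∈ A, mul P e a = a ∧ mul P a e = a

end Properties

end

end GhostAlgebra

/-! The strings of a product are the connected components of a graph on the nodes of the factors. In
`stringGraph` every vertex has degree at most two, and the deficit counts the ends of strings at
that vertex (`degree_stringGraph`). Hence every component is a path with two ends or a cycle
(`hasTwoEnds`), and the choices made in `concat` are forced.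

Planarity of a product is a parity argument. For weights in `ZMod 2` on the perimeter, `crossing`
counts ordered pairs modulo two. It vanishes on two disjoint sets of strings of a planar diagram
(`crossing_perimeter`). The perimeter of a product arises from those of its factors by cutting out
the middle line, which the two traverse in opposite directions, so the count still vanishes
(`crossing_concat_perimeter`), whereas two crossing strings would make it one.

Associativity compares both bracketings with the concatenation of all three diagrams at once.
Multiplying two neighbours first replaces a subgraph by its outer vertices and preserves
connectivity between the vertices that remain (`Coarsening`). So both bracketings yield
`tripleConcat` (`contract_eq`), and each loop or boundary arc of the triple concatenation is removed
at exactly one of the two stages (`Coarsening.closedCount_eq`, `arcFactor_split`). Its parameter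
does not depend on the stage: a removed arc leaves ghosts at its ends, ghosts cancel only in pairs,
and every diagram has an even number of marks on each boundary, so the parities recorded by `labels`
persist. Both products of factors are therefore `tripleFactor`. The products also vanish for the
same triples, because emptiness of a node propagates along the strings of a nonzero product
(`concat_link_eq_empty_iff`).

The identity is the sum, over all sets of heights, of the diagrams with horizontal strings at these
heights. Against a given diagram exactly one summand fits, and it only lengthens strings
(`IsExtension`). For `1 ≤ n`, combinations of diagrams without empty nodes annihilate the diagram
without strings and marks (`mul_emptyDiagram`), so none of them is an identity. -/

namespace GhostAlgebra

noncomputable section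

open Classical

/-! ### Cancellation of ghosts -/

section Ghosts

variable {α β : Type*}

/-- No two adjacent marks are ghosts. -/
abbrev Reduced (w : List (Option α)) : Prop :=
  w.IsChain (fun a b => ¬ (a = none ∧ b = none))

theorem pushMark_some (a : α) (w : List (Option α)) : pushMark (some a) w = some a :: w := by
  simp [pushMark]

theorem pushMark_none_none (w : List (Option α)) : pushMark none (none :: w) = w := rfl

theorem pushMark_none_some (a : α) (w : List (Option α)) :
    pushMark none (some a :: w) = none :: some a :: w := rfl

theorem pushMark_none_nil : pushMark none ([] : List (Option α)) = [none] := rfl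

theorem Reduced.pushMark {w : List (Option α)} (h : Reduced w) (m : Option α) :
    Reduced (pushMark m w) := by
  rcases m with _ | a
  · rcases w with _ | ⟨_ | b, w⟩
    · simp [pushMark_none_nil, Reduced]
    · exact h.tail
    · rw [pushMark_none_some]
      exact List.IsChain.cons_cons (by simp) h
  · rw [pushMark_some]
    rcases w with _ | ⟨b, w⟩
    · simp [Reduced]
    · exact List.IsChain.cons_cons (by simp) h

/-- Reducedness is essential: two ghosts put in front of `none :: none :: t` leave only `t`. -/
theorem Reduced.pushMark_pushMark {w : List (Option α)} (h : Reduced w) :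
    GhostAlgebra.pushMark none (GhostAlgebra.pushMark none w) = w := by
  rcases w with _ | ⟨_ | b, w⟩
  · rfl
  · rcases w with _ | ⟨_ | b, w⟩
    · rfl
    · simp [Reduced] at h
    · rfl
  · rfl

theorem Reduced.foldr {b : List (Option α)} (hb : Reduced b) (w : List (Option α)) :
    Reduced (w.foldr GhostAlgebra.pushMark b) := by
  induction w with
  | nil => exact hb
  | cons m w ih => exact ih.pushMark m

theorem reduced_reduceGhosts (w : List (Option α)) : Reduced (reduceGhosts w) :=
  Reduced.foldr (by simp [Reduced]) w

theorem reduceGhosts_cons (m : Option α) (w : List (Option α)) :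
    reduceGhosts (m :: w) = pushMark m (reduceGhosts w) := rfl

theorem Reduced.reduceGhosts_eq {w : List (Option α)} (h : Reduced w) : reduceGhosts w = w := by
  induction w with
  | nil => rfl
  | cons m w ih =>
    rw [reduceGhosts_cons, ih h.tail]
    rcases m with _ | a
    · rcases w with _ | ⟨_ | b, w⟩
      · rfl
      · simp [Reduced] at h
      · rfl
    · exact pushMark_some a w

/-- A pair of ghosts cancelled before applying `g` is still a pair of ghosts afterwards, and by
`Reduced.pushMark_pushMark` it acts trivially on the reduced word to its right. The arbitrary tail
`b` serves to cancel ghosts inside one factor of a concatenation. -/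
theorem foldr_pushMark_map_reduceGhosts {g : Option α → Option β} (hg : g none = none)
    {b : List (Option β)} (hb : Reduced b) (w : List (Option α)) :
    ((reduceGhosts w).map g).foldr pushMark b = (w.map g).foldr pushMark b := by
  induction w with
  | nil => rfl
  | cons m w ih =>
    rw [reduceGhosts_cons]
    rcases m with _ | a
    · rw [List.map_cons, List.foldr_cons, ← ih, hg]
      rcases h : reduceGhosts w with _ | ⟨_ | c, t⟩
      · simp [pushMark_none_nil, hg]
      · rw [pushMark_none_none, List.map_cons, List.foldr_cons, hg,
          (hb.foldr _).pushMark_pushMark]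
      · simp [pushMark_none_some, hg]
    · simp [pushMark_some, ih]

theorem reduceGhosts_map_append {g : Option α → Option β} (hg : g none = none)
    (w : List (Option α)) (b : List (Option β)) :
    reduceGhosts ((reduceGhosts w).map g ++ b) = reduceGhosts (w.map g ++ b) := by
  unfold reduceGhosts
  rw [List.foldr_append, List.foldr_append]
  exact foldr_pushMark_map_reduceGhosts hg (reduced_reduceGhosts b) w

theorem reduceGhosts_append_map {g : Option α → Option β} (hg : g none = none)
    (w : List (Option α)) (b : List (Option β)) :
    reduceGhosts (b ++ (reduceGhosts w).map g) = reduceGhosts (b ++ w.map g) := by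
  unfold reduceGhosts
  rw [List.foldr_append, List.foldr_append]
  exact congrArg (fun t => List.foldr pushMark t b)
    (foldr_pushMark_map_reduceGhosts hg (by simp [Reduced]) w)

theorem reduceOption_pushMark (m : Option α) (w : List (Option α)) :
    (pushMark m w).reduceOption = (m :: w).reduceOption := by
  rcases m with _ | a
  · rcases w with _ | ⟨_ | b, w⟩ <;> simp [pushMark, List.reduceOption]
  · rw [pushMark_some]

theorem reduceOption_reduceGhosts (w : List (Option α)) :
    (reduceGhosts w).reduceOption = w.reduceOption := by
  induction w with
  | nil => rfl
  | cons m w ih =>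
    rw [reduceGhosts_cons, reduceOption_pushMark]
    rcases m with _ | a
    · simpa using ih
    · simpa using ih

theorem some_mem_reduceGhosts {a : α} {w : List (Option α)} :
    some a ∈ reduceGhosts w ↔ some a ∈ w := by
  rw [← List.reduceOption_mem_iff, reduceOption_reduceGhosts, List.reduceOption_mem_iff]

theorem even_length_pushMark (m : Option α) (w : List (Option α)) :
    Even (pushMark m w).length ↔ Even (w.length + 1) := by
  rcases m with _ | a
  · rcases w with _ | ⟨_ | b, w⟩ <;> simp [pushMark, parity_simps]
  · simp [pushMark_some]

theorem even_length_reduceGhosts (w : List (Option α)) :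
    Even (reduceGhosts w).length ↔ Even w.length := by
  induction w with
  | nil => rfl
  | cons m w ih =>
    rw [reduceGhosts_cons, even_length_pushMark, List.length_cons]
    simp [parity_simps, ih]

end Ghosts

/-! ### String endpoints with the parities of their numbers -/

section Labels

variable {α β : Type*}

/-- The string endpoints of a word with the parities of their numbers, where the first mark has
parity `b` and `true` means odd. -/
def labels : Bool → List (Option α) → List (α × Bool)
  | _, [] => []
  | b, none :: w => labels (!b) w
  | b, some a :: w => (a, b) :: labels (!b) w

/-- Cancelling two ghosts shifts the numbers of all later endpoints by two. -/
theorem labels_pushMark (b : Bool) (m : Option α) (w : List (Option α)) :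
    labels b (pushMark m w) = labels b (m :: w) := by
  rcases m with _ | a
  · rcases w with _ | ⟨_ | c, w⟩ <;> simp [pushMark, labels]
  · rw [pushMark_some]

theorem labels_reduceGhosts (b : Bool) (w : List (Option α)) :
    labels b (reduceGhosts w) = labels b w := by
  induction w generalizing b with
  | nil => rfl
  | cons m w ih =>
    rw [reduceGhosts_cons, labels_pushMark]
    rcases m with _ | a <;> simp [labels, ih]

/-- This is where evenness of the number of marks enters: the second word starts with the same
parity as the first. -/
theorem labels_append_of_even (b : Bool) {w : List (Option α)} (hw : Even w.length)
    (t : List (Option α)) : labels b (w ++ t) = labels b w ++ labels b t := by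
  have : ∀ (w : List (Option α)) (b : Bool),
      labels b (w ++ t) = labels b w ++ labels (b ^^ w.length.bodd) t := by
    intro w
    induction w with
    | nil => simp [labels]
    | cons m w ih =>
      intro b
      rcases m with _ | a <;> simp [labels, ih]
  rw [this]
  have h : w.length.bodd = false := by
    obtain ⟨k, hk⟩ := hw
    rw [hk]
    simp [Nat.bodd_add]
  simp [h]

/-- An endpoint that is dropped still occupies its place as a ghost, so the surviving endpoints keep
their parities. This is the purpose of leaving ghosts at the ends of removed arcs. -/
theorem labels_map_bind (f : α → Option β) (b : Bool) (w : List (Option α)) :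
    labels b (w.map fun m => m.bind f) =
      (labels b w).filterMap fun a => (f a.1).map fun c => (c, a.2) := by
  induction w generalizing b with
  | nil => rfl
  | cons m w ih =>
    rcases m with _ | a
    · simp [labels, ih]
    · rcases h : f a with _ | c <;> simp [labels, ih, h]

theorem labels_map (f : α → β) (b : Bool) (w : List (Option α)) :
    labels b (w.map (Option.map f)) = (labels b w).map (Prod.map f id) := by
  induction w generalizing b with
  | nil => rfl
  | cons m w ih => rcases m with _ | a <;> simp [labels, ih]

theorem map_fst_labels (b : Bool) (w : List (Option α)) :
    (labels b w).map Prod.fst = w.reduceOption := by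
  induction w generalizing b with
  | nil => rfl
  | cons m w ih => rcases m with _ | a <;> simp [labels, ih]

theorem some_mem_of_mem_labels {b : Bool} {w : List (Option α)} {a : α × Bool}
    (h : a ∈ labels b w) : some a.1 ∈ w := by
  rw [← List.reduceOption_mem_iff, ← map_fst_labels b]
  exact List.mem_map_of_mem h

theorem pairwise_ne_labels (b : Bool) {w : List (Option α)} (h : w.reduceOption.Nodup) :
    (labels b w).Pairwise fun a c => a.1 ≠ c.1 := by
  rw [← map_fst_labels b, List.Nodup, List.pairwise_map] at h
  exact h

theorem labels_eq_map_idxOf [BEq (Option α)] [LawfulBEq (Option α)] (b : Bool)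
    {w : List (Option α)}
    (h : w.reduceOption.Nodup) :
    labels b w = w.reduceOption.map fun a => (a, b ^^ (w.idxOf (some a)).bodd) := by
  induction w generalizing b with
  | nil => rfl
  | cons m w ih =>
    rcases m with _ | a
    · rw [List.reduceOption_cons_of_none] at h ⊢
      rw [labels, ih _ h]
      apply List.map_congr_left
      intro c _
      simp
    · rw [List.reduceOption_cons_of_some] at h ⊢
      rw [labels, ih _ h.of_cons, List.map_cons]
      congr 1
      · simp
      apply List.map_congr_left
      intro c hc
      have hac : a ≠ c := by
        rintro rfl
        exact (List.nodup_cons.1 h).1 hc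
      simp [hac]

theorem pairwise_idxOf_reduceOption [BEq (Option α)] [LawfulBEq (Option α)]
    {w : List (Option α)}
    (h : w.reduceOption.Nodup) :
    w.reduceOption.Pairwise fun a c => w.idxOf (some a) < w.idxOf (some c) := by
  induction w with
  | nil => exact List.Pairwise.nil
  | cons m w ih =>
    rcases m with _ | a
    · rw [List.reduceOption_cons_of_none] at h ⊢
      refine (ih h).imp ?_
      intro c d hcd
      simpa using hcd
    · rw [List.reduceOption_cons_of_some] at h ⊢
      have ha := (List.nodup_cons.1 h).1
      refine List.Pairwise.cons ?_ ?_
      · intro c hc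
        have hac : a ≠ c := by
          rintro rfl
          exact ha hc
        simp [hac]
      · refine List.Pairwise.imp_of_mem ?_ (ih h.of_cons)
        intro c d hc hd hcd
        have hac : a ≠ c := by
          rintro rfl
          exact ha hc
        have had : a ≠ d := by
          rintro rfl
          exact ha hd
        simpa [hac, had] using hcd

end Labels

/-! ### Products over pairs of endpoints -/

section PairProducts

variable {α β : Type*} {R : Type*} [CommMonoid R]

/-- The product of `f a.2 c.2` over all related pairs with `a` in the first and `c` in the second
list. -/
def crossProd (r : α → α → Prop) (f : Bool → Bool → R) (l l' : List (α × Bool)) : R :=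
  (l.map fun a => (l'.map fun c => if r a.1 c.1 then f a.2 c.2 else 1).prod).prod

/-- The product of `f a.2 c.2` over all related pairs with `a` before `c` in the list. -/
def pairProd (r : α → α → Prop) (f : Bool → Bool → R) : List (α × Bool) → R
  | [] => 1
  | a :: l => (l.map fun c => if r a.1 c.1 then f a.2 c.2 else 1).prod * pairProd r f l

variable {r : α → α → Prop} {f : Bool → Bool → R}

theorem crossProd_cons_left (a : α × Bool) (l l' : List (α × Bool)) :
    crossProd r f (a :: l) l' =
      (l'.map fun c => if r a.1 c.1 then f a.2 c.2 else 1).prod * crossProd r f l l' := by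
  simp [crossProd]

/-- The factor of the pair of endpoints `F a`, `F c`, if these exist. -/
def optionFactor (r : β → β → Prop) (F : α → Option β) (s : R) (a c : α) : R :=
  match F a, F c with
  | some p, some q => if r p q then s else 1
  | _, _ => 1

theorem prod_map_filterMap_eq {r : β → β → Prop} {F : α → Option β} (a : α × Bool) (p : β)
    (hp : F a.1 = some p) (l : List (α × Bool)) :
    ((l.filterMap fun a => (F a.1).map fun c => (c, a.2)).map
      fun c => if r p c.1 then f a.2 c.2 else 1).prod =
    (l.map fun c => optionFactor r F (f a.2 c.2) a.1 c.1).prod := by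
  induction l with
  | nil => rfl
  | cons c l ih =>
    rcases h : F c.1 with _ | q
    · simp [h, ih, optionFactor]
    · simp [h, ih, optionFactor, hp]

theorem prod_map_optionFactor_of_none {r : β → β → Prop} {F : α → Option β} (a : α × Bool)
    (hp : F a.1 = none) (l : List (α × Bool)) :
    (l.map fun c => optionFactor r F (f a.2 c.2) a.1 c.1).prod = 1 := by
  apply List.prod_eq_one
  simp [optionFactor, hp]

/-- It suffices to split the factor of each single pair; dropping the entries without image under
`F` changes neither the remaining parities nor which pairs are formed. Since `h` holds for every
value `s`, the choice of `f` plays no role. -/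
theorem crossProd_split {rT rD : α → α → Prop} {rC : β → β → Prop} {F : α → Option β}
    {l l' : List (α × Bool)}
    (h : ∀ a ∈ l, ∀ c ∈ l', ∀ s : R, (if rT a.1 c.1 then s else 1) =
      (if rD a.1 c.1 then s else 1) * optionFactor rC F s a.1 c.1) :
    crossProd rT f l l' = crossProd rD f l l' *
      crossProd rC f (l.filterMap fun a => (F a.1).map fun c => (c, a.2))
        (l'.filterMap fun a => (F a.1).map fun c => (c, a.2)) := by
  induction l with
  | nil => simp [crossProd]
  | cons a l ih =>
    have h1 : (l'.map fun c => if rT a.1 c.1 then f a.2 c.2 else 1).prod =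
        (l'.map fun c => if rD a.1 c.1 then f a.2 c.2 else 1).prod *
        (l'.map fun c => optionFactor rC F (f a.2 c.2) a.1 c.1).prod := by
      rw [← List.prod_map_mul]
      congr 1
      apply List.map_congr_left
      intro c hc
      exact h a (by simp) c hc _
    rw [crossProd_cons_left, crossProd_cons_left, h1,
      ih fun a ha => h a (List.mem_cons_of_mem _ ha)]
    rcases hp : F a.1 with _ | p
    · rw [prod_map_optionFactor_of_none a hp, List.filterMap_cons_none (by simp [hp])]
      rw [mul_one, mul_assoc]
    · rw [← prod_map_filterMap_eq a p hp,
        List.filterMap_cons_some (b := (p, a.2)) (by simp [hp]), crossProd_cons_left]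
      ac_rfl

/-- The analogue of `crossProd_split` within one boundary. The hypothesis is only required for pairs
in list order, which excludes pairing an endpoint with itself. -/
theorem pairProd_split {rT rD : α → α → Prop} {rC : β → β → Prop} {F : α → Option β}
    {l : List (α × Bool)}
    (h : l.Pairwise fun a c => ∀ s : R, (if rT a.1 c.1 then s else 1) =
      (if rD a.1 c.1 then s else 1) * optionFactor rC F s a.1 c.1) :
    pairProd rT f l = pairProd rD f l *
      pairProd rC f (l.filterMap fun a => (F a.1).map fun c => (c, a.2)) := by
  induction l with
  | nil => simp [pairProd]
  | cons a l ih =>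
    rw [List.pairwise_cons] at h
    have h1 : (l.map fun c => if rT a.1 c.1 then f a.2 c.2 else 1).prod =
        (l.map fun c => if rD a.1 c.1 then f a.2 c.2 else 1).prod *
        (l.map fun c => optionFactor rC F (f a.2 c.2) a.1 c.1).prod := by
      rw [← List.prod_map_mul]
      congr 1
      apply List.map_congr_left
      intro c hc
      exact h.1 c hc _
    rw [pairProd, pairProd, h1, ih h.2]
    rcases hp : F a.1 with _ | p
    · rw [prod_map_optionFactor_of_none a hp, List.filterMap_cons_none (by simp [hp])]
      rw [mul_one, mul_assoc]
    · rw [← prod_map_filterMap_eq a p hp,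
        List.filterMap_cons_some (b := (p, a.2)) (by simp [hp]), pairProd]
      ac_rfl

theorem crossProd_map (g : β → α) (l l' : List (β × Bool)) :
    crossProd r f (l.map (Prod.map g id)) (l'.map (Prod.map g id)) =
      crossProd (fun a c => r (g a) (g c)) f l l' := by
  simp [crossProd, Function.comp_def]

theorem pairProd_map (g : β → α) (l : List (β × Bool)) :
    pairProd r f (l.map (Prod.map g id)) = pairProd (fun a c => r (g a) (g c)) f l := by
  induction l with
  | nil => rfl
  | cons a l ih => simp [pairProd, ih, Function.comp_def]

/-- Translates between recursion along a word and the product over all ordered pairs of vertices.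
With `k` strictly increasing along the list, the condition `k a < k c` picks out each pair once, in
list order. -/
theorem pairProd_map_key [DecidableEq α] (k : α → ℕ) (b : α → Bool) {l : List α}
    (hl : l.Pairwise fun a c => k a < k c) :
    pairProd r f (l.map fun a => (a, b a)) =
      ∏ a ∈ l.toFinset, ∏ c ∈ l.toFinset, if r a c ∧ k a < k c then f (b a) (b c) else 1 := by
  induction l with
  | nil => simp [pairProd]
  | cons a l ih =>
    rw [List.pairwise_cons] at hl
    have hnd : l.Nodup := hl.2.imp fun {c d} h => by
      rintro rfl
      exact lt_irrefl _ h
    have ha : a ∉ l.toFinset := fun h => lt_irrefl _ (hl.1 a (List.mem_toFinset.1 h))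
    rw [List.map_cons, pairProd, ih hl.2, List.toFinset_cons, Finset.prod_insert ha,
      Finset.prod_insert ha]
    congr 1
    · rw [if_neg (by simp), one_mul, List.prod_toFinset _ hnd, List.map_map]
      congr 1
      apply List.map_congr_left
      intro c hc
      simp [hl.1 c hc]
    · apply Finset.prod_congr rfl
      intro c hc
      rw [Finset.prod_insert ha, if_neg, one_mul]
      rintro ⟨_, h⟩
      exact lt_asymm h (hl.1 c (List.mem_toFinset.1 hc))

theorem crossProd_map_key [DecidableEq α] (b b' : α → Bool) {l l' : List α} (hl : l.Nodup)
    (hl' : l'.Nodup) :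
    crossProd r f (l.map fun a => (a, b a)) (l'.map fun a => (a, b' a)) =
      ∏ a ∈ l.toFinset, ∏ c ∈ l'.toFinset, if r a c then f (b a) (b' c) else 1 := by
  rw [List.prod_toFinset _ hl]
  unfold crossProd
  rw [List.map_map]
  congr 1
  apply List.map_congr_left
  intro a _
  simp only [Function.comp_apply]
  rw [List.prod_toFinset _ hl', List.map_map]
  rfl

end PairProducts

/-! ### Ends of the components of a graph of maximal degree two -/

section Degree

variable {V : Type*} [Fintype V]

/-- The handshake identity turns `hdeg` into: twice the number of vertices is twice the number of
edges plus the number of ends. Connectedness bounds the vertices by the edges plus one, so the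
number of ends is even and at most two. A vertex with both properties counts as two ends, which
covers isolated vertices. -/
theorem card_add_card_of_connected {H : SimpleGraph V} (hH : H.Connected) (P Q : V → Prop)
    (hdeg : ∀ v, H.degree v + ((if P v then 1 else 0) + (if Q v then 1 else 0)) = 2) :
    (Finset.univ.filter fun v => P v).card + (Finset.univ.filter fun v => Q v).card = 0 ∨
      (Finset.univ.filter fun v => P v).card + (Finset.univ.filter fun v => Q v).card = 2 := by
  have h1 := H.sum_degrees_eq_twice_card_edges
  have h2 := hH.card_vert_le_card_edgeSet_add_one
  have h3 : ∑ v, (H.degree v + ((if P v then 1 else 0) + (if Q v then 1 else 0))) =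
      ∑ _v : V, 2 := Finset.sum_congr rfl fun v _ => hdeg v
  rw [Finset.sum_add_distrib, Finset.sum_add_distrib, h1, Finset.sum_boole, Finset.sum_boole,
    Finset.sum_const, Finset.card_univ] at h3
  rw [Nat.card_eq_fintype_card, Nat.card_eq_fintype_card, ← SimpleGraph.edgeFinset_card] at h2
  simp only [Nat.cast_id, smul_eq_mul] at h3
  omega

/-- A component contains all neighbours of its vertices, so degrees do not change on restriction to
it. -/
theorem card_add_card_component {G : SimpleGraph V} (C : G.ConnectedComponent) (P Q : V → Prop)
    (hdeg : ∀ v, G.degree v + ((if P v then 1 else 0) + (if Q v then 1 else 0)) = 2) :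
    (Finset.univ.filter fun v => v ∈ C.supp ∧ P v).card +
        (Finset.univ.filter fun v => v ∈ C.supp ∧ Q v).card = 0 ∨
      (Finset.univ.filter fun v => v ∈ C.supp ∧ P v).card +
        (Finset.univ.filter fun v => v ∈ C.supp ∧ Q v).card = 2 := by
  have key := card_add_card_of_connected (H := G.induce C.supp) C.connected_toSimpleGraph
    (fun v => P v) (fun v => Q v) (by
      intro v
      have hs : G.neighborSet v ⊆ C.supp := by
        intro w hw
        exact C.mem_supp_of_adj_mem_supp v.2 hw
      have := G.degree_induce_of_neighborSet_subset hs
      rw [← hdeg v]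
      congr 1)
  have conv : ∀ P : V → Prop, (Finset.univ.filter fun v : C.supp => P v).card =
      (Finset.univ.filter fun v => v ∈ C.supp ∧ P v).card := by
    intro P
    rw [← Finset.card_map (Function.Embedding.subtype _)]
    congr 1
    ext v
    simp [and_comm]
  rw [conv P, conv Q] at key
  exact key

/-- Facts about the ends `P`, `Q` of the components of a graph in which the degree of each vertex
and the number of ends at it add up to two. -/
structure HasTwoEnds (G : SimpleGraph V) (P Q : V → Prop) : Prop where
  exists_other : ∀ u, P u → (∃ v, G.Reachable u v ∧ P v ∧ v ≠ u) ∨ ∃ v, G.Reachable u v ∧ Q v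
  not_right : ∀ u v w, P u → P v → u ≠ v → G.Reachable u v → G.Reachable u w → ¬ Q w
  right_unique : ∀ u v w, P u → Q v → Q w → G.Reachable u v → G.Reachable u w → v = w
  left_unique : ∀ u v w, P u → P v → P w → u ≠ v → G.Reachable u v → G.Reachable u w → w = u ∨ w = v

/-- Each property excludes a component with exactly one end or with three ends. -/
theorem hasTwoEnds {G : SimpleGraph V} (P Q : V → Prop)
    (hdeg : ∀ v, G.degree v + ((if P v then 1 else 0) + (if Q v then 1 else 0)) = 2) :
    HasTwoEnds G P Q := by
  have key := fun u => card_add_card_component (G.connectedComponentMk u) P Q hdeg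
  have hm : ∀ u v, v ∈ (G.connectedComponentMk u).supp ↔ G.Reachable u v := fun u v => by
    rw [SimpleGraph.ConnectedComponent.mem_supp_iff, SimpleGraph.ConnectedComponent.eq]
    exact SimpleGraph.reachable_comm
  simp only [hm] at key
  constructor
  · intro u hu
    by_contra hcon
    push Not at hcon
    have h1 : (Finset.univ.filter fun v => G.Reachable u v ∧ P v) = {u} := by
      ext v
      simp only [Finset.mem_filter, Finset.mem_univ, true_and, Finset.mem_singleton]
      constructor
      · rintro ⟨h, h'⟩
        exact hcon.1 v h h'
      · rintro rfl
        exact ⟨SimpleGraph.Reachable.refl _, hu⟩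
    have h2 : (Finset.univ.filter fun v => G.Reachable u v ∧ Q v) = ∅ := by
      ext v
      simp only [Finset.mem_filter, Finset.mem_univ, true_and, Finset.notMem_empty, iff_false]
      exact fun h => hcon.2 v h.1 h.2
    have := key u
    rw [h1, h2] at this
    simp at this
  · intro u v w hu hv huv huv' huw hw
    have h1 : ({u, v} : Finset V) ⊆ Finset.univ.filter fun v => G.Reachable u v ∧ P v := by
      intro t ht
      simp only [Finset.mem_insert, Finset.mem_singleton] at ht
      rcases ht with rfl | rfl
      · simp [hu]
      · simp [hv, huv']
    have h2 : ({w} : Finset V) ⊆ Finset.univ.filter fun v => G.Reachable u v ∧ Q v := by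
      simp [hw, huw]
    have h1' := Finset.card_le_card h1
    have h2' := Finset.card_le_card h2
    rw [Finset.card_pair huv] at h1'
    rw [Finset.card_singleton] at h2'
    have := key u
    omega
  · intro u v w hu hv hw huv huw
    by_contra hne
    have h1 : ({v, w} : Finset V) ⊆ Finset.univ.filter fun v => G.Reachable u v ∧ Q v := by
      intro t ht
      simp only [Finset.mem_insert, Finset.mem_singleton] at ht
      rcases ht with rfl | rfl
      · simp [hv, huv]
      · simp [hw, huw]
    have h2 : ({u} : Finset V) ⊆ Finset.univ.filter fun v => G.Reachable u v ∧ P v := by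
      simp [hu]
    have h1' := Finset.card_le_card h1
    have h2' := Finset.card_le_card h2
    rw [Finset.card_pair hne] at h1'
    rw [Finset.card_singleton] at h2'
    have := key u
    omega
  · intro u v w hu hv hw huv huv' huw
    by_contra! hne
    have h1 : ({w, u, v} : Finset V) ⊆ Finset.univ.filter fun v => G.Reachable u v ∧ P v := by
      intro t ht
      simp only [Finset.mem_insert, Finset.mem_singleton] at ht
      rcases ht with rfl | rfl | rfl
      · simp [hw, huw]
      · simp [hu]
      · simp [hv, huv']
    have h1' := Finset.card_le_card h1
    rw [Finset.card_insert_of_notMem (by simp [hne]), Finset.card_pair huv] at h1'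
    have := key u
    omega

end Degree

/-! ### The strings of a concatenation -/

section Strings

variable {n : ℕ}

/-- The node to which a node of a concatenation is joined by a string of its factor. -/
def linkPartner (x y : RawDiagram n) (v : CNode n) : Option (CNode n) :=
  match v with
  | Sum.inl p => match x.link p with
    | Link.node q => some (Sum.inl q)
    | _ => none
  | Sum.inr p => match y.link p with
    | Link.node q => some (Sum.inr q)
    | _ => none

/-- The node at the same place on the middle line. -/
def gluePartner : CNode n → Option (CNode n)
  | Sum.inl (Sum.inr i) => some (Sum.inr (Sum.inl i))
  | Sum.inr (Sum.inl i) => some (Sum.inl (Sum.inr i))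
  | _ => none

/-- The string at `v` ends there or on a boundary. -/
def IsTerminal (x y : RawDiagram n) (v : CNode n) : Prop := ∀ q, cLink x y v ≠ Link.node q

variable {x y : RawDiagram n}

theorem linkPartner_eq_none {v : CNode n} : linkPartner x y v = none ↔ IsTerminal x y v := by
  rcases v with p | p
  · rcases h : x.link p <;> simp [linkPartner, IsTerminal, cLink, h]
  · rcases h : y.link p <;> simp [linkPartner, IsTerminal, cLink, h]

theorem gluePartner_eq_none {v : CNode n} : gluePartner v = none ↔ ¬ IsMiddle v := by
  rcases v with (i | i) | (i | i) <;> simp [gluePartner, IsMiddle]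

theorem not_isMiddle_outer (p : Node n) : ¬ IsMiddle (outer p) := by
  rcases p with i | i <;> simp [outer, IsMiddle]

theorem not_isMiddle_iff {v : CNode n} : ¬ IsMiddle v ↔ ∃ p, v = outer p := by
  constructor
  · rcases v with (i | i) | (i | i)
    · exact fun _ => ⟨Sum.inl i, rfl⟩
    · simp [IsMiddle]
    · simp [IsMiddle]
    · exact fun _ => ⟨Sum.inr i, rfl⟩
  · rintro ⟨p, rfl⟩
    exact not_isMiddle_outer p

theorem outer_injective : Function.Injective (outer : Node n → CNode n) := by
  rintro (i | i) (j | j) h <;> simp_all [outer]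

theorem step_iff {u v : CNode n} :
    Step x y u v ↔ linkPartner x y u = some v ∨ (u.isLeft ∧ gluePartner u = some v) := by
  constructor
  · rintro (h | h | i)
    · simp [linkPartner, h]
    · simp [linkPartner, h]
    · simp [gluePartner]
  · rintro (h | ⟨h, h'⟩)
    · rcases u with p | p
      · rcases h2 : x.link p with _ | q | _ <;> simp [linkPartner, h2] at h
        subst h
        exact Step.left h2
      · rcases h2 : y.link p with _ | q | _ <;> simp [linkPartner, h2] at h
        subst h
        exact Step.right h2
    · rcases u with (i | i) | p
      · simp [gluePartner] at h'
      · simp [gluePartner] at h'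
        subst h'
        exact Step.glue i
      · simp at h

theorem adj_iff (hx : x.IsDiagram) (hy : y.IsDiagram) {u v : CNode n} :
    (stringGraph x y).Adj u v ↔ linkPartner x y u = some v ∨ gluePartner u = some v := by
  rw [stringGraph, SimpleGraph.fromRel_adj]
  constructor
  · rintro ⟨_, (h | h | i) | (h | h | i)⟩
    · simp [linkPartner, h]
    · simp [linkPartner, h]
    · simp [gluePartner]
    · simp [linkPartner, hx.link_symm _ _ h]
    · simp [linkPartner, hy.link_symm _ _ h]
    · simp [gluePartner]
  · rintro (h | h)
    · refine ⟨?_, Or.inl (step_iff.2 (Or.inl h))⟩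
      rintro rfl
      rcases u with p | p
      · rcases h2 : x.link p with _ | q | _ <;> simp [linkPartner, h2] at h
        subst h
        exact hx.link_ne _ h2
      · rcases h2 : y.link p with _ | q | _ <;> simp [linkPartner, h2] at h
        subst h
        exact hy.link_ne _ h2
    · rcases u with (i | i) | (i | i) <;> simp [gluePartner] at h <;> subst h
      · exact ⟨by simp, Or.inl (Step.glue i)⟩
      · exact ⟨by simp, Or.inr (Step.glue i)⟩

/-- A vertex has at most one neighbour along a string of its factor and at most one across the
middle line. These differ, since only the latter changes the factor. The two indicators account for
whichever of them is missing. -/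
theorem degree_stringGraph (hx : x.IsDiagram) (hy : y.IsDiagram) (v : CNode n) :
    (stringGraph x y).degree v +
      ((if ¬ IsMiddle v then 1 else 0) + (if IsTerminal x y v then 1 else 0)) = 2 := by
  have hnb : (stringGraph x y).neighborFinset v =
      (linkPartner x y v).toFinset ∪ (gluePartner v).toFinset := by
    ext w
    simp [adj_iff hx hy]
  have hdisj : Disjoint (linkPartner x y v).toFinset (gluePartner v).toFinset := by
    rw [Finset.disjoint_left]
    intro w hw hw'
    simp only [Option.mem_toFinset, Option.mem_def] at hw hw'
    rcases v with (i | i) | (i | i) <;> simp [gluePartner] at hw' <;> subst hw'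
    · rcases h2 : x.link (Sum.inr i) with _ | q | _ <;> simp [linkPartner, h2] at hw
    · rcases h2 : y.link (Sum.inl i) with _ | q | _ <;> simp [linkPartner, h2] at hw
  rw [← SimpleGraph.card_neighborFinset_eq_degree, hnb, Finset.card_union_of_disjoint hdisj]
  simp only [← linkPartner_eq_none, ← gluePartner_eq_none]
  rcases linkPartner x y v with _ | a <;> rcases gluePartner v with _ | b <;> simp

theorem hasTwoEnds_stringGraph (hx : x.IsDiagram) (hy : y.IsDiagram) :
    HasTwoEnds (stringGraph x y) (fun v => ¬ IsMiddle v) (IsTerminal x y) :=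
  hasTwoEnds _ _ fun v => by convert degree_stringGraph hx hy v

theorem some_mem_cWord (hx : x.IsDiagram) (hy : y.IsDiagram) {s : Side} {v : CNode n} :
    some v ∈ cWord x y s ↔ cLink x y v = Link.boundary s := by
  rcases v with p | p
  · simp [cWord, cLink, ← hx.mem_word]
  · simp [cWord, cLink, ← hy.mem_word]

theorem isTerminal_of_mem_cWord (hx : x.IsDiagram) (hy : y.IsDiagram) {s : Side} {v : CNode n}
    (h : some v ∈ cWord x y s) : IsTerminal x y v := by
  intro q hq
  rw [(some_mem_cWord hx hy).1 h] at hq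
  cases hq

/-- A component has at most two outer nodes, so the node chosen in `concat` is the only candidate.
-/
theorem concat_link_eq_node (hx : x.IsDiagram) (hy : y.IsDiagram) {p q : Node n} :
    (concat x y).link p = Link.node q ↔
      q ≠ p ∧ (stringGraph x y).Reachable (outer p) (outer q) := by
  have key := (hasTwoEnds_stringGraph hx hy).left_unique
  simp only [concat]
  constructor
  · split_ifs with h h'
    · intro e
      cases e
      exact h.choose_spec
    · simp
    · simp
  · intro h
    have h' : ∃ q, q ≠ p ∧ (stringGraph x y).Reachable (outer p) (outer q) := ⟨q, h⟩
    rw [dif_pos h']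
    have hs := h'.choose_spec
    congr 1
    rcases key (outer p) (outer q) (outer h'.choose) (not_isMiddle_outer _) (not_isMiddle_outer _)
      (not_isMiddle_outer _) (outer_injective.ne h.1.symm) h.2 hs.2 with e | e
    · exact absurd (outer_injective e) hs.1
    · exact outer_injective e

theorem not_reachable_terminal (hx : x.IsDiagram) (hy : y.IsDiagram) {p q : Node n} {v : CNode n}
    (hv : IsTerminal x y v) (h : (stringGraph x y).Reachable (outer p) v)
    (h' : (stringGraph x y).Reachable (outer q) v) : p = q := by
  by_contra hne
  exact (hasTwoEnds_stringGraph hx hy).not_right (outer p) (outer q) v (not_isMiddle_outer _)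
    (not_isMiddle_outer _) (outer_injective.ne hne) (h.trans h'.symm) h hv

theorem terminal_unique (hx : x.IsDiagram) (hy : y.IsDiagram) {p : Node n} {v w : CNode n}
    (hv : IsTerminal x y v) (hw : IsTerminal x y w)
    (h : (stringGraph x y).Reachable (outer p) v)
    (h' : (stringGraph x y).Reachable (outer p) w) : v = w :=
  (hasTwoEnds_stringGraph hx hy).right_unique _ _ _ (not_isMiddle_outer p) hv hw h h'

theorem concat_link_eq_boundary (hx : x.IsDiagram) (hy : y.IsDiagram) {p : Node n} {s : Side} :
    (concat x y).link p = Link.boundary s ↔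
      ∃ v, some v ∈ cWord x y s ∧ (stringGraph x y).Reachable (outer p) v := by
  simp only [concat]
  constructor
  · split_ifs with h h'
    · simp
    · intro e
      cases e
      exact h'.choose_spec
    · simp
  · intro h
    have h' : ∃ s, ∃ v, some v ∈ cWord x y s ∧ (stringGraph x y).Reachable (outer p) v := ⟨s, h⟩
    rw [dif_neg, dif_pos h']
    · obtain ⟨v, hv, hr⟩ := h
      obtain ⟨w, hw, hr'⟩ := h'.choose_spec
      have := terminal_unique hx hy (isTerminal_of_mem_cWord hx hy hv)
        (isTerminal_of_mem_cWord hx hy hw) hr hr'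
      subst this
      rw [some_mem_cWord hx hy] at hv hw
      exact hw.symm.trans hv
    · rintro ⟨q, hq, hr⟩
      obtain ⟨v, hv, hr'⟩ := h
      exact hq.symm (not_reachable_terminal hx hy (isTerminal_of_mem_cWord hx hy hv) hr'
        (hr.symm.trans hr'))

/-- The string from an outer node has a second end; if this is neither an outer node nor on a
boundary, it is an empty node. No condition on `MeetsEmpty` is needed, so `concat` is controlled
even where the product is zero. -/
theorem concat_link_eq_empty (hx : x.IsDiagram) (hy : y.IsDiagram) {p : Node n} :
    (concat x y).link p = Link.empty ↔
      ∃ v, cLink x y v = Link.empty ∧ (stringGraph x y).Reachable (outer p) v := by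
  constructor
  · intro h
    rcases (hasTwoEnds_stringGraph hx hy).exists_other (outer p) (not_isMiddle_outer p) with
      ⟨v, hr, hv, hne⟩ | ⟨v, hr, hv⟩
    · obtain ⟨q, rfl⟩ := not_isMiddle_iff.1 hv
      have := (concat_link_eq_node hx hy (p := p) (q := q)).2
        ⟨fun e => hne (by rw [e]), hr⟩
      rw [h] at this
      cases this
    · rcases hl : cLink x y v with _ | q | s
      · exact ⟨v, hl, hr⟩
      · exact absurd hl (hv q)
      · have := (concat_link_eq_boundary hx hy (p := p) (s := s)).2
          ⟨v, (some_mem_cWord hx hy).2 hl, hr⟩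
        rw [h] at this
        cases this
  · rintro ⟨v, hv, hr⟩
    have ht : IsTerminal x y v := fun q hq => by rw [hv] at hq; cases hq
    rcases h : (concat x y).link p with _ | q | s
    · rfl
    · obtain ⟨hq, hr'⟩ := (concat_link_eq_node hx hy).1 h
      exact absurd (not_reachable_terminal hx hy ht (hr'.symm.trans hr) hr) hq
    · obtain ⟨w, hw, hr'⟩ := (concat_link_eq_boundary hx hy).1 h
      have := terminal_unique hx hy ht (isTerminal_of_mem_cWord hx hy hw) hr hr'
      subst this
      rw [(some_mem_cWord hx hy).1 hw] at hv
      cases hv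

/-- The outer node at which the string through `v` starts, if there is one. -/
def outerEnd (x y : RawDiagram n) (v : CNode n) : Option (Node n) :=
  if h : ∃ p, (stringGraph x y).Reachable (outer p) v then some h.choose else none

theorem reachable_of_outerEnd {v : CNode n} {p : Node n} (h : outerEnd x y v = some p) :
    (stringGraph x y).Reachable (outer p) v := by
  unfold outerEnd at h
  split_ifs at h with h'
  cases h
  exact h'.choose_spec

theorem outerEnd_eq_none {v : CNode n} :
    outerEnd x y v = none ↔ ∀ p, ¬ (stringGraph x y).Reachable (outer p) v := by
  unfold outerEnd
  split_ifs with h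
  · exact ⟨fun e => e.elim, fun e => absurd h (not_exists.2 e)⟩
  · exact ⟨fun _ => not_exists.1 h, fun _ => rfl⟩

theorem outerEnd_eq_some (hx : x.IsDiagram) (hy : y.IsDiagram) {v : CNode n}
    (hv : IsTerminal x y v) {p : Node n} :
    outerEnd x y v = some p ↔ (stringGraph x y).Reachable (outer p) v := by
  refine ⟨reachable_of_outerEnd, fun h => ?_⟩
  rcases h' : outerEnd x y v with _ | q
  · exact absurd h (outerEnd_eq_none.1 h' p)
  · rw [not_reachable_terminal hx hy hv h (reachable_of_outerEnd h')]

theorem concat_word (x y : RawDiagram n) (s : Side) :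
    (concat x y).word s =
      reduceGhosts ((cWord x y s).map fun m => m.bind (outerEnd x y)) := rfl

theorem reduceOption_map_bind {α β : Type*} (f : α → Option β) (w : List (Option α)) :
    (w.map fun m => m.bind f).reduceOption = w.reduceOption.filterMap f := by
  induction w with
  | nil => rfl
  | cons m w ih =>
    rcases m with _ | a
    · simpa using ih
    · rcases h : f a with _ | b <;> simp [h, ih]

theorem reduceOption_concat_word (x y : RawDiagram n) (s : Side) :
    ((concat x y).word s).reduceOption =
      (cWord x y s).reduceOption.filterMap (outerEnd x y) := by
  rw [concat_word, reduceOption_reduceGhosts, reduceOption_map_bind]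

theorem some_mem_concat_word {s : Side} {p : Node n} :
    some p ∈ (concat x y).word s ↔ ∃ v, some v ∈ cWord x y s ∧ outerEnd x y v = some p := by
  rw [← List.reduceOption_mem_iff, reduceOption_concat_word, List.mem_filterMap]
  simp [List.reduceOption_mem_iff]

theorem reduceOption_map_map {α β : Type*} (f : α → β) (w : List (Option α)) :
    (w.map (Option.map f)).reduceOption = w.reduceOption.map f := by
  induction w with
  | nil => rfl
  | cons m w ih => rcases m with _ | a <;> simp [ih]

theorem reduceOption_cWord (x y : RawDiagram n) (s : Side) :
    (cWord x y s).reduceOption =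
      (x.word s).reduceOption.map Sum.inl ++ (y.word s).reduceOption.map Sum.inr := by
  rw [cWord, List.reduceOption_append, reduceOption_map_map, reduceOption_map_map]

theorem nodup_cWord (hx : x.IsDiagram) (hy : y.IsDiagram) (s : Side) :
    (cWord x y s).reduceOption.Nodup := by
  rw [reduceOption_cWord]
  refine List.Nodup.append ((hx.nodup s).map Sum.inl_injective)
    ((hy.nodup s).map Sum.inr_injective) ?_
  intro v hv hv'
  simp only [List.mem_map] at hv hv'
  obtain ⟨p, _, rfl⟩ := hv
  obtain ⟨q, _, h⟩ := hv'
  cases h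

end Strings

/-! ### Counting crossings modulo two -/

section Crossings

variable {α β : Type*}

/-- The total weight of the points in a list. -/
def weight (p : α → ZMod 2) (l : List α) : ZMod 2 := (l.map p).sum

/-- The total weight `p a * q b` of all pairs with `a` before `b` in a list. -/
def crossing (p q : α → ZMod 2) : List α → ZMod 2
  | [] => 0
  | a :: l => p a * weight q l + crossing p q l

variable {p q : α → ZMod 2}

theorem weight_append (l m : List α) : weight p (l ++ m) = weight p l + weight p m := by
  simp [weight]

theorem weight_cons (a : α) (l : List α) : weight p (a :: l) = p a + weight p l := by
  simp [weight]

theorem weight_reverse (l : List α) : weight p l.reverse = weight p l := by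
  simp [weight, List.sum_reverse]

theorem weight_map (f : β → α) (l : List β) : weight p (l.map f) = weight (p ∘ f) l := by
  simp [weight]

theorem weight_congr {p' : α → ZMod 2} {l : List α} (h : ∀ a ∈ l, p a = p' a) :
    weight p l = weight p' l := by
  unfold weight
  rw [List.map_congr_left h]

theorem weight_add (p p' : α → ZMod 2) (l : List α) :
    weight (p + p') l = weight p l + weight p' l := by
  induction l with
  | nil => simp [weight]
  | cons a l ih =>
    rw [weight_cons, weight_cons, weight_cons, ih, Pi.add_apply]
    ring

theorem weight_zero (l : List α) : weight (0 : α → ZMod 2) l = 0 := by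
  induction l with
  | nil => simp [weight]
  | cons a l ih => rw [weight_cons, ih, Pi.zero_apply, add_zero]

theorem crossing_append (l m : List α) :
    crossing p q (l ++ m) = crossing p q l + crossing p q m + weight p l * weight q m := by
  induction l with
  | nil => simp [crossing, weight]
  | cons a l ih =>
    rw [List.cons_append, crossing, crossing, ih, weight_append, weight_cons]
    ring

/-- Each pair of different positions is in the right order in exactly one of the two lists; the
products at a single position vanish by `hpq`. -/
theorem crossing_reverse (hpq : ∀ a, p a * q a = 0) (l : List α) :
    crossing p q l.reverse + crossing p q l = weight p l * weight q l := by
  induction l with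
  | nil => simp [crossing, weight]
  | cons a l ih =>
    rw [List.reverse_cons, crossing_append, weight_reverse, crossing, weight_cons, weight_cons]
    simp only [crossing, weight, List.map_cons, List.map_nil, List.sum_cons, List.sum_nil] at ih ⊢
    linear_combination ih - hpq a

theorem crossing_map (f : β → α) (l : List β) :
    crossing p q (l.map f) = crossing (p ∘ f) (q ∘ f) l := by
  induction l with
  | nil => rfl
  | cons a l ih => rw [List.map_cons, crossing, crossing, ih, weight_map]; rfl

theorem crossing_congr {p' q' : α → ZMod 2} {l : List α} (h : ∀ a ∈ l, p a = p' a)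
    (h' : ∀ a ∈ l, q a = q' a) : crossing p q l = crossing p' q' l := by
  induction l with
  | nil => rfl
  | cons a l ih =>
    rw [crossing, crossing, h a (by simp), weight_congr fun b hb => h' b (List.mem_cons_of_mem _ hb),
      ih (fun b hb => h b (List.mem_cons_of_mem _ hb)) fun b hb => h' b (List.mem_cons_of_mem _ hb)]

theorem crossing_add_left (p p' q : α → ZMod 2) (l : List α) :
    crossing (p + p') q l = crossing p q l + crossing p' q l := by
  induction l with
  | nil => simp [crossing]
  | cons a l ih =>
    rw [crossing, crossing, crossing, ih, Pi.add_apply]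
    ring

theorem crossing_add_right (p q q' : α → ZMod 2) (l : List α) :
    crossing p (q + q') l = crossing p q l + crossing p q' l := by
  induction l with
  | nil => simp [crossing]
  | cons a l ih =>
    rw [crossing, crossing, crossing, ih, weight_add]
    ring

theorem crossing_zero_left (q : α → ZMod 2) (l : List α) : crossing 0 q l = 0 := by
  induction l with
  | nil => rfl
  | cons a l ih => simp [crossing, ih]

theorem crossing_zero_right (p : α → ZMod 2) (l : List α) : crossing p 0 l = 0 := by
  induction l with
  | nil => rfl
  | cons a l ih => simp [crossing, ih, weight_zero]

theorem weight_filterMap {p' : β → ZMod 2} {f : α → Option β} {l : List α}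
    (h : ∀ a ∈ l, p a = (f a).elim 0 p') : weight p' (l.filterMap f) = weight p l := by
  induction l with
  | nil => rfl
  | cons a l ih =>
    have ih' := ih fun b hb => h b (List.mem_cons_of_mem _ hb)
    have ha := h a (by simp)
    rcases hf : f a with _ | c
    · rw [List.filterMap_cons_none hf, weight_cons, ih', ha, hf]
      simp
    · rw [List.filterMap_cons_some hf, weight_cons, weight_cons, ih', ha, hf]
      simp

theorem crossing_filterMap {p' q' : β → ZMod 2} {f : α → Option β} {l : List α}
    (h : ∀ a ∈ l, p a = (f a).elim 0 p') (h' : ∀ a ∈ l, q a = (f a).elim 0 q') :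
    crossing p' q' (l.filterMap f) = crossing p q l := by
  induction l with
  | nil => rfl
  | cons a l ih =>
    have ih' := ih (fun b hb => h b (List.mem_cons_of_mem _ hb))
      fun b hb => h' b (List.mem_cons_of_mem _ hb)
    have ha := h a (by simp)
    rcases hf : f a with _ | c
    · rw [List.filterMap_cons_none hf, crossing, ih', ha, hf]
      simp
    · rw [List.filterMap_cons_some hf, crossing, crossing, ih', ha, hf,
        weight_filterMap fun b hb => h' b (List.mem_cons_of_mem _ hb)]
      simp

/-- The weight that is one at `a` and zero elsewhere. -/
def pointWeight (a : α) : α → ZMod 2 := fun v => if v = a then 1 else 0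

theorem weight_pointWeight {a : α} {l : List α} (hl : l.Nodup) :
    weight (pointWeight a) l = if a ∈ l then 1 else 0 := by
  induction l with
  | nil => rfl
  | cons c l ih =>
    rw [weight_cons, ih hl.of_cons]
    by_cases hc : c = a
    · subst hc
      simp [pointWeight, (List.nodup_cons.1 hl).1]
    · simp [pointWeight, hc, Ne.symm hc]

theorem crossing_pointWeight {a b : α} {l : List α} (hl : l.Nodup) (ha : a ∈ l) (hb : b ∈ l) :
    crossing (pointWeight a) (pointWeight b) l = if l.idxOf a < l.idxOf b then 1 else 0 := by
  -- Membership is lost when passing to a tail, so the induction works without it. A missing point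
  -- has the length of the list as its index: for `a` this makes the inequality false by itself,
  -- while for `b` membership has to be kept as a condition.
  have : ∀ l : List α, l.Nodup → crossing (pointWeight a) (pointWeight b) l =
      if l.idxOf a < l.idxOf b ∧ b ∈ l then 1 else 0 := by
    intro l hl
    induction l with
    | nil => simp [crossing]
    | cons c l ih =>
      rw [crossing, ih hl.of_cons, weight_pointWeight hl.of_cons]
      have hc := (List.nodup_cons.1 hl).1
      by_cases hca : c = a
      · subst hca
        have h1 : ¬ (l.idxOf c < l.idxOf b ∧ b ∈ l) := by
          rw [List.idxOf_eq_length hc]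
          exact fun h => absurd h.1 (not_lt.2 List.idxOf_le_length)
        rw [if_neg h1]
        by_cases hcb : c = b
        · subst hcb
          simp [hc]
        · simp [pointWeight, hcb, Ne.symm hcb]
      · by_cases hcb : c = b
        · subst hcb
          simp [pointWeight, hca, hc]
        · simp [pointWeight, hca, hcb, Ne.symm hcb]
  rw [this l hl]
  simp [hb]

theorem sublist_of_pairwise_idxOf {l m : List α} (hl : l.Nodup)
    (hm : m.Pairwise fun a b => l.idxOf a < l.idxOf b) (h : ∀ a ∈ m, a ∈ l) : m.Sublist l := by
  induction l generalizing m with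
  | nil =>
    rcases m with _ | ⟨a, m⟩
    · exact List.Sublist.refl _
    · exact absurd (h a (by simp)) (by simp)
  | cons c l ih =>
    have hc := (List.nodup_cons.1 hl).1
    have step : ∀ m : List α, c ∉ m → (m.Pairwise fun a b => (c :: l).idxOf a < (c :: l).idxOf b) →
        (∀ a ∈ m, a ∈ c :: l) → m.Sublist l := by
      intro m hcm hm h
      apply ih hl.of_cons
      · refine hm.imp_of_mem ?_
        intro a b ha hb hab
        have hca : c ≠ a := by rintro rfl; exact hcm ha
        have hcb : c ≠ b := by rintro rfl; exact hcm hb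
        simpa [hca, hcb] using hab
      · intro a ha
        rcases List.mem_cons.1 (h a ha) with rfl | h'
        · exact absurd ha hcm
        · exact h'
    rcases m with _ | ⟨a, m⟩
    · exact List.nil_sublist _
    · rw [List.pairwise_cons] at hm
      have hcm : c ∉ m := fun hcm => by
        have := hm.1 c hcm
        simp at this
      by_cases hca : c = a
      · subst hca
        exact (step m hcm hm.2 fun a ha => h a (List.mem_cons_of_mem _ ha)).cons_cons c
      · refine (step (a :: m) ?_ (List.pairwise_cons.2 hm) h).cons c
        simp [hca, hcm]

theorem pairwise_idxOf {l m : List α} (hl : l.Nodup) (h : m.Sublist l) :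
    m.Pairwise fun a b => l.idxOf a < l.idxOf b := by
  refine List.Pairwise.sublist h ?_
  rw [List.pairwise_iff_getElem]
  intro i j hi hj hij
  rwa [hl.idxOf_getElem, hl.idxOf_getElem]

/-- The sum is odd if one or three of the four inequalities hold, and these eight patterns are the
eight ways in which the pairs `i, i'` and `j, j'` can interleave. -/
theorem chord_parity {i i' j j' : ℕ} (h1 : i ≠ j) (h2 : i ≠ j') (h3 : i' ≠ j) (h4 : i' ≠ j')
    (c1 : ¬ (i < j ∧ j < i' ∧ i' < j')) (c2 : ¬ (i < j' ∧ j' < i' ∧ i' < j))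
    (c3 : ¬ (i' < j ∧ j < i ∧ i < j')) (c4 : ¬ (i' < j' ∧ j' < i ∧ i < j))
    (c5 : ¬ (j < i ∧ i < j' ∧ j' < i')) (c6 : ¬ (j < i' ∧ i' < j' ∧ j' < i))
    (c7 : ¬ (j' < i ∧ i < j ∧ j < i')) (c8 : ¬ (j' < i' ∧ i' < j ∧ j < i)) :
    ((if i < j then 1 else 0) + (if i < j' then 1 else 0) +
      ((if i' < j then 1 else 0) + (if i' < j' then 1 else 0)) : ZMod 2) = 0 := by
  have two : (1 + 1 : ZMod 2) = 0 := rfl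
  rcases lt_or_gt_of_ne h1 with g1 | g1 <;> rcases lt_or_gt_of_ne h2 with g2 | g2 <;>
    rcases lt_or_gt_of_ne h3 with g3 | g3 <;> rcases lt_or_gt_of_ne h4 with g4 | g4 <;>
    first
    | exact absurd ⟨‹_›, ‹_›, ‹_›⟩ c1
    | exact absurd ⟨‹_›, ‹_›, ‹_›⟩ c2
    | exact absurd ⟨‹_›, ‹_›, ‹_›⟩ c3
    | exact absurd ⟨‹_›, ‹_›, ‹_›⟩ c4
    | exact absurd ⟨‹_›, ‹_›, ‹_›⟩ c5
    | exact absurd ⟨‹_›, ‹_›, ‹_›⟩ c6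
    | exact absurd ⟨‹_›, ‹_›, ‹_›⟩ c7
    | exact absurd ⟨‹_›, ‹_›, ‹_›⟩ c8
    | simp [g1, g2, g3, g4, g1.not_gt, g2.not_gt, g3.not_gt, g4.not_gt, two]

/-- Chords that pairwise do not cross. -/
theorem crossing_chords {l : List α} (hl : l.Nodup) {r : α → α → Prop} (hr : ∀ a b, r a b → r b a)
    (hnc : ∀ a b c e, [a, b, c, e].Sublist l → r a c → ¬ r b e)
    {s s' t t' : α} (hs : s ∈ l) (hs' : s' ∈ l) (ht : t ∈ l) (ht' : t' ∈ l)
    (h1 : s ≠ t) (h2 : s ≠ t') (h3 : s' ≠ t) (h4 : s' ≠ t') (hss : r s s') (htt : r t t') :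
    crossing (pointWeight s + pointWeight s') (pointWeight t + pointWeight t') l = 0 := by
  have no : ∀ a b c e, a ∈ l → b ∈ l → c ∈ l → e ∈ l → r a c → r b e →
      ¬ (l.idxOf a < l.idxOf b ∧ l.idxOf b < l.idxOf c ∧ l.idxOf c < l.idxOf e) := by
    rintro a b c e ha hb hc he hac hbe ⟨i1, i2, i3⟩
    refine hnc a b c e (sublist_of_pairwise_idxOf hl ?_ ?_) hac hbe
    · simp only [List.pairwise_cons, List.mem_cons, List.not_mem_nil, or_false, forall_eq_or_imp,
        forall_eq, IsEmpty.forall_iff, implies_true, List.Pairwise.nil, and_true]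
      omega
    · simp [ha, hb, hc, he]
  have hidx : ∀ a b, a ∈ l → a ≠ b → l.idxOf a ≠ l.idxOf b := by
    intro a b ha hab h
    exact hab ((List.idxOf_inj ha).1 h)
  rw [crossing_add_left, crossing_add_right, crossing_add_right, crossing_pointWeight hl hs ht,
    crossing_pointWeight hl hs ht', crossing_pointWeight hl hs' ht, crossing_pointWeight hl hs' ht']
  exact chord_parity (hidx _ _ hs h1) (hidx _ _ hs h2) (hidx _ _ hs' h3) (hidx _ _ hs' h4)
    (no _ _ _ _ hs ht hs' ht' hss htt) (no _ _ _ _ hs ht' hs' ht hss (hr _ _ htt))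
    (no _ _ _ _ hs' ht hs ht' (hr _ _ hss) htt) (no _ _ _ _ hs' ht' hs ht (hr _ _ hss) (hr _ _ htt))
    (no _ _ _ _ ht hs ht' hs' htt hss) (no _ _ _ _ ht hs' ht' hs htt (hr _ _ hss))
    (no _ _ _ _ ht' hs ht hs' (hr _ _ htt) hss) (no _ _ _ _ ht' hs' ht hs (hr _ _ htt) (hr _ _ hss))

/-- Three of the four pairs are in order: `a` precedes `b` and `e`, and `c` precedes only `e`. -/
theorem crossing_of_sublist {l : List α} (hl : l.Nodup) {a b c e : α}
    (h : [a, b, c, e].Sublist l) :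
    crossing (pointWeight a + pointWeight c) (pointWeight b + pointWeight e) l = 1 := by
  have hp := pairwise_idxOf hl h
  have hm := h.subset
  simp only [List.pairwise_cons, List.mem_cons, List.not_mem_nil, or_false, forall_eq_or_imp,
    forall_eq, IsEmpty.forall_iff, implies_true, List.Pairwise.nil, and_true] at hp
  have ha : a ∈ l := hm (by simp)
  have hb : b ∈ l := hm (by simp)
  have hc : c ∈ l := hm (by simp)
  have he : e ∈ l := hm (by simp)
  rw [crossing_add_left, crossing_add_right, crossing_add_right, crossing_pointWeight hl ha hb,
    crossing_pointWeight hl ha he, crossing_pointWeight hl hc hb, crossing_pointWeight hl hc he,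
    if_pos (by omega), if_pos (by omega), if_neg (by omega), if_pos (by omega)]
  rfl

/-- The set `F` is a disjoint union of two-point orbits of the fixed-point-free involution `π`, so
its indicator is a sum of indicators on which `Φ` vanishes. Used with `Φ` a weight, or a crossing
number in one argument, and with `π` exchanging the ends of each string. -/
theorem additive_eq_zero_of_pairing [DecidableEq α] (Φ : (α → ZMod 2) → ZMod 2) (h0 : Φ 0 = 0)
    (hadd : ∀ p q, Φ (p + q) = Φ p + Φ q) (π : α → α) (F : Finset α)
    (hmem : ∀ a ∈ F, π a ∈ F) (hne : ∀ a ∈ F, π a ≠ a) (hinv : ∀ a ∈ F, π (π a) = a)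
    (hpair : ∀ a ∈ F, Φ (pointWeight a + pointWeight (π a)) = 0) :
    Φ (fun v => if v ∈ F then 1 else 0) = 0 := by
  induction F using Finset.strongInduction with
  | H F ih =>
    rcases F.eq_empty_or_nonempty with rfl | ⟨a, ha⟩
    · refine Eq.trans (congrArg Φ ?_) h0
      funext v
      simp
    · have hsub : (F.erase a).erase (π a) ⊂ F :=
        lt_of_le_of_lt (Finset.erase_subset _ _) (Finset.erase_ssubset ha)
      have hmF : ∀ b ∈ (F.erase a).erase (π a), b ∈ F := fun b hb => hsub.1 hb
      have key := ih _ hsub (by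
          intro b hb
          have hbF := hmF b hb
          simp only [Finset.mem_erase, ne_eq] at hb ⊢
          refine ⟨fun h => hb.2.1 ?_, fun h => hb.1 ?_, hmem b hbF⟩
          · rw [← hinv b hbF, h, hinv a ha]
          · rw [← h, hinv b hbF])
        (fun b hb => hne b (hmF b hb)) (fun b hb => hinv b (hmF b hb))
        (fun b hb => hpair b (hmF b hb))
      have heq : (fun v => if v ∈ F then (1 : ZMod 2) else 0) =
          (pointWeight a + pointWeight (π a)) +
            fun v => if v ∈ (F.erase a).erase (π a) then 1 else 0 := by
        funext v
        simp only [Pi.add_apply, pointWeight, Finset.mem_erase]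
        by_cases h1 : v = a
        · subst h1
          simp [ha, (hne v ha).symm]
        · by_cases h2 : v = π a
          · subst h2
            simp [h1, hmem a ha]
          · simp [h1, h2]
      rw [heq, hadd, hpair a ha, key, add_zero]

end Crossings

/-! ### The concatenation of two diagrams is a diagram -/

section Planarity

variable {n : ℕ}

open RawDiagram

/-- The node at which the string at a point of the perimeter starts. -/
def nodeOf : PerimeterPoint n → Node n
  | Sum.inl p => p
  | Sum.inr (_, p) => p

theorem mem_perimeter_inl (d : RawDiagram n) (p : Node n) : Sum.inl p ∈ d.perimeter := by
  rcases p with i | i <;> simp [perimeter]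

theorem mem_perimeter_inr {d : RawDiagram n} {s : Side} {p : Node n} :
    Sum.inr (s, p) ∈ d.perimeter ↔ some p ∈ d.word s := by
  cases s <;> simp [perimeter, List.reduceOption_mem_iff]

theorem nodup_perimeter {d : RawDiagram n} (h : ∀ s, (d.word s).reduceOption.Nodup) :
    d.perimeter.Nodup := by
  have h1 : ((List.finRange n).reverse.map
      fun i => (Sum.inl (Sum.inl i) : PerimeterPoint n)).Nodup :=
    (List.nodup_reverse.2 (List.nodup_finRange n)).map fun i j h => by simpa using h
  have h2 : ((d.word Side.top).reduceOption.map
      fun p => (Sum.inr (Side.top, p) : PerimeterPoint n)).Nodup :=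
    (h _).map fun i j h => by simpa using h
  have h3 : ((List.finRange n).map fun i => (Sum.inl (Sum.inr i) : PerimeterPoint n)).Nodup :=
    (List.nodup_finRange n).map fun i j h => by simpa using h
  have h4 : ((d.word Side.bottom).reduceOption.reverse.map
      fun p => (Sum.inr (Side.bottom, p) : PerimeterPoint n)).Nodup :=
    (List.nodup_reverse.2 (h _)).map fun i j h => by simpa using h
  unfold perimeter
  refine ((h1.append h2 ?_).append h3 ?_).append h4 ?_
  · intro a ha hb
    simp only [List.mem_map] at ha hb
    obtain ⟨_, _, rfl⟩ := ha
    obtain ⟨_, _, h⟩ := hb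
    cases h
  · intro a ha hb
    simp only [List.mem_map, List.mem_append] at ha hb
    obtain ⟨_, _, rfl⟩ := hb
    rcases ha with ⟨_, _, h⟩ | ⟨_, _, h⟩ <;> cases h
  · intro a ha hb
    simp only [List.mem_map, List.mem_append] at ha hb
    obtain ⟨_, _, rfl⟩ := hb
    rcases ha with (⟨_, _, h⟩ | ⟨_, _, h⟩) | ⟨_, _, h⟩ <;> cases h

theorem sameString_symm {d : RawDiagram n}
    (hsymm : ∀ p q, d.link p = Link.node q → d.link q = Link.node p) (a b : PerimeterPoint n)
    (h : d.SameString a b) : d.SameString b a := by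
  rcases a with p | ⟨s, p⟩ <;> rcases b with q | ⟨t, q⟩
  · exact hsymm _ _ h
  · obtain ⟨rfl, h⟩ := h
    exact ⟨rfl, h⟩
  · obtain ⟨rfl, h⟩ := h
    exact ⟨rfl, h⟩
  · exact h

/-- The other end of the string at a point of the perimeter. -/
def otherEnd (d : RawDiagram n) : PerimeterPoint n → PerimeterPoint n
  | Sum.inl p => match d.link p with
    | Link.empty => Sum.inl p
    | Link.node q => Sum.inl q
    | Link.boundary s => Sum.inr (s, p)
  | Sum.inr (_, p) => Sum.inl p

/-- A set of nodes as a weight. -/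
def setWeight {α : Type*} (S : α → Prop) : α → ZMod 2 := fun v => if S v then 1 else 0

/-- A set of nodes that contains all ends of the strings attached to its nodes, and no empty node. -/
structure IsStringClosed (d : RawDiagram n) (S : Node n → Prop) : Prop where
  link_ne_empty : ∀ p, S p → d.link p ≠ Link.empty
  mem : ∀ p q, S p → d.link p = Link.node q → S q

/-- The points of the perimeter at strings in `S`. -/
def stringPoints (d : RawDiagram n) (S : Node n → Prop) : Finset (PerimeterPoint n) :=
  d.perimeter.toFinset.filter fun a => S (nodeOf a)

theorem mem_stringPoints {d : RawDiagram n} {S : Node n → Prop} {a : PerimeterPoint n} :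
    a ∈ stringPoints d S ↔ a ∈ d.perimeter ∧ S (nodeOf a) := by
  simp [stringPoints]

/-- A string attached to a boundary contributes its node and its boundary endpoint, so every string
has two points on the perimeter. The fixed points of `otherEnd` at empty nodes are excluded by
`IsStringClosed`. -/
theorem stringPoints_pairing {d : RawDiagram n} (hd : d.IsDiagram) {S : Node n → Prop}
    (hS : IsStringClosed d S) {a : PerimeterPoint n} (ha : a ∈ stringPoints d S) :
    otherEnd d a ∈ stringPoints d S ∧ otherEnd d a ≠ a ∧ otherEnd d (otherEnd d a) = a ∧
      d.SameString a (otherEnd d a) := by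
  rw [mem_stringPoints] at ha
  obtain ⟨ha, haS⟩ := ha
  rcases a with p | ⟨s, p⟩
  · simp only [nodeOf] at haS
    rcases h : d.link p with _ | q | s
    · exact absurd h (hS.link_ne_empty p haS)
    · have hq := hd.link_symm _ _ h
      simp only [otherEnd, h, hq, mem_stringPoints, SameString]
      refine ⟨⟨mem_perimeter_inl _ _, hS.mem _ _ haS h⟩, ?_, trivial, trivial⟩
      rintro e
      cases e
      exact hd.link_ne _ h
    · simp only [otherEnd, h, mem_stringPoints, SameString]
      exact ⟨⟨mem_perimeter_inr.2 ((hd.mem_word _ _).2 h), haS⟩, by simp, trivial,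
        trivial, trivial⟩
  · simp only [nodeOf] at haS
    have h := (hd.mem_word _ _).1 (mem_perimeter_inr.1 ha)
    simp only [otherEnd, h, mem_stringPoints, SameString]
    exact ⟨⟨mem_perimeter_inl _ _, haS⟩, by simp, trivial, trivial, trivial⟩

theorem setWeight_eq_stringPoints {d : RawDiagram n} {S : Node n → Prop} {a : PerimeterPoint n}
    (ha : a ∈ d.perimeter) :
    (setWeight S ∘ nodeOf) a = if a ∈ stringPoints d S then 1 else 0 := by
  simp [setWeight, mem_stringPoints, ha]

theorem map_nodeOf_perimeter (d : RawDiagram n) :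
    d.perimeter.map nodeOf = (List.finRange n).reverse.map Sum.inl ++
      (d.word Side.top).reduceOption ++ (List.finRange n).map Sum.inr ++
      (d.word Side.bottom).reduceOption.reverse := by
  simp only [perimeter, List.map_append, List.map_map]
  congr 1
  · congr 2
    exact List.map_id' _
  · exact List.map_id' _

theorem weight_perimeter {d : RawDiagram n} (hd : d.IsDiagram) {S : Node n → Prop}
    (hS : IsStringClosed d S) : weight (setWeight S ∘ nodeOf) d.perimeter = 0 := by
  have hnd := nodup_perimeter hd.nodup
  rw [weight_congr fun a ha => setWeight_eq_stringPoints ha]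
  refine additive_eq_zero_of_pairing (fun p => weight p d.perimeter) (weight_zero _)
    (fun p q => weight_add _ _ _) (otherEnd d) (stringPoints d S)
    (fun a ha => (stringPoints_pairing hd hS ha).1)
    (fun a ha => (stringPoints_pairing hd hS ha).2.1)
    (fun a ha => (stringPoints_pairing hd hS ha).2.2.1) ?_
  intro a ha
  rw [weight_add, weight_pointWeight hnd, weight_pointWeight hnd,
    if_pos (mem_stringPoints.1 ha).1,
    if_pos (mem_stringPoints.1 (stringPoints_pairing hd hS ha).1).1]
  rfl

/-- By additivity in both arguments it is enough to treat one string from each set, and two chords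
that do not cross are linked an even number of times. -/
theorem crossing_perimeter {d : RawDiagram n} (hd : d.IsDiagram) {S S' : Node n → Prop}
    (hS : IsStringClosed d S) (hS' : IsStringClosed d S') (hdisj : ∀ p, S p → ¬ S' p) :
    crossing (setWeight S ∘ nodeOf) (setWeight S' ∘ nodeOf) d.perimeter = 0 := by
  have hnd := nodup_perimeter hd.nodup
  rw [crossing_congr (fun a ha => setWeight_eq_stringPoints ha)
    fun a ha => setWeight_eq_stringPoints ha]
  have hne : ∀ a ∈ stringPoints d S, ∀ b ∈ stringPoints d S', a ≠ b := by
    rintro a ha b hb rfl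
    exact hdisj _ (mem_stringPoints.1 ha).2 (mem_stringPoints.1 hb).2
  refine additive_eq_zero_of_pairing (fun p => crossing p _ d.perimeter) (crossing_zero_left _ _)
    (fun p q => crossing_add_left _ _ _ _) (otherEnd d) (stringPoints d S)
    (fun a ha => (stringPoints_pairing hd hS ha).1)
    (fun a ha => (stringPoints_pairing hd hS ha).2.1)
    (fun a ha => (stringPoints_pairing hd hS ha).2.2.1) ?_
  intro a ha
  refine additive_eq_zero_of_pairing (fun q => crossing _ q d.perimeter) (crossing_zero_right _ _)
    (fun p q => crossing_add_right _ _ _ _) (otherEnd d) (stringPoints d S')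
    (fun a ha => (stringPoints_pairing hd hS' ha).1)
    (fun a ha => (stringPoints_pairing hd hS' ha).2.1)
    (fun a ha => (stringPoints_pairing hd hS' ha).2.2.1) ?_
  intro b hb
  have ha' := stringPoints_pairing hd hS ha
  have hb' := stringPoints_pairing hd hS' hb
  exact crossing_chords hnd (sameString_symm hd.link_symm) hd.nonCrossing
    (mem_stringPoints.1 ha).1 (mem_stringPoints.1 ha'.1).1 (mem_stringPoints.1 hb).1
    (mem_stringPoints.1 hb'.1).1 (hne _ ha _ hb) (hne _ ha _ hb'.1) (hne _ ha'.1 _ hb)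
    (hne _ ha'.1 _ hb'.1) ha'.2.2.2 hb'.2.2.2

variable {x y : RawDiagram n}

theorem concat_link_symm (hx : x.IsDiagram) (hy : y.IsDiagram) (p q : Node n)
    (h : (concat x y).link p = Link.node q) : (concat x y).link q = Link.node p := by
  rw [concat_link_eq_node hx hy] at h ⊢
  exact ⟨h.1.symm, h.2.symm⟩

theorem concat_mem_word (hx : x.IsDiagram) (hy : y.IsDiagram) (s : Side) (p : Node n) :
    some p ∈ (concat x y).word s ↔ (concat x y).link p = Link.boundary s := by
  rw [some_mem_concat_word, concat_link_eq_boundary hx hy]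
  refine exists_congr fun v => and_congr_right fun hv => ?_
  exact outerEnd_eq_some hx hy (isTerminal_of_mem_cWord hx hy hv)

theorem concat_nodup (hx : x.IsDiagram) (hy : y.IsDiagram) (s : Side) :
    ((concat x y).word s).reduceOption.Nodup := by
  rw [reduceOption_concat_word]
  have := nodup_cWord hx hy s
  rw [List.Nodup, List.pairwise_filterMap]
  refine this.imp_of_mem ?_
  rintro v w hv hw hne p hp q hq rfl
  rw [List.reduceOption_mem_iff] at hv hw
  exact hne (terminal_unique hx hy (isTerminal_of_mem_cWord hx hy hv)
    (isTerminal_of_mem_cWord hx hy hw) (reachable_of_outerEnd hp) (reachable_of_outerEnd hq))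

theorem even_length_cWord (hx : x.IsDiagram) (hy : y.IsDiagram) (s : Side) :
    Even (cWord x y s).length := by
  simp [cWord, hx.even s, hy.even s, Even.add]

theorem isStringClosed_inl (hx : x.IsDiagram) (hy : y.IsDiagram) {p : Node n}
    (hp : (concat x y).link p ≠ Link.empty) :
    IsStringClosed x fun q => (stringGraph x y).Reachable (outer p) (Sum.inl q) where
  link_ne_empty q hq h := hp ((concat_link_eq_empty hx hy).2 ⟨Sum.inl q, h, hq⟩)
  mem q r hq h := hq.trans (SimpleGraph.Adj.reachable
    ((adj_iff hx hy).2 (Or.inl (by simp [linkPartner, h]))))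

theorem isStringClosed_inr (hx : x.IsDiagram) (hy : y.IsDiagram) {p : Node n}
    (hp : (concat x y).link p ≠ Link.empty) :
    IsStringClosed y fun q => (stringGraph x y).Reachable (outer p) (Sum.inr q) where
  link_ne_empty q hq h := hp ((concat_link_eq_empty hx hy).2 ⟨Sum.inr q, h, hq⟩)
  mem q r hq h := hq.trans (SimpleGraph.Adj.reachable
    ((adj_iff hx hy).2 (Or.inl (by simp [linkPartner, h]))))

theorem reachable_glue (i : Fin n) :
    (stringGraph x y).Reachable (Sum.inl (Sum.inr i)) (Sum.inr (Sum.inl i)) :=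
  SimpleGraph.Adj.reachable ⟨by simp, Or.inl (Step.glue i)⟩

/-- The points of the perimeter of the concatenation on the string of a given point. -/
theorem reachable_nodeOf_iff (hx : x.IsDiagram) (hy : y.IsDiagram) {a c b : PerimeterPoint n}
    (ha : a ∈ (concat x y).perimeter) (hb : b ∈ (concat x y).perimeter)
    (hac : (concat x y).SameString a c) :
    (stringGraph x y).Reachable (outer (nodeOf a)) (outer (nodeOf b)) ↔ b = a ∨ b = c := by
  have h1 : (stringGraph x y).Reachable (outer (nodeOf a)) (outer (nodeOf b)) ↔
      nodeOf b = nodeOf a ∨ (concat x y).link (nodeOf a) = Link.node (nodeOf b) := by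
    rw [concat_link_eq_node hx hy]
    by_cases h : nodeOf b = nodeOf a
    · simp [h]
    · simp [h]
  rw [h1]
  have hw := concat_mem_word hx hy
  have hs := concat_link_symm hx hy
  generalize concat x y = d at *
  rcases a with p | ⟨s, p⟩ <;> rcases c with q | ⟨t, q⟩
  · simp only [SameString] at hac
    rcases b with r | ⟨u, r⟩
    · simp only [nodeOf, hac, Link.node.injEq, Sum.inl.injEq]
      exact or_congr Iff.rfl eq_comm
    · have hr := (hw _ _).1 (mem_perimeter_inr.1 hb)
      simp only [nodeOf, hac, Link.node.injEq, reduceCtorEq, or_false, iff_false]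
      rintro (rfl | rfl)
      · rw [hac] at hr
        cases hr
      · rw [hs _ _ hac] at hr
        cases hr
  · obtain ⟨rfl, hac⟩ := hac
    rcases b with r | ⟨u, r⟩
    · simp [nodeOf, hac]
    · have hr := (hw _ _).1 (mem_perimeter_inr.1 hb)
      simp only [nodeOf, hac, reduceCtorEq, or_false, Sum.inr.injEq, Prod.mk.injEq, false_or]
      constructor
      · rintro rfl
        rw [hac] at hr
        cases hr
        exact ⟨rfl, rfl⟩
      · exact fun h => h.2
  · obtain ⟨rfl, hac⟩ := hac
    rcases b with r | ⟨u, r⟩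
    · simp [nodeOf, hac]
    · have hr := (hw _ _).1 (mem_perimeter_inr.1 hb)
      simp only [nodeOf, hac, reduceCtorEq, or_false, Sum.inr.injEq, Prod.mk.injEq]
      constructor
      · rintro rfl
        rw [hac] at hr
        cases hr
        exact ⟨rfl, rfl⟩
      · exact fun h => h.2
  · exact absurd hac (by simp [SameString])

/-- Which outer node `outerEnd` chooses is irrelevant, since all candidates lie on the string of
`v`. In the form required by `crossing_filterMap`, this moves counts from the words of the product
to those of the concatenation. -/
theorem setWeight_eq_elim_outerEnd (p : Node n) (v : CNode n) :
    setWeight ((stringGraph x y).Reachable (outer p)) v =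
      (outerEnd x y v).elim 0
        (setWeight fun q => (stringGraph x y).Reachable (outer p) (outer q)) := by
  rcases h : outerEnd x y v with _ | q
  · simp [setWeight, outerEnd_eq_none.1 h p]
  · have hq := reachable_of_outerEnd h
    simp only [setWeight, Option.elim_some]
    congr 1
    exact propext ⟨fun h => h.trans hq.symm, fun h => h.trans hq⟩

/-- In the perimeter of `x` the middle line is replaced by the rest of the perimeter of `y`. Modulo
two this rest has the same weights as the middle line, because the weights on the whole perimeter of
`y` vanish. The pairs within the middle line, counted once in each direction, contribute the product
of its two weights, which cancels against the pairs between the middle line and the rest of `y`. -/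
theorem crossing_concat_perimeter (hx : x.IsDiagram) (hy : y.IsDiagram) {p q : Node n}
    (hp : (concat x y).link p ≠ Link.empty) (hq : (concat x y).link q ≠ Link.empty)
    (hpq : ¬ (stringGraph x y).Reachable (outer p) (outer q)) :
    crossing (setWeight (fun r => (stringGraph x y).Reachable (outer p) (outer r)) ∘ nodeOf)
      (setWeight (fun r => (stringGraph x y).Reachable (outer q) (outer r)) ∘ nodeOf)
      (concat x y).perimeter = 0 := by
  have hdisj : ∀ v, (stringGraph x y).Reachable (outer p) v →
      ¬ (stringGraph x y).Reachable (outer q) v := fun v h h' => hpq (h.trans h'.symm)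
  have cx := crossing_perimeter hx (isStringClosed_inl hx hy hp) (isStringClosed_inl hx hy hq)
    fun v => hdisj _
  have cy := crossing_perimeter hy (isStringClosed_inr hx hy hp) (isStringClosed_inr hx hy hq)
    fun v => hdisj _
  have wp := weight_perimeter hy (isStringClosed_inr hx hy hp)
  have wq := weight_perimeter hy (isStringClosed_inr hx hy hq)
  set A := setWeight ((stringGraph x y).Reachable (outer p)) with hA
  set B := setWeight ((stringGraph x y).Reachable (outer q)) with hB
  have hAB : ∀ v, A v * B v = 0 := by
    intro v
    simp only [hA, hB, setWeight]
    split_ifs with h h'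
    · exact absurd h' (hdisj v h)
    all_goals simp
  have hglue : ∀ (r : Node n) i, setWeight ((stringGraph x y).Reachable (outer r))
      (Sum.inr (Sum.inl i)) = setWeight ((stringGraph x y).Reachable (outer r))
      (Sum.inl (Sum.inr i)) := by
    intro r i
    simp only [setWeight]
    congr 1
    exact propext ⟨fun h => h.trans (reachable_glue i).symm, fun h => h.trans (reachable_glue i)⟩
  -- The middle nodes are listed downwards in the perimeter of `x` and upwards in that of `y`.
  have hM := crossing_reverse (p := A ∘ fun i => Sum.inl (Sum.inr i))
    (q := B ∘ fun i => Sum.inl (Sum.inr i)) (fun i => hAB _) (List.finRange n)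
  have gA : (A ∘ fun i => Sum.inr (Sum.inl i)) = A ∘ fun i => Sum.inl (Sum.inr i) :=
    funext fun i => hglue p i
  have gB : (B ∘ fun i => Sum.inr (Sum.inl i)) = B ∘ fun i => Sum.inl (Sum.inr i) :=
    funext fun i => hglue q i
  have fc : ∀ s, crossing
      (setWeight fun r => (stringGraph x y).Reachable (outer p) (outer r))
      (setWeight fun r => (stringGraph x y).Reachable (outer q) (outer r))
      ((concat x y).word s).reduceOption = crossing A B (cWord x y s).reduceOption := by
    intro s
    rw [reduceOption_concat_word]
    exact crossing_filterMap (fun v _ => setWeight_eq_elim_outerEnd p v)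
      fun v _ => setWeight_eq_elim_outerEnd q v
  have fr : crossing
      (setWeight fun r => (stringGraph x y).Reachable (outer p) (outer r))
      (setWeight fun r => (stringGraph x y).Reachable (outer q) (outer r))
      ((concat x y).word Side.bottom).reduceOption.reverse =
        crossing A B (cWord x y Side.bottom).reduceOption.reverse := by
    rw [reduceOption_concat_word, ← List.filterMap_reverse]
    exact crossing_filterMap (fun v _ => setWeight_eq_elim_outerEnd p v)
      fun v _ => setWeight_eq_elim_outerEnd q v
  have fw : ∀ r s, weight
      (setWeight fun t => (stringGraph x y).Reachable (outer r) (outer t))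
      ((concat x y).word s).reduceOption =
        weight (setWeight ((stringGraph x y).Reachable (outer r))) (cWord x y s).reduceOption := by
    intro r s
    rw [reduceOption_concat_word]
    exact weight_filterMap fun v _ => setWeight_eq_elim_outerEnd r v
  have eA : setWeight (fun r => (stringGraph x y).Reachable (outer p) (outer r)) = A ∘ outer := rfl
  have eB : setWeight (fun r => (stringGraph x y).Reachable (outer q) (outer r)) = B ∘ outer := rfl
  have eAl : setWeight (fun r => (stringGraph x y).Reachable (outer p) (Sum.inl r)) =
    A ∘ Sum.inl := rfl
  have eBl : setWeight (fun r => (stringGraph x y).Reachable (outer q) (Sum.inl r)) =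
    B ∘ Sum.inl := rfl
  have eAr : setWeight (fun r => (stringGraph x y).Reachable (outer p) (Sum.inr r)) =
    A ∘ Sum.inr := rfl
  have eBr : setWeight (fun r => (stringGraph x y).Reachable (outer q) (Sum.inr r)) =
    B ∘ Sum.inr := rfl
  rw [eA, eB] at fc fr
  have fwp := fw p
  have fwq := fw q
  rw [eA, ← hA] at fwp
  rw [eB, ← hB] at fwq
  rw [eAl, eBl] at cx
  rw [eAr, eBr] at cy
  rw [eAr] at wp
  rw [eBr] at wq
  rw [eA, eB]
  rw [← crossing_map, map_nodeOf_perimeter] at cx cy ⊢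
  rw [← weight_map, map_nodeOf_perimeter] at wp wq
  have oA1 : (A ∘ outer) ∘ Sum.inl = A ∘ fun i => Sum.inl (Sum.inl i) := rfl
  have oA2 : (A ∘ outer) ∘ Sum.inr = A ∘ fun i => Sum.inr (Sum.inr i) := rfl
  have oB1 : (B ∘ outer) ∘ Sum.inl = B ∘ fun i => Sum.inl (Sum.inl i) := rfl
  have oB2 : (B ∘ outer) ∘ Sum.inr = B ∘ fun i => Sum.inr (Sum.inr i) := rfl
  have cA1 : (A ∘ Sum.inl) ∘ Sum.inl = A ∘ fun i => Sum.inl (Sum.inl i) := rfl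
  have cA2 : (A ∘ Sum.inl) ∘ Sum.inr = A ∘ fun i => Sum.inl (Sum.inr i) := rfl
  have cA3 : (A ∘ Sum.inr) ∘ Sum.inl = A ∘ fun i => Sum.inr (Sum.inl i) := rfl
  have cA4 : (A ∘ Sum.inr) ∘ Sum.inr = A ∘ fun i => Sum.inr (Sum.inr i) := rfl
  have cB1 : (B ∘ Sum.inl) ∘ Sum.inl = B ∘ fun i => Sum.inl (Sum.inl i) := rfl
  have cB2 : (B ∘ Sum.inl) ∘ Sum.inr = B ∘ fun i => Sum.inl (Sum.inr i) := rfl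
  have cB3 : (B ∘ Sum.inr) ∘ Sum.inl = B ∘ fun i => Sum.inr (Sum.inl i) := rfl
  have cB4 : (B ∘ Sum.inr) ∘ Sum.inr = B ∘ fun i => Sum.inr (Sum.inr i) := rfl
  simp only [crossing_append, weight_append, crossing_map, weight_map, fc, fr, fwp, fwq,
    reduceOption_cWord, weight_reverse, List.reverse_append, ← List.map_reverse, oA1, oA2, oB1,
    oB2] at cx cy wp wq ⊢
  simp only [cA1, cA2, cA3, cA4, cB1, cB2, cB3, cB4, gA, gB]
    at cx cy wp wq ⊢
  have two : (2 : ZMod 2) = 0 := rfl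
  generalize weight (A ∘ fun i => Sum.inl (Sum.inl i)) (List.finRange n) = aL at *
  generalize weight (A ∘ fun i => Sum.inl (Sum.inr i)) (List.finRange n) = aM at *
  generalize weight (A ∘ fun i => Sum.inr (Sum.inr i)) (List.finRange n) = aR at *
  generalize weight (B ∘ fun i => Sum.inl (Sum.inr i)) (List.finRange n) = bM at *
  generalize weight (B ∘ fun i => Sum.inr (Sum.inr i)) (List.finRange n) = bR at *
  generalize weight (A ∘ Sum.inl) (x.word Side.top).reduceOption = aT at *
  generalize weight (A ∘ Sum.inl) (x.word Side.bottom).reduceOption = aB at *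
  generalize weight (A ∘ Sum.inr) (y.word Side.top).reduceOption = aS at *
  generalize weight (A ∘ Sum.inr) (y.word Side.bottom).reduceOption = aC at *
  generalize weight (B ∘ Sum.inl) (x.word Side.top).reduceOption = bT at *
  generalize weight (B ∘ Sum.inl) (x.word Side.bottom).reduceOption = bB at *
  generalize weight (B ∘ Sum.inr) (y.word Side.top).reduceOption = bS at *
  generalize weight (B ∘ Sum.inr) (y.word Side.bottom).reduceOption = bC at *
  -- The terms with `wp` and `wq` exchange the weights of the middle line for those of the rest of
  -- the perimeter of `y`; the last term collects what is counted twice.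
  linear_combination cx + cy - hM + (aL + aT - aM) * wq + bB * wp - ((aL + aT) * bM + aM * bB) * two

/-- The product of two diagrams is a diagram. -/
theorem isDiagram_concat (hx : x.IsDiagram) (hy : y.IsDiagram) : (concat x y).IsDiagram where
  link_ne p h := ((concat_link_eq_node hx hy).1 h).1 rfl
  link_symm := concat_link_symm hx hy
  mem_word := concat_mem_word hx hy
  nodup := concat_nodup hx hy
  even s := by
    rw [concat_word, even_length_reduceGhosts, List.length_map]
    exact even_length_cWord hx hy s
  reduced s := reduced_reduceGhosts _
  nonCrossing := by
    intro a b c e hl hac hbe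
    have hnd := nodup_perimeter (concat_nodup hx hy)
    have hm := hl.subset
    have ha : a ∈ (concat x y).perimeter := hm (by simp)
    have hb : b ∈ (concat x y).perimeter := hm (by simp)
    have hlink : ∀ a c, (concat x y).SameString a c →
        (concat x y).link (nodeOf a) ≠ Link.empty := by
      rintro (p | ⟨s, p⟩) (q | ⟨t, q⟩) h h'
      · exact absurd (h.symm.trans h') (by simp)
      · exact absurd (h.2.symm.trans h') (by simp)
      · obtain ⟨rfl, h⟩ := h
        exact absurd (h.symm.trans h') (by simp)
      · exact h
    have hdist := hl.nodup hnd
    simp only [List.nodup_cons, List.mem_cons, List.not_mem_nil, or_false, not_or,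
      not_false_eq_true, List.nodup_nil, and_true] at hdist
    -- The point `b` differs from `a` and `c`, which are the only points of the perimeter on their
    -- string, so the two strings are different components.
    have key := crossing_concat_perimeter hx hy (hlink a c hac) (hlink b e hbe) (by
      rw [reachable_nodeOf_iff hx hy ha hb hac]
      tauto)
    have hpt : ∀ a c, a ∈ (concat x y).perimeter → a ≠ c → (concat x y).SameString a c →
        ∀ b ∈ (concat x y).perimeter,
        (setWeight (fun r => (stringGraph x y).Reachable (outer (nodeOf a)) (outer r)) ∘ nodeOf) b =
          (pointWeight a + pointWeight c) b := by
      intro a c ha hne hac b hb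
      simp only [Function.comp_apply, setWeight, reachable_nodeOf_iff hx hy ha hb hac,
        Pi.add_apply, pointWeight]
      by_cases h1 : b = a
      · subst h1
        simp [hne]
      · simp [h1]
    -- The weight of each string is concentrated at its two ends, so the vanishing crossing number
    -- would have to equal one.
    rw [crossing_congr (hpt a c ha (by tauto) hac) (hpt b e hb (by tauto) hbe),
      crossing_of_sublist hnd hl] at key
    exact one_ne_zero key

end Planarity

/-! ### Contracting a part of a graph to its outer vertices -/

section Coarsening

variable {U V W N M : Type*}

/-- The vertices of `T` are those of `D` (through `A`) and further ones (through `B`); in `C` the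
graph `D` is replaced by its outer vertices `o p`, two of which are connected in `C` when they are
connected in `D`. -/
structure Coarsening (D : SimpleGraph U) (T : SimpleGraph V) (C : SimpleGraph W) (o : N → U)
    (A : U → V) (B : M → V) (i : N → W) (j : M → W) (φ : W → V) : Prop where
  bijective : Function.Bijective (Sum.elim A B)
  surjective : Function.Surjective (Sum.elim i j)
  φ_i : ∀ p, φ (i p) = A (o p)
  φ_j : ∀ m, φ (j m) = B m
  adj_T : ∀ v v', T.Adj v v' → (∃ u u', v = A u ∧ v' = A u' ∧ D.Reachable u u') ∨
    ∃ w w', v = φ w ∧ v' = φ w' ∧ C.Reachable w w'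
  adj_D : ∀ u u', D.Adj u u' → T.Reachable (A u) (A u')
  adj_C : ∀ w w', C.Adj w w' → T.Reachable (φ w) (φ w')
  reachable_i : ∀ p q, D.Reachable (o p) (o q) → C.Reachable (i p) (i q)

theorem apply_eq_of_reachable {X : Type*} {G : SimpleGraph V} (f : V → X)
    (h : ∀ v v', G.Adj v v' → f v = f v') {v v' : V} (hr : G.Reachable v v') : f v = f v' := by
  obtain ⟨w⟩ := hr
  induction w with
  | nil => rfl
  | cons ha _ ih => exact (h _ _ ha).trans ih

theorem reachable_map_of_adj {G : SimpleGraph V} {H : SimpleGraph W} (f : V → W)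
    (h : ∀ v v', G.Adj v v' → H.Reachable (f v) (f v')) {v v' : V} (hr : G.Reachable v v') :
    H.Reachable (f v) (f v') := by
  obtain ⟨w⟩ := hr
  induction w with
  | nil => exact SimpleGraph.Reachable.refl _
  | cons ha _ ih => exact (h _ _ ha).trans ih

namespace Coarsening

variable {D : SimpleGraph U} {T : SimpleGraph V} {C : SimpleGraph W} {o : N → U}
  {A : U → V} {B : M → V} {i : N → W} {j : M → W} {φ : W → V}

/-- The component of `C` or of `D` that corresponds to the component of a vertex of `T`. -/
def component (h : Coarsening D T C o A B i j φ) (v : V) :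
    C.ConnectedComponent ⊕ D.ConnectedComponent :=
  Sum.elim (fun u => if h : ∃ p, D.Reachable (o p) u then
      Sum.inl (C.connectedComponentMk (i h.choose)) else Sum.inr (D.connectedComponentMk u))
    (fun m => Sum.inl (C.connectedComponentMk (j m)))
    ((Equiv.ofBijective _ h.bijective).symm v)

/-- The field `reachable_i` makes the result independent of the outer vertex chosen in `component`.
-/
theorem component_A_of_reachable (h : Coarsening D T C o A B i j φ) {p : N} {u : U} (hp : D.Reachable (o p) u) :
    h.component (A u) = Sum.inl (C.connectedComponentMk (i p)) := by
  have e : (Equiv.ofBijective _ h.bijective).symm (A u) = Sum.inl u := by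
    rw [Equiv.symm_apply_eq]
    rfl
  have hex : ∃ p, D.Reachable (o p) u := ⟨p, hp⟩
  rw [component, e, Sum.elim_inl, dif_pos hex]
  congr 1
  exact SimpleGraph.ConnectedComponent.sound (h.reachable_i _ _ (hex.choose_spec.trans hp.symm))

theorem component_A_of_not_reachable (h : Coarsening D T C o A B i j φ) {u : U} (hp : ∀ p, ¬ D.Reachable (o p) u) :
    h.component (A u) = Sum.inr (D.connectedComponentMk u) := by
  have e : (Equiv.ofBijective _ h.bijective).symm (A u) = Sum.inl u := by
    rw [Equiv.symm_apply_eq]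
    rfl
  rw [component, e, Sum.elim_inl, dif_neg (not_exists.2 hp)]

theorem component_B (h : Coarsening D T C o A B i j φ) (m : M) : h.component (B m) = Sum.inl (C.connectedComponentMk (j m)) := by
  have e : (Equiv.ofBijective _ h.bijective).symm (B m) = Sum.inr m := by
    rw [Equiv.symm_apply_eq]
    rfl
  rw [component, e, Sum.elim_inr]

theorem component_φ (h : Coarsening D T C o A B i j φ) (w : W) : h.component (φ w) = Sum.inl (C.connectedComponentMk w) := by
  obtain ⟨p | m, rfl⟩ := h.surjective w
  · rw [Sum.elim_inl, h.φ_i, h.component_A_of_reachable (SimpleGraph.Reachable.refl _)]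
  · rw [Sum.elim_inr, h.φ_j, h.component_B]

theorem component_A_eq (h : Coarsening D T C o A B i j φ) {u u' : U} (hu : D.Reachable u u') :
    h.component (A u) = h.component (A u') := by
  by_cases hp : ∃ p, D.Reachable (o p) u
  · obtain ⟨p, hp⟩ := hp
    rw [h.component_A_of_reachable hp, h.component_A_of_reachable (hp.trans hu)]
  · have hp' := not_exists.1 hp
    rw [h.component_A_of_not_reachable hp',
      h.component_A_of_not_reachable fun p hpu => hp' p (hpu.trans hu.symm)]
    congr 1
    exact SimpleGraph.ConnectedComponent.sound hu

/-- An edge of `T` comes from connectivity in `D` or in `C`, and `component` respects both. This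
invariant shows that `T` makes no identifications beyond those of `C` and `D`, which is the hard
half of the equivalences below. -/
theorem component_eq_of_reachable (h : Coarsening D T C o A B i j φ) {v v' : V} (hv : T.Reachable v v') :
    h.component v = h.component v' := by
  refine apply_eq_of_reachable h.component ?_ hv
  intro v v' ha
  rcases h.adj_T v v' ha with ⟨u, u', rfl, rfl, hu⟩ | ⟨w, w', rfl, rfl, hw⟩
  · exact h.component_A_eq hu
  · rw [h.component_φ, h.component_φ]
    congr 1
    exact SimpleGraph.ConnectedComponent.sound hw

theorem reachable_A (h : Coarsening D T C o A B i j φ) {u u' : U} (hu : D.Reachable u u') : T.Reachable (A u) (A u') :=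
  reachable_map_of_adj A h.adj_D hu

theorem reachable_φ_iff (h : Coarsening D T C o A B i j φ) {w w' : W} : T.Reachable (φ w) (φ w') ↔ C.Reachable w w' := by
  refine ⟨fun hw => ?_, fun hw => reachable_map_of_adj φ h.adj_C hw⟩
  have := h.component_eq_of_reachable hw
  rw [h.component_φ, h.component_φ] at this
  exact SimpleGraph.ConnectedComponent.exact (Sum.inl_injective this)

theorem reachable_A_iff (h : Coarsening D T C o A B i j φ) {u u' : U} (hu : ∀ p, ¬ D.Reachable (o p) u) :
    T.Reachable (A u) (A u') ↔ D.Reachable u u' := by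
  refine ⟨fun hr => ?_, h.reachable_A⟩
  have := h.component_eq_of_reachable hr
  rw [h.component_A_of_not_reachable hu] at this
  by_cases hp : ∃ p, D.Reachable (o p) u'
  · obtain ⟨p, hp⟩ := hp
    rw [h.component_A_of_reachable hp] at this
    cases this
  · rw [h.component_A_of_not_reachable (not_exists.1 hp)] at this
    exact SimpleGraph.ConnectedComponent.exact (Sum.inr_injective this)

theorem exists_reachable_of_A_φ (h : Coarsening D T C o A B i j φ) {u : U} {w : W} (hr : T.Reachable (A u) (φ w)) :
    ∃ p, D.Reachable (o p) u := by
  by_contra hp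
  have := h.component_eq_of_reachable hr
  rw [h.component_A_of_not_reachable (not_exists.1 hp), h.component_φ] at this
  cases this

theorem reachable_A_φ (h : Coarsening D T C o A B i j φ) {p : N} {u : U} (hp : D.Reachable (o p) u) :
    T.Reachable (A u) (φ (i p)) := by
  rw [h.φ_i]
  exact h.reachable_A hp.symm

theorem cases_V (h : Coarsening D T C o A B i j φ) (v : V) : (∃ u, v = A u) ∨ ∃ m, v = φ (j m) := by
  obtain ⟨u | m, rfl⟩ := h.bijective.2 v
  · exact Or.inl ⟨u, rfl⟩
  · exact Or.inr ⟨m, (h.φ_j m).symm⟩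

theorem reachable_φ_B (h : Coarsening D T C o A B i j φ) {w : W} {m : M} : T.Reachable (φ w) (B m) ↔ C.Reachable w (j m) := by
  rw [← h.φ_j, h.reachable_φ_iff]

end Coarsening

/-- The number of components without a vertex satisfying `P`. -/
def closedCount (G : SimpleGraph V) (P : V → Prop) : ℕ :=
  Nat.card {c : G.ConnectedComponent // ∀ v ∈ c.supp, ¬ P v}

theorem mk_closed_iff {G : SimpleGraph V} {P : V → Prop} {v : V} :
    (∀ w ∈ (G.connectedComponentMk v).supp, ¬ P w) ↔ ∀ w, G.Reachable v w → ¬ P w := by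
  refine forall_congr' fun w => ?_
  rw [SimpleGraph.ConnectedComponent.mem_supp_iff, SimpleGraph.ConnectedComponent.eq,
    SimpleGraph.reachable_comm]

/-- A closed component of `T` either meets the image of `φ`, and then comes from a closed component
of `C`, or lies inside `D` away from all outer vertices. Here `E` marks the ends inside `D` that
remain ends in `T`, and `K` the outer vertices of `D` that are still outer in `T`; contraction makes
an end of type `E` visible at the vertices `i p` of its string. -/
theorem Coarsening.closedCount_eq [Finite V] [Finite W] [Finite U] {D : SimpleGraph U}
    {T : SimpleGraph V} {C : SimpleGraph W} {o : N → U}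
    {A : U → V} {B : M → V} {i : N → W} {j : M → W} {φ : W → V}
    (h : Coarsening D T C o A B i j φ) {PD : U → Prop} {PT : V → Prop} {PC : W → Prop}
    (E : U → Prop) (K : N → Prop)
    (hD : ∀ u, PD u ↔ E u ∨ ∃ p, u = o p)
    (hTA : ∀ u, PT (A u) ↔ E u ∨ ∃ p, K p ∧ u = o p)
    (hTB : ∀ m, PT (B m) ↔ PC (j m))
    (hC : ∀ p, PC (i p) ↔ K p ∨ ∃ u, E u ∧ D.Reachable (o p) u) :
    closedCount T PT = closedCount C PC + closedCount D PD := by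
  have closed_C : ∀ w, (∀ v, T.Reachable (φ w) v → ¬ PT v) ↔ ∀ w', C.Reachable w w' → ¬ PC w' := by
    intro w
    constructor
    · intro hw w' hr
      obtain ⟨p | m, rfl⟩ := h.surjective w'
      · rw [Sum.elim_inl] at hr ⊢
        have hr' := h.reachable_φ_iff.2 hr
        rw [hC]
        rintro (hk | ⟨u, hu, hup⟩)
        · exact hw _ hr' ((h.φ_i p).symm ▸ (hTA _).2 (Or.inr ⟨p, hk, rfl⟩))
        · exact hw _ (hr'.trans (h.reachable_A_φ hup).symm) ((hTA _).2 (Or.inl hu))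
      · rw [Sum.elim_inr] at hr ⊢
        rw [← hTB]
        exact hw _ (h.reachable_φ_B.2 hr)
    · intro hw v hr
      rcases h.cases_V v with ⟨u, rfl⟩ | ⟨m, rfl⟩
      · obtain ⟨p, hp⟩ := h.exists_reachable_of_A_φ hr.symm
        have hwp := h.reachable_φ_iff.1 (hr.trans (h.reachable_A_φ hp))
        rw [hTA]
        rintro (hu | ⟨q, hq, rfl⟩)
        · exact hw _ hwp ((hC p).2 (Or.inr ⟨u, hu, hp⟩))
        · exact hw _ (hwp.trans (h.reachable_i _ _ hp)) ((hC q).2 (Or.inl hq))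
      · rw [h.φ_j, hTB]
        exact hw _ (h.reachable_φ_iff.1 hr)
  have closed_D : ∀ u, (∀ u', D.Reachable u u' → ¬ PD u') ↔
      (∀ p, ¬ D.Reachable (o p) u) ∧ ∀ v, T.Reachable (A u) v → ¬ PT v := by
    intro u
    constructor
    · intro hu
      have hn : ∀ p, ¬ D.Reachable (o p) u := fun p hp =>
        hu _ hp.symm ((hD _).2 (Or.inr ⟨p, rfl⟩))
      refine ⟨hn, fun v hr => ?_⟩
      rcases h.cases_V v with ⟨u', rfl⟩ | ⟨m, rfl⟩
      · have hr' := (h.reachable_A_iff hn).1 hr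
        rw [hTA]
        rintro (hu' | ⟨q, hq, rfl⟩)
        · exact hu _ hr' ((hD _).2 (Or.inl hu'))
        · exact hn q hr'.symm
      · obtain ⟨p, hp⟩ := h.exists_reachable_of_A_φ hr
        exact absurd hp (hn p)
    · rintro ⟨hn, hu⟩ u' hr
      rw [hD]
      rintro (hu' | ⟨q, rfl⟩)
      · exact hu _ (h.reachable_A hr) ((hTA _).2 (Or.inl hu'))
      · exact hn q hr.symm
  have hCl : ∀ w w', C.Reachable w w' → T.connectedComponentMk (φ w) =
      T.connectedComponentMk (φ w') := fun w w' hr =>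
    SimpleGraph.ConnectedComponent.sound (h.reachable_φ_iff.2 hr)
  have hDl : ∀ u u', D.Reachable u u' → T.connectedComponentMk (A u) =
      T.connectedComponentMk (A u') := fun u u' hr =>
    SimpleGraph.ConnectedComponent.sound (h.reachable_A hr)
  let f : {c : C.ConnectedComponent // ∀ v ∈ c.supp, ¬ PC v} ⊕
      {c : D.ConnectedComponent // ∀ v ∈ c.supp, ¬ PD v} →
      {c : T.ConnectedComponent // ∀ v ∈ c.supp, ¬ PT v} :=
    Sum.elim
      (fun c => ⟨Quot.lift (fun w => T.connectedComponentMk (φ w)) hCl c.1, by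
        obtain ⟨c, hc⟩ := c
        induction c using Quot.ind with
        | mk w => exact mk_closed_iff.2 ((closed_C w).2 (mk_closed_iff.1 hc))⟩)
      (fun c => ⟨Quot.lift (fun u => T.connectedComponentMk (A u)) hDl c.1, by
        obtain ⟨c, hc⟩ := c
        induction c using Quot.ind with
        | mk u => exact mk_closed_iff.2 ((closed_D u).1 (mk_closed_iff.1 hc)).2⟩)
  have hf : Function.Bijective f := by
    constructor
    · rintro (⟨c, hc⟩ | ⟨c, hc⟩) (⟨c', hc'⟩ | ⟨c', hc'⟩) heq <;>
        induction c using Quot.ind <;> induction c' using Quot.ind <;>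
        rename_i a b <;> have heq' := congrArg Subtype.val heq
      · have e := SimpleGraph.ConnectedComponent.exact heq'
        congr 2
        exact SimpleGraph.ConnectedComponent.sound (h.reachable_φ_iff.1 e)
      · have e := SimpleGraph.ConnectedComponent.exact heq'
        obtain ⟨p, hp⟩ := h.exists_reachable_of_A_φ e.symm
        exact absurd hp (((closed_D b).1 (mk_closed_iff.1 hc')).1 p)
      · have e := SimpleGraph.ConnectedComponent.exact heq'
        obtain ⟨p, hp⟩ := h.exists_reachable_of_A_φ e
        exact absurd hp (((closed_D a).1 (mk_closed_iff.1 hc)).1 p)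
      · have e := SimpleGraph.ConnectedComponent.exact heq'
        congr 2
        exact SimpleGraph.ConnectedComponent.sound
          ((h.reachable_A_iff ((closed_D a).1 (mk_closed_iff.1 hc)).1).1 e)
    · rintro ⟨c, hc⟩
      induction c using Quot.ind with
      | mk v =>
        have hv := mk_closed_iff.1 hc
        -- This settles all components that contain a vertex `B m` or are connected to some `o p`;
        -- the others come from `D`.
        have of_φ : ∀ w, T.Reachable v (φ w) → ∃ a, f a = ⟨T.connectedComponentMk v, hc⟩ := by
          intro w hw
          refine ⟨Sum.inl ⟨C.connectedComponentMk w,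
            mk_closed_iff.2 ((closed_C w).1 fun v' hr => hv v' (hw.trans hr))⟩, ?_⟩
          apply Subtype.ext
          exact SimpleGraph.ConnectedComponent.sound hw.symm
        rcases h.cases_V v with ⟨u, rfl⟩ | ⟨m, rfl⟩
        · by_cases hp : ∃ p, D.Reachable (o p) u
          · obtain ⟨p, hp⟩ := hp
            exact of_φ _ (h.reachable_A_φ hp)
          · exact ⟨Sum.inr ⟨D.connectedComponentMk u,
              mk_closed_iff.2 ((closed_D u).2 ⟨not_exists.1 hp, hv⟩)⟩, rfl⟩
        · exact of_φ _ (SimpleGraph.Reachable.refl _)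
  unfold closedCount
  rw [← Nat.card_sum]
  exact (Nat.card_eq_of_bijective f hf).symm

end Coarsening

/-! ### Diagrams and factors read off a graph -/

section Contract

variable {n : ℕ} {V W U : Type*}

/-- The diagram whose strings are the components of `G` through the vertices `o p`, with the words
obtained from `w` by replacing the endpoints on all other components by ghosts. -/
def contract (G : SimpleGraph V) (o : Node n → V) (w : Side → List (Option V)) : RawDiagram n where
  link p :=
    if h : ∃ q, q ≠ p ∧ G.Reachable (o p) (o q) then Link.node h.choose
    else if h : ∃ s, ∃ v, some v ∈ w s ∧ G.Reachable (o p) v then Link.boundary h.choose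
    else Link.empty
  word s := reduceGhosts ((w s).map fun m => m.bind fun v =>
    if h : ∃ p, G.Reachable (o p) v then some h.choose else none)

theorem concat_eq_contract (x y : RawDiagram n) :
    concat x y = contract (stringGraph x y) outer (cWord x y) := by
  unfold concat contract
  congr!

theorem reduceGhosts_map_reduceGhosts {α β : Type*} {g : Option α → Option β} (hg : g none = none)
    (w : List (Option α)) : reduceGhosts ((reduceGhosts w).map g) = reduceGhosts (w.map g) := by
  simpa using reduceGhosts_map_append hg w []

variable {T : SimpleGraph V} {C : SimpleGraph W} {φ : W → V} {π : V → Option W}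

theorem some_mem_map_bind {α β : Type*} {f : α → Option β} {w : List (Option α)} {b : β} :
    some b ∈ w.map (fun m => m.bind f) ↔ ∃ a, some a ∈ w ∧ f a = some b := by
  simp only [List.mem_map]
  constructor
  · rintro ⟨m, hm, h⟩
    rcases m with _ | a
    · cases h
    · exact ⟨a, hm, h⟩
  · rintro ⟨a, ha, h⟩
    exact ⟨some a, ha, h⟩

/-- The contracted diagram depends only on which endpoints and outer vertices are connected, and `φ`
and `π` preserve this. The words are compared only up to cancellation of ghosts, because an inner
product has already cancelled some. -/
theorem contract_eq {oT : Node n → V} {oC : Node n → W} {wT : Side → List (Option V)}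
    {wC : Side → List (Option W)}
    (hφ : ∀ w w', T.Reachable (φ w) (φ w') ↔ C.Reachable w w') (ho : ∀ p, φ (oC p) = oT p)
    (hsome : ∀ v w, π v = some w → T.Reachable v (φ w))
    (hnone : ∀ v, π v = none → ∀ w, ¬ T.Reachable v (φ w))
    (hword : ∀ s, reduceGhosts (wC s) = reduceGhosts ((wT s).map fun m => m.bind π)) :
    contract T oT wT = contract C oC wC := by
  have hmem : ∀ s w, some w ∈ wC s ↔ ∃ v, some v ∈ wT s ∧ π v = some w := by
    intro s w
    rw [← some_mem_reduceGhosts, hword, some_mem_reduceGhosts, some_mem_map_bind]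
  have h1 : ∀ p q, T.Reachable (oT p) (oT q) ↔ C.Reachable (oC p) (oC q) := by
    intro p q
    rw [← ho, ← ho, hφ]
  have h3 : ∀ p v w, π v = some w → (T.Reachable (oT p) v ↔ C.Reachable (oC p) w) := by
    intro p v w hvw
    rw [← hφ, ho]
    exact ⟨fun h => h.trans (hsome v w hvw), fun h => h.trans (hsome v w hvw).symm⟩
  have h4 : ∀ p v, π v = none → ¬ T.Reachable (oT p) v := by
    intro p v hv h
    rw [← ho] at h
    exact hnone v hv _ h.symm
  have h2 : ∀ p s, (∃ v, some v ∈ wT s ∧ T.Reachable (oT p) v) ↔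
      ∃ w, some w ∈ wC s ∧ C.Reachable (oC p) w := by
    intro p s
    constructor
    · rintro ⟨v, hv, hr⟩
      rcases hw : π v with _ | w
      · exact absurd hr (h4 p v hw)
      · exact ⟨w, (hmem s w).2 ⟨v, hv, hw⟩, (h3 p v w hw).1 hr⟩
    · rintro ⟨w, hw, hr⟩
      obtain ⟨v, hv, hvw⟩ := (hmem s w).1 hw
      exact ⟨v, hv, (h3 p v w hvw).2 hr⟩
  have hlink : (contract T oT wT).link = (contract C oC wC).link := by
    funext p
    simp only [contract, h1, h2]
  have hword' : (contract T oT wT).word = (contract C oC wC).word := by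
    funext s
    simp only [contract]
    rw [← reduceGhosts_map_reduceGhosts (Option.bind_none _) (wC s), hword,
      reduceGhosts_map_reduceGhosts (Option.bind_none _), List.map_map]
    congr 1
    apply List.map_congr_left
    intro m _
    rcases m with _ | v
    · rfl
    · simp only [Function.comp_apply, Option.bind_some]
      rcases hw : π v with _ | w
      · rw [dif_neg (not_exists.2 fun p => h4 p v hw), Option.bind_none]
      · simp only [h3 _ v w hw, Option.bind_some]
  rw [RawDiagram.mk.injEq]
  exact ⟨hlink, hword'⟩

variable {R : Type*}

/-- The parameter of a boundary arc with both ends on `s`, in terms of the parities of its ends. -/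
def sideParam (P : Params R) (s : Side) (b c : Bool) : R := P.sameSide s b.toNat c.toNat

/-- The parameter of a boundary arc between the two boundaries, in terms of the parities of its
ends. -/
def acrossParam (P : Params R) (b c : Bool) : R := P.acrossSides b.toNat c.toNat

variable [CommRing R]

/-- The product of the parameters of the boundary arcs given by the components of `G`. -/
def arcFactor (P : Params R) (G : SimpleGraph V) (w : Side → List (Option V)) : R :=
  pairProd G.Reachable (sideParam P Side.top) (labels true (w Side.top)) *
    pairProd G.Reachable (sideParam P Side.bottom) (labels true (w Side.bottom)) *
    crossProd G.Reachable (acrossParam P) (labels true (w Side.top))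
      (labels true (w Side.bottom))

theorem labels_eq_of_reduceGhosts_eq {α : Type*} {w w' : List (Option α)}
    (h : reduceGhosts w = reduceGhosts w') (b : Bool) : labels b w = labels b w' := by
  rw [← labels_reduceGhosts, h, labels_reduceGhosts]

theorem pairProd_eq_one {r : V → V → Prop} (f : Bool → Bool → R) {l : List (V × Bool)}
    (hr : l.Pairwise fun a c => ¬ r a.1 c.1) : pairProd r f l = 1 := by
  induction l with
  | nil => rfl
  | cons a l ih =>
    rw [List.pairwise_cons] at hr
    rw [pairProd, ih hr.2, mul_one]
    apply List.prod_eq_one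
    intro t ht
    obtain ⟨c, hc, rfl⟩ := List.mem_map.1 ht
    rw [if_neg (hr.1 c hc)]

theorem crossProd_eq_one {r : V → V → Prop} (f : Bool → Bool → R) {l l' : List (V × Bool)}
    (hr : ∀ a ∈ l, ∀ c ∈ l', ¬ r a.1 c.1) : crossProd r f l l' = 1 := by
  apply List.prod_eq_one
  intro t ht
  obtain ⟨a, ha, rfl⟩ := List.mem_map.1 ht
  apply List.prod_eq_one
  intro t ht
  obtain ⟨c, hc, rfl⟩ := List.mem_map.1 ht
  rw [if_neg (hr a ha c hc)]

/-- Connected endpoints either both survive in `C` or are both dropped by `π`; in the latter case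
`hρ` identifies them as an arc of `D`. The condition `v ≠ v'` there matters: an endpoint of a string
that survives in `C` is connected to itself in `D` although `π` does not drop it. Only the labels of
`wD` must match, since the marks outside `D` may contribute further ghosts. -/
theorem arcFactor_split (P : Params R) {D : SimpleGraph U} {ρ : V → Option U}
    {wT : Side → List (Option V)} {wC : Side → List (Option W)} {wD : Side → List (Option U)}
    (hφ : ∀ w w', T.Reachable (φ w) (φ w') ↔ C.Reachable w w')
    (hsome : ∀ v w, π v = some w → T.Reachable v (φ w))
    (hnone : ∀ v, π v = none → ∀ w, ¬ T.Reachable v (φ w))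
    (hword : ∀ s, reduceGhosts (wC s) = reduceGhosts ((wT s).map fun m => m.bind π))
    (hnodup : ∀ s, (wT s).reduceOption.Nodup)
    (hdisj : ∀ v, some v ∈ wT Side.top → some v ∉ wT Side.bottom)
    (hρ : ∀ v v' s s', some v ∈ wT s → some v' ∈ wT s' → v ≠ v' →
      ((T.Reachable v v' ∧ π v = none ∧ π v' = none) ↔
        ∃ u u', ρ v = some u ∧ ρ v' = some u' ∧ D.Reachable u u'))
    (hwD : ∀ s, labels true (wD s) = labels true ((wT s).map fun m => m.bind ρ)) :
    arcFactor P T wT = arcFactor P D wD * arcFactor P C wC := by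
  -- By `hsome` and `hnone`, an endpoint with image under `π` is never connected to one without.
  have c1 : ∀ v v' (s : R), (if T.Reachable v v' then s else 1) =
      (if T.Reachable v v' ∧ π v = none ∧ π v' = none then s else 1) *
        optionFactor C.Reachable π s v v' := by
    intro v v' s
    rcases h : π v with _ | w
    · rcases h' : π v' with _ | w'
      · simp [optionFactor, h]
      · have hn : ¬ T.Reachable v v' := fun hr => hnone v h w' (hr.trans (hsome v' w' h'))
        simp [optionFactor, h, hn]
    · rcases h' : π v' with _ | w'
      · have hn : ¬ T.Reachable v v' := fun hr => hnone v' h' w (hr.symm.trans (hsome v w h))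
        simp [optionFactor, h, h', hn]
      · have hc : T.Reachable v v' ↔ C.Reachable w w' := by
          rw [← hφ]
          exact ⟨fun hr => ((hsome v w h).symm.trans hr).trans (hsome v' w' h'),
            fun hr => ((hsome v w h).trans hr).trans (hsome v' w' h').symm⟩
        simp [optionFactor, h, h', hc]
  have c2 : ∀ v v' t t', some v ∈ wT t → some v' ∈ wT t' → v ≠ v' → ∀ (s : R),
      (if T.Reachable v v' ∧ π v = none ∧ π v' = none then s else 1) =
      (if False then s else 1) * optionFactor D.Reachable ρ s v v' := by
    intro v v' t t' hv hv' hne s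
    simp only [hρ v v' t t' hv hv' hne]
    rcases h : ρ v with _ | u
    · simp [optionFactor, h]
    · rcases h' : ρ v' with _ | u'
      · simp [optionFactor, h, h']
      · simp [optionFactor, h, h']
  have lC : ∀ s, labels true (wC s) =
      (labels true (wT s)).filterMap fun a => (π a.1).map fun c => (c, a.2) := by
    intro s
    rw [labels_eq_of_reduceGhosts_eq (hword s), labels_map_bind]
  have lD : ∀ s, labels true (wD s) =
      (labels true (wT s)).filterMap fun a => (ρ a.1).map fun c => (c, a.2) := by
    intro s
    rw [hwD s, labels_map_bind]
  have hpair : ∀ s f, pairProd T.Reachable f (labels true (wT s)) =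
      (pairProd D.Reachable f (labels true (wD s)) *
        pairProd C.Reachable f (labels true (wC s)) : R) := by
    intro s f
    rw [lC, lD, pairProd_split (rT := T.Reachable) (rC := C.Reachable) (F := π)
      (rD := fun v v' => T.Reachable v v' ∧ π v = none ∧ π v' = none)
      ((pairwise_ne_labels true (hnodup s)).imp fun {a c} _ t => by convert c1 a.1 c.1 t)]
    congr 1
    -- After the second splitting no pairs remain, hence the empty relation: by `hρ` a dropped arc
    -- always has images under `ρ`.
    rw [pairProd_split (rC := D.Reachable) (F := ρ) (rD := fun _ _ => False),
      pairProd_eq_one _ (List.pairwise_of_forall fun _ _ => id), one_mul]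
    refine (pairwise_ne_labels true (hnodup s)).imp_of_mem ?_
    intro a c ha hc hne t
    convert c2 _ _ s s (some_mem_of_mem_labels ha) (some_mem_of_mem_labels hc) hne t
  have hcross : ∀ f, crossProd T.Reachable f (labels true (wT Side.top))
        (labels true (wT Side.bottom)) =
      (crossProd D.Reachable f (labels true (wD Side.top)) (labels true (wD Side.bottom)) *
        crossProd C.Reachable f (labels true (wC Side.top)) (labels true (wC Side.bottom)) : R) := by
    intro f
    rw [lC, lC, lD, lD, crossProd_split (rT := T.Reachable) (rC := C.Reachable) (F := π)
      (rD := fun v v' => T.Reachable v v' ∧ π v = none ∧ π v' = none)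
      (fun a _ c _ t => by convert c1 a.1 c.1 t)]
    congr 1
    rw [crossProd_split (rC := D.Reachable) (F := ρ) (rD := fun _ _ => False),
      crossProd_eq_one _ (fun _ _ _ _ => id), one_mul]
    intro a ha c hc
    have ha' := some_mem_of_mem_labels ha
    have hc' := some_mem_of_mem_labels hc
    have hne : a.1 ≠ c.1 := by
      intro e
      rw [e] at ha'
      exact hdisj _ ha' hc'
    intro t
    convert c2 _ _ _ _ ha' hc' hne t
  unfold arcFactor
  rw [hpair, hpair, hcross]
  ring

end Contract

/-! ### The factor of a concatenation -/

section Factor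

variable {n : ℕ} {R : Type*} (P : Params R) {x y : RawDiagram n}

theorem odd_iff_bodd (k : ℕ) : Odd k ↔ k.bodd = true := by
  rw [← Nat.not_even_iff_odd, Nat.even_iff, Nat.mod_two_of_bodd]
  cases k.bodd <;> simp

theorem even_iff_bodd (k : ℕ) : Even k ↔ k.bodd = false := by
  rw [← Nat.not_odd_iff_even, odd_iff_bodd]
  simp

theorem sameSide_eq (s : Side) (i j : ℕ) : P.sameSide s i j = sideParam P s i.bodd j.bodd := by
  cases s <;> simp only [sideParam, Params.sameSide, odd_iff_bodd, even_iff_bodd] <;>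
    cases i.bodd <;> cases j.bodd <;> simp

theorem acrossSides_eq (i j : ℕ) : P.acrossSides i j = acrossParam P i.bodd j.bodd := by
  simp only [acrossParam, Params.acrossSides, odd_iff_bodd, even_iff_bodd]
  cases i.bodd <;> cases j.bodd <;> simp

variable [CommRing R]

instance lawfulBEq_sum {α β : Type*} [BEq α] [BEq β] [LawfulBEq α] [LawfulBEq β] :
    LawfulBEq (α ⊕ β) where
  eq_of_beq := by
    rintro (a | a) (b | b) h
    · exact congrArg Sum.inl (eq_of_beq (α := α) h)
    · cases h
    · cases h
    · exact congrArg Sum.inr (eq_of_beq (α := β) h)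
  rfl := by
    rintro (a | a)
    · exact BEq.rfl (α := α)
    · exact BEq.rfl (α := β)

theorem prod_prod_toFinset {V : Type*} [Fintype V] [DecidableEq V] (l l' : List V) (g : V → V → R) :
    ∏ u ∈ l.toFinset, ∏ v ∈ l'.toFinset, g u v =
      ∏ u : V, ∏ v : V, if u ∈ l ∧ v ∈ l' then g u v else 1 := by
  have h1 : ∀ (l : List V) (f : V → R), ∏ u ∈ l.toFinset, f u =
      ∏ u : V, if u ∈ l then f u else 1 := by
    intro l f
    rw [← Finset.prod_filter]
    congr 1
    ext v
    simp
  rw [h1]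
  refine Finset.prod_congr rfl fun u _ => ?_
  by_cases hu : u ∈ l
  · simp [hu, h1]
  · simp [hu]

theorem sameSideFactor_eq (hx : x.IsDiagram) (hy : y.IsDiagram) (s : Side) :
    sameSideFactor P x y s =
      pairProd (stringGraph x y).Reachable (sideParam P s) (labels true (cWord x y s)) := by
  have hnd := nodup_cWord hx hy s
  rw [labels_eq_map_idxOf true hnd, pairProd_map_key (fun u => (cWord x y s).idxOf (some u)) _
    (pairwise_idxOf_reduceOption hnd), prod_prod_toFinset]
  unfold sameSideFactor
  refine Finset.prod_congr rfl fun u _ => Finset.prod_congr rfl fun v _ => ?_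
  -- Positions start at zero and numbers at one; the shift is the initial parity `true` of the
  -- labels.
  simp only [List.reduceOption_mem_iff, endNumber, Nat.add_lt_add_iff_right, sameSide_eq,
    Nat.bodd_succ, Bool.true_xor]
  rw [← ite_and]
  exact if_congr (by tauto) rfl rfl

theorem acrossFactor_eq (hx : x.IsDiagram) (hy : y.IsDiagram) :
    acrossFactor P x y = crossProd (stringGraph x y).Reachable (acrossParam P)
      (labels true (cWord x y Side.top)) (labels true (cWord x y Side.bottom)) := by
  have ht := nodup_cWord hx hy Side.top
  have hb := nodup_cWord hx hy Side.bottom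
  rw [labels_eq_map_idxOf true ht, labels_eq_map_idxOf true hb, crossProd_map_key _ _ ht hb,
    prod_prod_toFinset]
  unfold acrossFactor
  refine Finset.prod_congr rfl fun u _ => Finset.prod_congr rfl fun v _ => ?_
  simp only [List.reduceOption_mem_iff, endNumber, acrossSides_eq, Nat.bodd_succ, Bool.true_xor]
  rw [← ite_and]
  simp only [and_assoc]
  congr!

theorem loopCount_eq (x y : RawDiagram n) : loopCount x y =
    closedCount (stringGraph x y) fun v => IsTerminal x y v ∨ ∃ p, v = outer p := by
  unfold loopCount closedCount
  congr 1
  simp only [← not_isMiddle_iff, IsTerminal, not_or, not_not, not_forall, ne_eq, and_comm]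

theorem factor_eq (hx : x.IsDiagram) (hy : y.IsDiagram) : factor P x y =
    P.β ^ (closedCount (stringGraph x y) fun v => IsTerminal x y v ∨ ∃ p, v = outer p) *
      arcFactor P (stringGraph x y) (cWord x y) := by
  rw [factor, sameSideFactor_eq P hx hy, sameSideFactor_eq P hx hy, acrossFactor_eq P hx hy,
    loopCount_eq, arcFactor]
  ring

end Factor

/-! ### The concatenation of three diagrams -/

section Triple

variable {n : ℕ}

/-- The nodes of the concatenation of three diagrams. -/
abbrev TNode (n : ℕ) := Node n ⊕ (Node n ⊕ Node n)

section

variable (x y z : RawDiagram n)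

/-- Two nodes are joined by a string of one of the three factors, or are at the same place. -/
inductive TripleStep : TNode n → TNode n → Prop
  | left {p q : Node n} : x.link p = Link.node q → TripleStep (Sum.inl p) (Sum.inl q)
  | middle {p q : Node n} : y.link p = Link.node q →
      TripleStep (Sum.inr (Sum.inl p)) (Sum.inr (Sum.inl q))
  | right {p q : Node n} : z.link p = Link.node q →
      TripleStep (Sum.inr (Sum.inr p)) (Sum.inr (Sum.inr q))
  | glueLeft (i : Fin n) : TripleStep (Sum.inl (Sum.inr i)) (Sum.inr (Sum.inl (Sum.inl i)))
  | glueRight (i : Fin n) :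
      TripleStep (Sum.inr (Sum.inl (Sum.inr i))) (Sum.inr (Sum.inr (Sum.inl i)))

/-- The graph whose components are the strings of the concatenation of three diagrams. -/
def tripleGraph : SimpleGraph (TNode n) := SimpleGraph.fromRel (TripleStep x y z)

/-- The marks on the boundary `s` of the concatenation of three diagrams. -/
def tripleWord (s : Side) : List (Option (TNode n)) :=
  (x.word s).map (Option.map Sum.inl) ++ ((y.word s).map (Option.map (Sum.inr ∘ Sum.inl)) ++
    (z.word s).map (Option.map (Sum.inr ∘ Sum.inr)))

/-- The nodes on the left and right sides of the concatenation of three diagrams. -/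
def tripleOuter : Node n → TNode n
  | Sum.inl i => Sum.inl (Sum.inl i)
  | Sum.inr i => Sum.inr (Sum.inr (Sum.inr i))

/-- What a node of the concatenation of three diagrams is joined to within its own factor. -/
def tripleLink : TNode n → Link n
  | Sum.inl p => x.link p
  | Sum.inr (Sum.inl p) => y.link p
  | Sum.inr (Sum.inr p) => z.link p

/-- The diagram given by the concatenation of three diagrams. -/
def tripleConcat : RawDiagram n := contract (tripleGraph x y z) tripleOuter (tripleWord x y z)

/-- The node belongs to a string with an end. -/
def TripleEnd (v : TNode n) : Prop :=
  (∀ q, tripleLink x y z v ≠ Link.node q) ∨ ∃ p, v = tripleOuter p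

/-- The factor of the concatenation of three diagrams. -/
def tripleFactor {R : Type*} [CommRing R] (P : Params R) : R :=
  P.β ^ closedCount (tripleGraph x y z) (TripleEnd x y z) *
    arcFactor P (tripleGraph x y z) (tripleWord x y z)

end

variable {x y z : RawDiagram n}

theorem reachable_fromRel {V : Type*} {r : V → V → Prop} {a b : V} (h : r a b) :
    (SimpleGraph.fromRel r).Reachable a b := by
  by_cases hab : a = b
  · rw [hab]
  · exact SimpleGraph.Adj.reachable ⟨hab, Or.inl h⟩

theorem of_adj_fromRel {V : Type*} {r Q : V → V → Prop} (hsymm : ∀ a b, Q a b → Q b a)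
    (h : ∀ a b, r a b → Q a b) (a b : V) (hab : (SimpleGraph.fromRel r).Adj a b) : Q a b := by
  rcases hab.2 with h' | h'
  · exact h _ _ h'
  · exact hsymm _ _ (h _ _ h')

theorem concat_reachable (hx : x.IsDiagram) (hy : y.IsDiagram) {p q : Node n}
    (h : (stringGraph x y).Reachable (outer p) (outer q)) :
    p = q ∨ (concat x y).link p = Link.node q := by
  by_cases hpq : p = q
  · exact Or.inl hpq
  · exact Or.inr ((concat_link_eq_node hx hy).2 ⟨fun e => hpq e.symm, h⟩)

theorem adj_symm_aux {U V W : Type*} {D : SimpleGraph U} {C : SimpleGraph W} {A : U → V}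
    {φ : W → V} (v v' : V) (h : (∃ u u', v = A u ∧ v' = A u' ∧ D.Reachable u u') ∨
      ∃ w w', v = φ w ∧ v' = φ w' ∧ C.Reachable w w') :
    (∃ u u', v' = A u ∧ v = A u' ∧ D.Reachable u u') ∨
      ∃ w w', v' = φ w ∧ v = φ w' ∧ C.Reachable w w' := by
  rcases h with ⟨u, u', h1, h2, h3⟩ | ⟨w, w', h1, h2, h3⟩
  · exact Or.inl ⟨u', u, h2, h1, h3.symm⟩
  · exact Or.inr ⟨w', w, h2, h1, h3.symm⟩

/-- The first two factors, as a part of three. -/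
def firstTwo : CNode n → TNode n := Sum.map id Sum.inl

/-- The nodes of the concatenation of a product with a third diagram. -/
def ofLeftProduct : CNode n → TNode n := Sum.elim (firstTwo ∘ outer) (Sum.inr ∘ Sum.inr)

/-- The nodes of the concatenation of a diagram with a product. -/
def ofRightProduct : CNode n → TNode n := Sum.elim Sum.inl (Sum.inr ∘ outer)

/-- The contracted part is the concatenation of `x` and `y`, and the further vertices are those of
`z`. Connectivity among the outer nodes of this part is what the strings of `concat x y` record. -/
theorem coarsening_left (hx : x.IsDiagram) (hy : y.IsDiagram) :
    Coarsening (stringGraph x y) (tripleGraph x y z) (stringGraph (concat x y) z) outer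
      firstTwo (Sum.inr ∘ Sum.inr) Sum.inl Sum.inr ofLeftProduct := by
  have hD : ∀ u u', (stringGraph x y).Adj u u' →
      (tripleGraph x y z).Reachable (firstTwo u) (firstTwo u') := by
    refine of_adj_fromRel (fun a b h => h.symm) ?_
    rintro a b (h | h | i)
    · exact reachable_fromRel (TripleStep.left h)
    · exact reachable_fromRel (TripleStep.middle h)
    · exact reachable_fromRel (TripleStep.glueLeft i)
  refine ⟨⟨?_, ?_⟩, ?_, fun _ => rfl, fun _ => rfl, ?_, hD, ?_, ?_⟩
  · rintro ((p | p) | p) ((q | q) | q) h <;> simp_all [firstTwo]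
  · rintro (p | p | p)
    · exact ⟨Sum.inl (Sum.inl p), rfl⟩
    · exact ⟨Sum.inl (Sum.inr p), rfl⟩
    · exact ⟨Sum.inr p, rfl⟩
  · rintro (p | p)
    · exact ⟨Sum.inl p, rfl⟩
    · exact ⟨Sum.inr p, rfl⟩
  · refine of_adj_fromRel adj_symm_aux ?_
    rintro a b (h | h | h | i | i)
    · exact Or.inl ⟨Sum.inl _, Sum.inl _, rfl, rfl, reachable_fromRel (Step.left h)⟩
    · exact Or.inl ⟨Sum.inr _, Sum.inr _, rfl, rfl, reachable_fromRel (Step.right h)⟩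
    · exact Or.inr ⟨Sum.inr _, Sum.inr _, rfl, rfl, reachable_fromRel (Step.right h)⟩
    · exact Or.inl ⟨Sum.inl _, Sum.inr _, rfl, rfl, reachable_fromRel (Step.glue i)⟩
    · exact Or.inr ⟨Sum.inl (Sum.inr i), Sum.inr _, rfl, rfl, reachable_fromRel (Step.glue i)⟩
  · refine of_adj_fromRel (fun a b h => h.symm) ?_
    rintro a b (h | h | i)
    · exact reachable_map_of_adj firstTwo hD ((concat_link_eq_node hx hy).1 h).2
    · exact reachable_fromRel (TripleStep.right h)
    · exact reachable_fromRel (TripleStep.glueRight i)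
  · intro p q h
    rcases concat_reachable hx hy h with rfl | h
    · exact SimpleGraph.Reachable.refl _
    · exact reachable_fromRel (Step.left h)

theorem coarsening_right (hy : y.IsDiagram) (hz : z.IsDiagram) :
    Coarsening (stringGraph y z) (tripleGraph x y z) (stringGraph x (concat y z)) outer
      Sum.inr Sum.inl Sum.inr Sum.inl ofRightProduct := by
  have hD : ∀ u u', (stringGraph y z).Adj u u' →
      (tripleGraph x y z).Reachable (Sum.inr u) (Sum.inr u') := by
    refine of_adj_fromRel (fun a b h => h.symm) ?_
    rintro a b (h | h | i)
    · exact reachable_fromRel (TripleStep.middle h)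
    · exact reachable_fromRel (TripleStep.right h)
    · exact reachable_fromRel (TripleStep.glueRight i)
  refine ⟨⟨?_, ?_⟩, ?_, fun _ => rfl, fun _ => rfl, ?_, hD, ?_, ?_⟩
  · rintro (p | p) (q | q) h <;> simp_all
  · rintro (p | p)
    · exact ⟨Sum.inr p, rfl⟩
    · exact ⟨Sum.inl p, rfl⟩
  · rintro (p | p)
    · exact ⟨Sum.inr p, rfl⟩
    · exact ⟨Sum.inl p, rfl⟩
  · refine of_adj_fromRel adj_symm_aux ?_
    rintro a b (h | h | h | i | i)
    · exact Or.inr ⟨Sum.inl _, Sum.inl _, rfl, rfl, reachable_fromRel (Step.left h)⟩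
    · exact Or.inl ⟨Sum.inl _, Sum.inl _, rfl, rfl, reachable_fromRel (Step.left h)⟩
    · exact Or.inl ⟨Sum.inr _, Sum.inr _, rfl, rfl, reachable_fromRel (Step.right h)⟩
    · exact Or.inr ⟨Sum.inl _, Sum.inr (Sum.inl i), rfl, rfl, reachable_fromRel (Step.glue i)⟩
    · exact Or.inl ⟨Sum.inl (Sum.inr i), Sum.inr _, rfl, rfl, reachable_fromRel (Step.glue i)⟩
  · refine of_adj_fromRel (fun a b h => h.symm) ?_
    rintro a b (h | h | i)
    · exact reachable_fromRel (TripleStep.left h)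
    · exact reachable_map_of_adj Sum.inr hD ((concat_link_eq_node hy hz).1 h).2
    · exact reachable_fromRel (TripleStep.glueLeft i)
  · intro p q h
    rcases concat_reachable hy hz h with rfl | h
    · exact SimpleGraph.Reachable.refl _
    · exact reachable_fromRel (Step.right h)

/-- The node of the concatenation of `concat x y` with a third diagram that represents a node. -/
def toLeftProduct (x y : RawDiagram n) : TNode n → Option (CNode n)
  | Sum.inl p => (outerEnd x y (Sum.inl p)).map Sum.inl
  | Sum.inr (Sum.inl p) => (outerEnd x y (Sum.inr p)).map Sum.inl
  | Sum.inr (Sum.inr p) => some (Sum.inr p)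

/-- The node of the concatenation of a diagram with `concat y z` that represents a node. -/
def toRightProduct (y z : RawDiagram n) : TNode n → Option (CNode n)
  | Sum.inl p => some (Sum.inl p)
  | Sum.inr u => (outerEnd y z u).map Sum.inr

theorem toLeftProduct_firstTwo (u : CNode n) :
    toLeftProduct x y (firstTwo u) = (outerEnd x y u).map Sum.inl := by
  rcases u with p | p <;> rfl

theorem map_bind_comp {α β γ : Type*} (f : α → β) (π : β → Option γ) (w : List (Option α)) :
    (w.map (Option.map f)).map (fun m => m.bind π) = w.map fun m => m.bind (π ∘ f) := by
  rw [List.map_map]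
  apply List.map_congr_left
  rintro (_ | a) _ <;> rfl

theorem map_bind_some {α β : Type*} (f : α → β) (w : List (Option α)) :
    w.map (fun m => m.bind fun a => some (f a)) = w.map (Option.map f) := by
  apply List.map_congr_left
  rintro (_ | a) _ <;> rfl

theorem map_map_bind {α β γ : Type*} (f : α → Option β) (g : β → γ) (w : List (Option α)) :
    (w.map fun m => m.bind f).map (Option.map g) = w.map fun m => m.bind fun a => (f a).map g := by
  rw [List.map_map]
  apply List.map_congr_left
  rintro (_ | a) _ <;> rfl

theorem tripleWord_left (s : Side) : tripleWord x y z s =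
    (cWord x y s).map (Option.map firstTwo) ++
      (z.word s).map (Option.map (Sum.inr ∘ Sum.inr)) := by
  simp [tripleWord, cWord, firstTwo, Function.comp_def]

theorem tripleWord_right (s : Side) : tripleWord x y z s =
    (x.word s).map (Option.map Sum.inl) ++ (cWord y z s).map (Option.map Sum.inr) := by
  simp [tripleWord, cWord, Function.comp_def]

/-- The inner product cancels ghosts before the third word is attached; this is invisible after the
final cancellation. -/
theorem word_left (s : Side) : reduceGhosts (cWord (concat x y) z s) =
    reduceGhosts ((tripleWord x y z s).map fun m => m.bind (toLeftProduct x y)) := by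
  rw [tripleWord_left, List.map_append, map_bind_comp, map_bind_comp, cWord, concat_word,
    reduceGhosts_map_append rfl, map_map_bind]
  congr 2
  · congr 1
    funext m
    congr 1
    funext u
    exact (toLeftProduct_firstTwo u).symm
  · exact (map_bind_some _ _).symm

theorem word_right (s : Side) : reduceGhosts (cWord x (concat y z) s) =
    reduceGhosts ((tripleWord x y z s).map fun m => m.bind (toRightProduct y z)) := by
  rw [tripleWord_right, List.map_append, map_bind_comp, map_bind_comp, cWord, concat_word,
    reduceGhosts_append_map rfl, map_map_bind]
  congr 2
  exact (map_bind_some _ _).symm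

theorem toLeftProduct_some (hx : x.IsDiagram) (hy : y.IsDiagram) (v : TNode n) (w : CNode n)
    (h : toLeftProduct x y v = some w) :
    (tripleGraph x y z).Reachable v (ofLeftProduct w) := by
  have hc := coarsening_left (z := z) hx hy
  obtain ⟨u | m, rfl⟩ := hc.bijective.2 v
  · rw [Sum.elim_inl, toLeftProduct_firstTwo, Option.map_eq_some_iff] at h
    obtain ⟨p, hp, rfl⟩ := h
    exact hc.reachable_A_φ (reachable_of_outerEnd hp)
  · cases h
    exact SimpleGraph.Reachable.refl _

theorem toLeftProduct_none (hx : x.IsDiagram) (hy : y.IsDiagram) (v : TNode n)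
    (h : toLeftProduct x y v = none) (w : CNode n) :
    ¬ (tripleGraph x y z).Reachable v (ofLeftProduct w) := by
  have hc := coarsening_left (z := z) hx hy
  obtain ⟨u | m, rfl⟩ := hc.bijective.2 v
  · rw [Sum.elim_inl, toLeftProduct_firstTwo, Option.map_eq_none_iff] at h
    intro hr
    obtain ⟨p, hp⟩ := hc.exists_reachable_of_A_φ hr
    exact outerEnd_eq_none.1 h p hp
  · cases h

theorem toRightProduct_some (hy : y.IsDiagram) (hz : z.IsDiagram) (v : TNode n) (w : CNode n)
    (h : toRightProduct y z v = some w) :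
    (tripleGraph x y z).Reachable v (ofRightProduct w) := by
  have hc := coarsening_right (x := x) hy hz
  rcases v with p | u
  · cases h
    exact SimpleGraph.Reachable.refl _
  · rw [toRightProduct, Option.map_eq_some_iff] at h
    obtain ⟨p, hp, rfl⟩ := h
    exact hc.reachable_A_φ (reachable_of_outerEnd hp)

theorem toRightProduct_none (hy : y.IsDiagram) (hz : z.IsDiagram) (v : TNode n)
    (h : toRightProduct y z v = none) (w : CNode n) :
    ¬ (tripleGraph x y z).Reachable v (ofRightProduct w) := by
  have hc := coarsening_right (x := x) hy hz
  rcases v with p | u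
  · cases h
  · rw [toRightProduct, Option.map_eq_none_iff] at h
    intro hr
    obtain ⟨p, hp⟩ := hc.exists_reachable_of_A_φ hr
    exact outerEnd_eq_none.1 h p hp

/-- An endpoint of the first two factors is represented by the outer node of its string, or is
dropped if it has none; with this map `contract_eq` applies. -/
theorem concat_concat_left (hx : x.IsDiagram) (hy : y.IsDiagram) :
    concat (concat x y) z = tripleConcat x y z := by
  rw [concat_eq_contract (concat x y)]
  refine (contract_eq (φ := ofLeftProduct) (fun w w' => (coarsening_left hx hy).reachable_φ_iff) ?_
    (toLeftProduct_some hx hy) (toLeftProduct_none hx hy) word_left).symm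
  rintro (i | i) <;> rfl

theorem concat_concat_right (hy : y.IsDiagram) (hz : z.IsDiagram) :
    concat x (concat y z) = tripleConcat x y z := by
  rw [concat_eq_contract x (concat y z)]
  refine (contract_eq (φ := ofRightProduct) (fun w w' => (coarsening_right hy hz).reachable_φ_iff)
    ?_ (toRightProduct_some hy hz) (toRightProduct_none hy hz) word_right).symm
  rintro (i | i) <;> rfl

theorem concat_assoc (hx : x.IsDiagram) (hy : y.IsDiagram) (hz : z.IsDiagram) :
    concat (concat x y) z = concat x (concat y z) := by
  rw [concat_concat_left hx hy, concat_concat_right hy hz]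

/-- In this form an end inside the inner product is detected at its outer nodes, as
`Coarsening.closedCount_eq` requires. -/
theorem isTerminal_concat_iff (hx : x.IsDiagram) (hy : y.IsDiagram) (p : Node n) :
    (∀ q, (concat x y).link p ≠ Link.node q) ↔
      ∃ u, IsTerminal x y u ∧ (stringGraph x y).Reachable (outer p) u := by
  constructor
  · intro h
    rcases hl : (concat x y).link p with _ | q | s
    · obtain ⟨u, hu, hr⟩ := (concat_link_eq_empty hx hy).1 hl
      exact ⟨u, fun q hq => by simp [hu] at hq, hr⟩
    · exact absurd hl (h q)
    · obtain ⟨u, hu, hr⟩ := (concat_link_eq_boundary hx hy).1 hl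
      exact ⟨u, isTerminal_of_mem_cWord hx hy hu, hr⟩
  · rintro ⟨u, hu, hr⟩ q hq
    obtain ⟨hne, hr'⟩ := (concat_link_eq_node hx hy).1 hq
    exact hne (not_reachable_terminal hx hy hu (hr'.symm.trans hr) hr)

theorem closedCount_left (hx : x.IsDiagram) (hy : y.IsDiagram) :
    closedCount (tripleGraph x y z) (TripleEnd x y z) =
      closedCount (stringGraph (concat x y) z)
          (fun v => IsTerminal (concat x y) z v ∨ ∃ p, v = outer p) +
        closedCount (stringGraph x y) fun v => IsTerminal x y v ∨ ∃ p, v = outer p := by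
  -- The outer nodes of the first two factors that stay outer are those on the left; the right ones
  -- move to the second middle line.
  refine (coarsening_left hx hy).closedCount_eq (IsTerminal x y) (fun p => ∃ i, p = Sum.inl i)
    (fun u => Iff.rfl) ?_ ?_ ?_
  · rintro (p | p)
    · refine or_congr Iff.rfl ?_
      simp [firstTwo, tripleOuter, outer]
    · refine or_congr Iff.rfl ?_
      simp [firstTwo, tripleOuter, outer]
  · intro p
    refine or_congr Iff.rfl ?_
    simp [tripleOuter, outer]
  · intro p
    rw [← isTerminal_concat_iff hx hy, or_comm]
    refine or_congr ?_ Iff.rfl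
    simp [outer]

theorem closedCount_right (hy : y.IsDiagram) (hz : z.IsDiagram) :
    closedCount (tripleGraph x y z) (TripleEnd x y z) =
      closedCount (stringGraph x (concat y z))
          (fun v => IsTerminal x (concat y z) v ∨ ∃ p, v = outer p) +
        closedCount (stringGraph y z) fun v => IsTerminal y z v ∨ ∃ p, v = outer p := by
  refine (coarsening_right hy hz).closedCount_eq (IsTerminal y z) (fun p => ∃ i, p = Sum.inr i)
    (fun u => Iff.rfl) ?_ ?_ ?_
  · rintro (p | p)
    · refine or_congr Iff.rfl ?_
      simp [tripleOuter, outer]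
    · refine or_congr Iff.rfl ?_
      simp [tripleOuter, outer]
  · intro p
    refine or_congr Iff.rfl ?_
    simp [tripleOuter, outer]
  · intro p
    rw [← isTerminal_concat_iff hy hz, or_comm]
    refine or_congr ?_ Iff.rfl
    simp [outer]

theorem tripleWord_nodup (hx : x.IsDiagram) (hy : y.IsDiagram) (hz : z.IsDiagram) (s : Side) :
    (tripleWord x y z s).reduceOption.Nodup := by
  rw [tripleWord_right, List.reduceOption_append, reduceOption_map_map, reduceOption_map_map]
  refine List.Nodup.append ((hx.nodup s).map Sum.inl_injective)
    ((nodup_cWord hy hz s).map Sum.inr_injective) ?_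
  intro v hv hv'
  simp only [List.mem_map] at hv hv'
  obtain ⟨p, _, rfl⟩ := hv
  obtain ⟨q, _, h⟩ := hv'
  cases h

theorem some_mem_tripleWord (hx : x.IsDiagram) (hy : y.IsDiagram) (hz : z.IsDiagram) {s : Side}
    {v : TNode n} : some v ∈ tripleWord x y z s ↔ tripleLink x y z v = Link.boundary s := by
  rcases v with p | p | p
  · simp [tripleWord, tripleLink, ← hx.mem_word]
  · simp [tripleWord, tripleLink, ← hy.mem_word]
  · simp [tripleWord, tripleLink, ← hz.mem_word]

theorem tripleWord_disjoint (hx : x.IsDiagram) (hy : y.IsDiagram) (hz : z.IsDiagram) (v : TNode n)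
    (h : some v ∈ tripleWord x y z Side.top) : some v ∉ tripleWord x y z Side.bottom := by
  rw [some_mem_tripleWord hx hy hz] at h ⊢
  rw [h]
  simp

/-- Two terminal nodes on one string form a boundary arc. -/
theorem not_reachable_outer (hx : x.IsDiagram) (hy : y.IsDiagram) {u u' : CNode n}
    (hu : IsTerminal x y u) (hu' : IsTerminal x y u') (hne : u ≠ u')
    (h : (stringGraph x y).Reachable u u') (p : Node n) :
    ¬ (stringGraph x y).Reachable (outer p) u := fun hp =>
  hne (terminal_unique hx hy hu hu' hp (hp.trans h))

theorem labels_of_all_none {α β : Type*} (b : Bool) (w : List (Option α)) :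
    labels b (w.map fun m => m.bind fun _ => (none : Option β)) = [] := by
  rw [labels_map_bind]
  simp

theorem map_bind_some_id {α : Type*} (w : List (Option α)) :
    w.map (fun m => m.bind some) = w := by
  simp

/-- With `ρ` keeping exactly the endpoints of the first two factors, two different endpoints on one
component of the inner graph form an arc, and then no outer node lies on their string. -/
theorem arcFactor_left {R : Type*} [CommRing R] (P : Params R) (hx : x.IsDiagram)
    (hy : y.IsDiagram) (hz : z.IsDiagram) :
    arcFactor P (tripleGraph x y z) (tripleWord x y z) =
      arcFactor P (stringGraph x y) (cWord x y) *
        arcFactor P (stringGraph (concat x y) z) (cWord (concat x y) z) := by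
  have hc := coarsening_left (z := z) hx hy
  let ρ : TNode n → Option (CNode n) := Sum.elim (fun p => some (Sum.inl p))
    (Sum.elim (fun p => some (Sum.inr p)) fun _ => none)
  have hρ : ∀ u, ρ (firstTwo u) = some u := by rintro (p | p) <;> rfl
  refine arcFactor_split P (ρ := ρ) (φ := ofLeftProduct) (fun w w' => hc.reachable_φ_iff)
    (toLeftProduct_some hx hy) (toLeftProduct_none hx hy) word_left (tripleWord_nodup hx hy hz)
    (tripleWord_disjoint hx hy hz) ?_ ?_
  · have hT : ∀ u s, some (firstTwo u) ∈ tripleWord x y z s → IsTerminal x y u := by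
      intro u s hu q hq
      rw [some_mem_tripleWord hx hy hz] at hu
      rcases u with p | p
      · exact absurd (hu.symm.trans hq) (by simp)
      · exact absurd (hu.symm.trans hq) (by simp)
    intro v v' s s' hv hv' hne
    obtain ⟨u | m, rfl⟩ := hc.bijective.2 v
    · obtain ⟨u' | m', rfl⟩ := hc.bijective.2 v'
      · simp only [Sum.elim_inl, hρ, toLeftProduct_firstTwo, Option.map_eq_none_iff,
          Option.some.injEq, exists_eq_left', exists_and_left] at hv hv' hne ⊢
        constructor
        · rintro ⟨hr, hu, _⟩
          exact (hc.reachable_A_iff (outerEnd_eq_none.1 hu)).1 hr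
        · intro hr
          have hne' : u ≠ u' := fun e => hne (by rw [e])
          exact ⟨hc.reachable_A hr,
            outerEnd_eq_none.2 (not_reachable_outer hx hy (hT _ _ hv) (hT _ _ hv') hne' hr),
            outerEnd_eq_none.2
              (not_reachable_outer hx hy (hT _ _ hv') (hT _ _ hv) hne'.symm hr.symm)⟩
      · simp [ρ, toLeftProduct]
    · simp [ρ, toLeftProduct]
  · intro s
    rw [tripleWord_left, List.map_append, map_bind_comp, map_bind_comp,
      labels_append_of_even true (by simpa using even_length_cWord hx hy s)]
    have h1 : ρ ∘ firstTwo = some := funext hρ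
    have h2 : ρ ∘ (Sum.inr ∘ Sum.inr) = fun _ => none := rfl
    rw [h1, h2, labels_of_all_none, map_bind_some_id, List.append_nil]

theorem arcFactor_right {R : Type*} [CommRing R] (P : Params R) (hx : x.IsDiagram)
    (hy : y.IsDiagram) (hz : z.IsDiagram) :
    arcFactor P (tripleGraph x y z) (tripleWord x y z) =
      arcFactor P (stringGraph y z) (cWord y z) *
        arcFactor P (stringGraph x (concat y z)) (cWord x (concat y z)) := by
  have hc := coarsening_right (x := x) hy hz
  let ρ : TNode n → Option (CNode n) := Sum.elim (fun _ => none) some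
  refine arcFactor_split P (ρ := ρ) (φ := ofRightProduct) (fun w w' => hc.reachable_φ_iff)
    (toRightProduct_some hy hz) (toRightProduct_none hy hz) word_right (tripleWord_nodup hx hy hz)
    (tripleWord_disjoint hx hy hz) ?_ ?_
  · have hT : ∀ u s, some (Sum.inr u) ∈ tripleWord x y z s → IsTerminal y z u := by
      intro u s hu q hq
      rw [some_mem_tripleWord hx hy hz] at hu
      rcases u with p | p
      · exact absurd (hu.symm.trans hq) (by simp)
      · exact absurd (hu.symm.trans hq) (by simp)
    intro v v' s s' hv hv' hne
    rcases v with m | u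
    · simp [ρ, toRightProduct]
    · rcases v' with m' | u'
      · simp [ρ, toRightProduct]
      · simp only [ρ, toRightProduct, Sum.elim_inr, Option.map_eq_none_iff,
          Option.some.injEq, exists_eq_left', exists_and_left]
        constructor
        · rintro ⟨hr, hu, _⟩
          exact (hc.reachable_A_iff (outerEnd_eq_none.1 hu)).1 hr
        · intro hr
          have hne' : u ≠ u' := fun e => hne (by rw [e])
          exact ⟨hc.reachable_A hr,
            outerEnd_eq_none.2 (not_reachable_outer hy hz (hT _ _ hv) (hT _ _ hv') hne' hr),
            outerEnd_eq_none.2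
              (not_reachable_outer hy hz (hT _ _ hv') (hT _ _ hv) hne'.symm hr.symm)⟩
  · intro s
    -- The marks of `x` precede those of the inner product; since their number is even, the
    -- endpoints of `y` and `z` have the same parities in the triple word as in the word of the
    -- inner product.
    rw [tripleWord_right, List.map_append, map_bind_comp, map_bind_comp,
      labels_append_of_even true (by simpa using hx.even s)]
    have h1 : ρ ∘ Sum.inr = some := rfl
    have h2 : ρ ∘ Sum.inl = fun _ => none := rfl
    rw [h1, h2, labels_of_all_none, map_bind_some_id, List.nil_append]

theorem factor_left {R : Type*} [CommRing R] (P : Params R) (hx : x.IsDiagram)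
    (hy : y.IsDiagram) (hz : z.IsDiagram) :
    factor P x y * factor P (concat x y) z = tripleFactor x y z P := by
  rw [factor_eq P hx hy, factor_eq P (isDiagram_concat hx hy) hz, tripleFactor,
    closedCount_left hx hy, arcFactor_left P hx hy hz, pow_add]
  ring

theorem factor_right {R : Type*} [CommRing R] (P : Params R) (hx : x.IsDiagram)
    (hy : y.IsDiagram) (hz : z.IsDiagram) :
    factor P y z * factor P x (concat y z) = tripleFactor x y z P := by
  rw [factor_eq P hy hz, factor_eq P hx (isDiagram_concat hy hz), tripleFactor,
    closedCount_right hy hz, arcFactor_right P hx hy hz, pow_add]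
  ring

end Triple

/-! ### Empty nodes of a concatenation -/

section Empty

variable {n : ℕ} {x y z : RawDiagram n}

/-- If no string meets an empty node, emptiness is constant on the components of the concatenation.
-/
theorem concat_link_eq_empty_iff (hx : x.IsDiagram) (hy : y.IsDiagram) (h : ¬ MeetsEmpty x y)
    (p : Node n) : (concat x y).link p = Link.empty ↔ cLink x y (outer p) = Link.empty := by
  have hconst : ∀ u v, (stringGraph x y).Adj u v →
      (cLink x y u = Link.empty) = (cLink x y v = Link.empty) := by
    refine of_adj_fromRel (fun a b h => h.symm) ?_
    rintro a b (h' | h' | i)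
    · simp [cLink, h', hx.link_symm _ _ h']
    · simp [cLink, h', hy.link_symm _ _ h']
    · simp only [MeetsEmpty, not_exists, not_not] at h
      exact propext (h i)
  rw [concat_link_eq_empty hx hy]
  constructor
  · rintro ⟨v, hv, hr⟩
    rwa [apply_eq_of_reachable (fun v => cLink x y v = Link.empty) hconst hr]
  · exact fun hp => ⟨_, hp, SimpleGraph.Reachable.refl _⟩

/-- The right nodes of a nonvanishing product are empty exactly where those of its right factor are.
-/
theorem meetsEmpty_concat_left (hx : x.IsDiagram) (hy : y.IsDiagram) (h : ¬ MeetsEmpty x y) :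
    MeetsEmpty (concat x y) z ↔ MeetsEmpty y z := by
  refine exists_congr fun i => ?_
  rw [concat_link_eq_empty_iff hx hy h]
  rfl

theorem meetsEmpty_concat_right (hy : y.IsDiagram) (hz : z.IsDiagram) (h : ¬ MeetsEmpty y z) :
    MeetsEmpty x (concat y z) ↔ MeetsEmpty x y := by
  refine exists_congr fun i => ?_
  rw [concat_link_eq_empty_iff hy hz h]
  rfl

theorem noEmptyNode_concat (hx : x.IsDiagram) (hy : y.IsDiagram) (hx' : x.NoEmptyNode)
    (hy' : y.NoEmptyNode) : (concat x y).NoEmptyNode := by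
  intro p hp
  obtain ⟨v | v, hv, _⟩ := (concat_link_eq_empty hx hy).1 hp
  · exact hx' v hv
  · exact hy' v hv

theorem noBottomString_concat (hx : x.IsDiagram) (hy : y.IsDiagram) (hx' : x.NoBottomString)
    (hy' : y.NoBottomString) : (concat x y).NoBottomString := by
  intro p hp
  obtain ⟨v, hv, _⟩ := (concat_link_eq_boundary hx hy).1 hp
  rw [some_mem_cWord hx hy] at hv
  rcases v with v | v
  · exact hx' v hv
  · exact hy' v hv

end Empty

/-! ### The bilinear product -/

section Product

variable {n : ℕ} {R : Type*} [CommRing R] (P : Params R)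

theorem mul_zero_left (b : RawDiagram n →₀ R) : mul P 0 b = 0 := Finsupp.sum_zero_index

theorem mul_zero_right (a : RawDiagram n →₀ R) : mul P a 0 = 0 := by
  simp [mul]

theorem mul_add_left (a a' b : RawDiagram n →₀ R) :
    mul P (a + a') b = mul P a b + mul P a' b := by
  unfold mul
  refine Finsupp.sum_add_index' ?_ ?_
  · simp
  · intro x r r'
    simp [add_mul, add_smul, Finsupp.sum_add]

theorem mul_add_right (a b b' : RawDiagram n →₀ R) :
    mul P a (b + b') = mul P a b + mul P a b' := by
  unfold mul
  rw [← Finsupp.sum_add]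
  refine Finsupp.sum_congr fun x _ => ?_
  refine Finsupp.sum_add_index' ?_ ?_
  · simp
  · intro x r r'
    simp [mul_add, add_smul]

theorem mul_single_single (x y : RawDiagram n) (r t : R) :
    mul P (Finsupp.single x r) (Finsupp.single y t) =
      if MeetsEmpty x y then 0 else Finsupp.single (concat x y) (r * t * factor P x y) := by
  unfold mul
  rw [Finsupp.sum_single_index (by simp), Finsupp.sum_single_index (by simp)]
  unfold mulDiagram
  split_ifs <;> simp

theorem mul_sum_left {ι : Type*} (F : Finset ι) (f : ι → RawDiagram n →₀ R)
    (b : RawDiagram n →₀ R) : mul P (∑ i ∈ F, f i) b = ∑ i ∈ F, mul P (f i) b := by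
  induction F using Finset.induction_on with
  | empty => simp [mul_zero_left]
  | insert i F hi ih => rw [Finset.sum_insert hi, Finset.sum_insert hi, mul_add_left, ih]

theorem mul_sum_right {ι : Type*} (F : Finset ι) (a : RawDiagram n →₀ R)
    (f : ι → RawDiagram n →₀ R) : mul P a (∑ i ∈ F, f i) = ∑ i ∈ F, mul P a (f i) := by
  induction F using Finset.induction_on with
  | empty => simp [mul_zero_right]
  | insert i F hi ih => rw [Finset.sum_insert hi, Finset.sum_insert hi, mul_add_right, ih]

theorem supported_induction {s : Set (RawDiagram n)} {p : (RawDiagram n →₀ R) → Prop} (h0 : p 0)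
    (hadd : ∀ a b, p a → p b → p (a + b)) (hsingle : ∀ x ∈ s, ∀ r, p (Finsupp.single x r))
    {a : RawDiagram n →₀ R} (ha : a ∈ Finsupp.supported R R s) : p a := by
  rw [← Finsupp.sum_single a]
  exact Finset.sum_induction _ p hadd h0 fun x hx => hsingle x (ha hx) _

theorem mulClosed_supported {s : Set (RawDiagram n)}
    (h : ∀ x ∈ s, ∀ y ∈ s, concat x y ∈ s) : MulClosed P (Finsupp.supported R R s) := by
  intro a ha b hb
  refine supported_induction (p := fun a => mul P a b ∈ Finsupp.supported R R s) ?_ ?_ ?_ ha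
  · rw [mul_zero_left]
    exact Submodule.zero_mem _
  · intro a a' h h'
    rw [mul_add_left]
    exact Submodule.add_mem _ h h'
  · intro x hx r
    refine supported_induction
      (p := fun b => mul P (Finsupp.single x r) b ∈ Finsupp.supported R R s) ?_ ?_ ?_ hb
    · rw [mul_zero_right]
      exact Submodule.zero_mem _
    · intro a a' h h'
      rw [mul_add_right]
      exact Submodule.add_mem _ h h'
    · intro y hy t
      rw [mul_single_single]
      split_ifs
      · exact Submodule.zero_mem _
      · exact Finsupp.single_mem_supported R _ (h x hx y hy)

theorem mul_single_assoc {x y z : RawDiagram n} (hx : x.IsDiagram) (hy : y.IsDiagram)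
    (hz : z.IsDiagram) (r t u : R) :
    mul P (mul P (Finsupp.single x r) (Finsupp.single y t)) (Finsupp.single z u) =
      mul P (Finsupp.single x r) (mul P (Finsupp.single y t) (Finsupp.single z u)) := by
  rw [mul_single_single, mul_single_single]
  by_cases h1 : MeetsEmpty x y
  · rw [if_pos h1, mul_zero_left]
    by_cases h2 : MeetsEmpty y z
    · rw [if_pos h2, mul_zero_right]
    · rw [if_neg h2, mul_single_single, if_pos ((meetsEmpty_concat_right hy hz h2).2 h1)]
  · rw [if_neg h1, mul_single_single]
    by_cases h2 : MeetsEmpty y z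
    · rw [if_pos h2, mul_zero_right, if_pos ((meetsEmpty_concat_left hx hy h1).2 h2)]
    · rw [if_neg h2, mul_single_single, if_neg (mt (meetsEmpty_concat_right hy hz h2).1 h1),
        if_neg (mt (meetsEmpty_concat_left hx hy h1).1 h2), concat_assoc hx hy hz]
      congr 1
      -- Both products of factors equal `tripleFactor`.
      linear_combination r * t * u * (factor_left P hx hy hz) -
        r * t * u * (factor_right P hx hy hz)

theorem mulAssociative_dGh2 : MulAssociative P (dGh2 R n) := by
  intro a ha b hb c hc
  refine supported_induction
    (p := fun a => mul P (mul P a b) c = mul P a (mul P b c)) ?_ ?_ ?_ ha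
  · simp only [mul_zero_left]
  · intro a a' h h'
    simp only [mul_add_left, h, h']
  intro x hx r
  refine supported_induction (p := fun b => mul P (mul P (Finsupp.single x r) b) c =
    mul P (Finsupp.single x r) (mul P b c)) ?_ ?_ ?_ hb
  · simp only [mul_zero_left, mul_zero_right]
  · intro a a' h h'
    simp only [mul_add_left, mul_add_right, h, h']
  intro y hy t
  refine supported_induction (p := fun c => mul P (mul P (Finsupp.single x r)
    (Finsupp.single y t)) c = mul P (Finsupp.single x r) (mul P (Finsupp.single y t) c)) ?_ ?_ ?_ hc
  · simp only [mul_zero_right]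
  · intro a a' h h'
    simp only [mul_add_right, h, h']
  intro z hz u
  exact mul_single_assoc P hx hy hz r t u

theorem MulAssociative.mono {A B : Submodule R (RawDiagram n →₀ R)} (h : MulAssociative P A)
    (hBA : B ≤ A) : MulAssociative P B :=
  fun a ha b hb c hc => h a (hBA ha) b (hBA hb) c (hBA hc)

theorem mulClosed_dGh2 : MulClosed P (dGh2 R n) :=
  mulClosed_supported P fun _ hx _ hy => isDiagram_concat hx hy

theorem mulClosed_Gh2 : MulClosed P (Gh2 R n) :=
  mulClosed_supported P fun _ hx _ hy =>
    ⟨isDiagram_concat hx.1 hy.1, noEmptyNode_concat hx.1 hy.1 hx.2 hy.2⟩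

theorem mulClosed_dGh1 : MulClosed P (dGh1 R n) :=
  mulClosed_supported P fun _ hx _ hy =>
    ⟨isDiagram_concat hx.1 hy.1, noBottomString_concat hx.1 hy.1 hx.2 hy.2⟩

theorem mulClosed_Gh1 : MulClosed P (Gh1 R n) :=
  mulClosed_supported P fun _ hx _ hy =>
    ⟨isDiagram_concat hx.1 hy.1, noEmptyNode_concat hx.1 hy.1 hx.2.1 hy.2.1,
      noBottomString_concat hx.1 hy.1 hx.2.2 hy.2.2⟩

theorem Gh2_le_dGh2 : Gh2 R n ≤ dGh2 R n := Finsupp.supported_mono fun _ h => h.1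

theorem dGh1_le_dGh2 : dGh1 R n ≤ dGh2 R n := Finsupp.supported_mono fun _ h => h.1

theorem Gh1_le_dGh2 : Gh1 R n ≤ dGh2 R n := Finsupp.supported_mono fun _ h => h.1

theorem Gh1_le_Gh2 : Gh1 R n ≤ Gh2 R n := Finsupp.supported_mono fun _ h => ⟨h.1, h.2.1⟩

end Product

/-! ### The identity -/

section Identity

variable {n : ℕ}

open RawDiagram

/-- The height of a node. -/
def level : Node n → Fin n := Sum.elim id id

theorem level_swap (p : Node n) : level p.swap = level p := by rcases p with i | i <;> rfl

/-- The diagram without marks on the boundaries, with a horizontal string at each height in `S`. -/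
def idDiagram (S : Finset (Fin n)) : RawDiagram n where
  link p := if level p ∈ S then Link.node p.swap else Link.empty
  word _ := []

/-- A strictly increasing function on the nodes, in clockwise order. -/
def clockwise : PerimeterPoint n → ℤ
  | Sum.inl (Sum.inl i) => -(i : ℤ) - 1
  | Sum.inl (Sum.inr i) => (i : ℤ) + 1
  | Sum.inr _ => 0

theorem pairwise_clockwise (S : Finset (Fin n)) :
    (idDiagram S).perimeter.Pairwise fun a b => clockwise a < clockwise b := by
  have hp := List.pairwise_lt_finRange n
  simp only [perimeter, idDiagram, List.reduceOption_nil, List.map_nil, List.append_nil,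
    List.reverse_nil]
  rw [List.pairwise_append]
  refine ⟨?_, ?_, ?_⟩
  · rw [List.pairwise_map, List.pairwise_reverse]
    refine hp.imp ?_
    intro i j h
    simp only [clockwise]
    have : (i : ℕ) < j := h
    omega
  · rw [List.pairwise_map]
    refine hp.imp ?_
    intro i j h
    simp only [clockwise]
    have : (i : ℕ) < j := h
    omega
  · intro a ha b hb
    simp only [List.mem_map] at ha hb
    obtain ⟨i, _, rfl⟩ := ha
    obtain ⟨j, _, rfl⟩ := hb
    simp only [clockwise]
    omega

theorem idDiagram_link_eq_node {S : Finset (Fin n)} {p q : Node n} :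
    (idDiagram S).link p = Link.node q ↔ level p ∈ S ∧ q = p.swap := by
  simp only [idDiagram]
  split_ifs with h
  · simp [h, eq_comm]
  · simp [h]

theorem idDiagram_link_eq_empty {S : Finset (Fin n)} {p : Node n} :
    (idDiagram S).link p = Link.empty ↔ level p ∉ S := by
  simp only [idDiagram]
  split_ifs with h <;> simp [h]

theorem idDiagram_link_ne_boundary {S : Finset (Fin n)} {p : Node n} {s : Side} :
    (idDiagram S).link p ≠ Link.boundary s := by
  simp only [idDiagram]
  split_ifs <;> simp

theorem clockwise_of_sameString {S : Finset (Fin n)} {a b : PerimeterPoint n}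
    (h : (idDiagram S).SameString a b) : clockwise b = -clockwise a := by
  rcases a with p | ⟨s, p⟩ <;> rcases b with q | ⟨t, q⟩
  · obtain ⟨_, rfl⟩ := idDiagram_link_eq_node.1 h
    rcases p with i | i <;> simp only [Sum.swap_inl, Sum.swap_inr, clockwise] <;> ring
  · exact absurd h.2 idDiagram_link_ne_boundary
  · exact absurd h.2 idDiagram_link_ne_boundary
  · exact h.elim

theorem isDiagram_idDiagram (S : Finset (Fin n)) : (idDiagram S).IsDiagram where
  link_ne p h := by
    have := (idDiagram_link_eq_node.1 h).2
    rcases p with i | i <;> cases this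
  link_symm p q h := by
    obtain ⟨h1, rfl⟩ := idDiagram_link_eq_node.1 h
    rw [idDiagram_link_eq_node]
    rcases p with i | i <;> exact ⟨h1, rfl⟩
  mem_word s p := by
    simp only [idDiagram_link_ne_boundary, iff_false]
    simp [idDiagram]
  nodup s := by simp [idDiagram]
  even s := by simp [idDiagram]
  reduced s := by simp [idDiagram]
  nonCrossing a b c e hl hac hbe := by
    have hp := (pairwise_clockwise S).sublist hl
    simp only [List.pairwise_cons, List.mem_cons, List.not_mem_nil, or_false, forall_eq_or_imp,
      forall_eq, IsEmpty.forall_iff, implies_true, List.Pairwise.nil, and_true] at hp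
    have h1 := clockwise_of_sameString hac
    have h2 := clockwise_of_sameString hbe
    -- The function `clockwise` changes sign along a string, so `a < c` and `b < e` nested as `a < b
    -- < c < e` would force `-a < -b`.
    omega

theorem noBottomString_idDiagram (S : Finset (Fin n)) : (idDiagram S).NoBottomString :=
  fun _ => idDiagram_link_ne_boundary

theorem link_ext {a b : Link n} (h1 : ∀ q, a = Link.node q ↔ b = Link.node q)
    (h2 : ∀ s, a = Link.boundary s ↔ b = Link.boundary s) : a = b := by
  rcases b with _ | q | s
  · rcases a with _ | q | s
    · rfl
    · exact ((h1 q).1 rfl).symm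
    · exact ((h2 s).1 rfl).symm
  · exact (h1 q).2 rfl
  · exact (h2 s).2 rfl

/-- The concatenation of `x` and `y` arises from `d` by extending some strings: `ρ` maps each node
to the corresponding node of `d`, and `τ` maps the nodes of `d` to nodes of one of the factors. -/
structure IsExtension (x y d : RawDiagram n) (ρ : CNode n → Node n) (τ : Node n → CNode n) :
    Prop where
  ρ_outer : ∀ p, ρ (outer p) = p
  ρ_τ : ∀ p, ρ (τ p) = p
  step : ∀ u v, Step x y u v → ρ u = ρ v ∨ d.link (ρ u) = Link.node (ρ v)
  reachable_node : ∀ p q, d.link p = Link.node q → (stringGraph x y).Reachable (outer p) (outer q)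
  reachable_boundary : ∀ p s, d.link p = Link.boundary s → (stringGraph x y).Reachable (outer p) (τ p)
  word : ∀ s, cWord x y s = (d.word s).map (Option.map τ)
  reachable_outer : ∀ v q, cLink x y v = Link.node q → ∃ p, (stringGraph x y).Reachable v (outer p)

namespace IsExtension

variable {x y d : RawDiagram n} {ρ : CNode n → Node n} {τ : Node n → CNode n}

/-- An edge is collapsed by `ρ` or follows a string of `d`, and following it twice leads back. So
`ρ` maps each component into the ends of a single string. -/
theorem eq_or_link (h : IsExtension x y d ρ τ) (hd : d.IsDiagram) {u v : CNode n}
    (hr : (stringGraph x y).Reachable u v) : ρ u = ρ v ∨ d.link (ρ u) = Link.node (ρ v) := by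
  have hadj : ∀ u v, (stringGraph x y).Adj u v → ρ u = ρ v ∨ d.link (ρ u) = Link.node (ρ v) := by
    refine of_adj_fromRel ?_ h.step
    rintro a b (h | h)
    · exact Or.inl h.symm
    · exact Or.inr (hd.link_symm _ _ h)
  obtain ⟨w⟩ := hr
  induction w with
  | nil => exact Or.inl rfl
  | cons ha _ ih =>
    rcases hadj _ _ ha with e | e
    · rwa [e]
    · rcases ih with e' | e'
      · rw [← e']
        exact Or.inr e
      · left
        have := hd.link_symm _ _ e
        rw [e'] at this
        exact (Link.node.inj this).symm

theorem eq_of_mem_word (h : IsExtension x y d ρ τ) (hd : d.IsDiagram) {p q : Node n} {s : Side}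
    {u : CNode n} (hu : ρ u = p) (hq : some q ∈ d.word s)
    (hr : (stringGraph x y).Reachable u (τ q)) : p = q := by
  rcases h.eq_or_link hd hr with e | e
  · rw [h.ρ_τ] at e
    exact hu.symm.trans e
  · rw [h.ρ_τ] at e
    have := hd.link_symm _ _ e
    rw [(hd.mem_word s q).1 hq] at this
    cases this

theorem concat_eq (h : IsExtension x y d ρ τ) (hx : x.IsDiagram) (hy : y.IsDiagram)
    (hd : d.IsDiagram) : concat x y = d := by
  have hmem : ∀ s v, some v ∈ cWord x y s ↔ ∃ p, some p ∈ d.word s ∧ v = τ p := by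
    intro s v
    rw [h.word]
    simp only [List.mem_map, Option.map_eq_some_iff]
    constructor
    · rintro ⟨_, hm, p, rfl, rfl⟩
      exact ⟨p, hm, rfl⟩
    · rintro ⟨p, hp, rfl⟩
      exact ⟨_, hp, p, rfl, rfl⟩
  have hlink : (concat x y).link = d.link := by
    funext p
    refine link_ext (fun q => ?_) fun s => ?_
    · rw [concat_link_eq_node hx hy]
      constructor
      · rintro ⟨hne, hr⟩
        have := h.eq_or_link hd hr
        rw [h.ρ_outer, h.ρ_outer] at this
        exact this.resolve_left hne.symm
      · intro hl
        refine ⟨?_, h.reachable_node _ _ hl⟩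
        rintro rfl
        exact hd.link_ne _ hl
    · rw [concat_link_eq_boundary hx hy]
      constructor
      · rintro ⟨v, hv, hr⟩
        obtain ⟨q, hq, rfl⟩ := (hmem s v).1 hv
        have := h.eq_of_mem_word hd (h.ρ_outer p) hq hr
        subst this
        exact (hd.mem_word _ _).1 hq
      · intro hl
        exact ⟨τ p, (hmem s _).2 ⟨p, (hd.mem_word _ _).2 hl, rfl⟩, h.reachable_boundary _ _ hl⟩
  have hword : (concat x y).word = d.word := by
    funext s
    rw [concat_word, h.word, map_bind_comp]
    have : (d.word s).map (fun m => m.bind (outerEnd x y ∘ τ)) = d.word s := by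
      conv_rhs => rw [← List.map_id (d.word s)]
      apply List.map_congr_left
      rintro (_ | p) hp
      · rfl
      · simp only [Option.bind_some, Function.comp_apply, id]
        rw [outerEnd_eq_some hx hy
          (isTerminal_of_mem_cWord hx hy ((hmem s _).2 ⟨p, hp, rfl⟩))]
        exact h.reachable_boundary _ _ ((hd.mem_word _ _).1 hp)
    rw [this]
    exact Reduced.reduceGhosts_eq (hd.reduced s)
  exact RawDiagram.ext hlink hword

/-- There are no loops, since every node with a partner in its factor reaches an outer node, and no
arcs, since by `eq_of_mem_word` different boundary endpoints of `d` lie on different strings. -/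
theorem factor_eq_one {R : Type*} [CommRing R] (P : Params R) (h : IsExtension x y d ρ τ)
    (hx : x.IsDiagram) (hy : y.IsDiagram) (hd : d.IsDiagram) : factor P x y = 1 := by
  have hcount : closedCount (stringGraph x y)
      (fun v => IsTerminal x y v ∨ ∃ p, v = outer p) = 0 := by
    have : IsEmpty {c : (stringGraph x y).ConnectedComponent //
        ∀ v ∈ c.supp, ¬ (IsTerminal x y v ∨ ∃ p, v = outer p)} := by
      constructor
      rintro ⟨c, hc⟩
      induction c using Quot.ind with
      | mk v =>
        have hv := mk_closed_iff.1 hc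
        have h1 := hv v (SimpleGraph.Reachable.refl _)
        simp only [IsTerminal, not_or, not_forall, ne_eq, not_not] at h1
        obtain ⟨⟨q, hq⟩, _⟩ := h1
        obtain ⟨p, hp⟩ := h.reachable_outer v q hq
        exact hv _ hp (Or.inr ⟨p, rfl⟩)
    exact Nat.card_of_isEmpty
  have hlab : ∀ s, labels true (cWord x y s) =
      (labels true (d.word s)).map (Prod.map τ id) := by
    intro s
    rw [h.word, labels_map]
  have hno : ∀ s t p q, some p ∈ d.word s → some q ∈ d.word t → p ≠ q →
      ¬ (stringGraph x y).Reachable (τ p) (τ q) :=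
    fun s t p q _ hq hne hr => hne (h.eq_of_mem_word hd (h.ρ_τ p) hq hr)
  have hpair : ∀ s (f : Bool → Bool → R),
      pairProd (stringGraph x y).Reachable f (labels true (cWord x y s)) = 1 := by
    intro s f
    rw [hlab, pairProd_map]
    refine pairProd_eq_one f ((pairwise_ne_labels true (hd.nodup s)).imp_of_mem ?_)
    intro a c ha hc hne
    exact hno _ _ _ _ (some_mem_of_mem_labels ha) (some_mem_of_mem_labels hc) hne
  rw [factor_eq P hx hy, hcount, arcFactor, hpair, hpair, hlab, hlab, crossProd_map,
    crossProd_eq_one]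
  · simp
  · intro a ha c hc
    have ha' := some_mem_of_mem_labels ha
    have hc' := some_mem_of_mem_labels hc
    refine hno _ _ _ _ ha' hc' ?_
    intro e
    rw [hd.mem_word, e] at ha'
    rw [hd.mem_word, ha'] at hc'
    cases hc'

end IsExtension

/-- The heights at which the left side of a diagram has a string. -/
def leftLevels (d : RawDiagram n) : Finset (Fin n) :=
  Finset.univ.filter fun i => d.link (Sum.inl i) ≠ Link.empty

/-- The heights at which the right side of a diagram has a string. -/
def rightLevels (d : RawDiagram n) : Finset (Fin n) :=
  Finset.univ.filter fun i => d.link (Sum.inr i) ≠ Link.empty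

theorem meetsEmpty_idDiagram_left {S : Finset (Fin n)} {d : RawDiagram n} :
    MeetsEmpty (idDiagram S) d ↔ S ≠ leftLevels d := by
  rw [← not_iff_not, not_not, MeetsEmpty, Finset.ext_iff]
  simp only [idDiagram_link_eq_empty, level, Sum.elim_inr, id, leftLevels, Finset.mem_filter,
    Finset.mem_univ, true_and, not_exists, not_not]
  exact forall_congr' fun i => by tauto

theorem meetsEmpty_idDiagram_right {S : Finset (Fin n)} {d : RawDiagram n} :
    MeetsEmpty d (idDiagram S) ↔ S ≠ rightLevels d := by
  rw [← not_iff_not, not_not, MeetsEmpty, Finset.ext_iff]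
  simp only [idDiagram_link_eq_empty, level, Sum.elim_inl, id, rightLevels, Finset.mem_filter,
    Finset.mem_univ, true_and, not_exists, not_not]
  exact forall_congr' fun i => by tauto

/-- The strings at the left side of `d` are lengthened, so `ρ` sends both nodes of a horizontal
string to the left node of `d` at their height. -/
theorem isExtension_left {d : RawDiagram n} (hd : d.IsDiagram) :
    IsExtension (idDiagram (leftLevels d)) d d (Sum.elim (fun p => Sum.inl (level p)) id)
      Sum.inr := by
  have hout : ∀ p, d.link p ≠ Link.empty →
      (stringGraph (idDiagram (leftLevels d)) d).Reachable (outer p) (Sum.inr p) := by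
    rintro (i | i) hp
    · have h1 : (idDiagram (leftLevels d)).link (Sum.inl i) = Link.node (Sum.inr i) :=
        idDiagram_link_eq_node.2 ⟨by simpa [leftLevels, level] using hp, rfl⟩
      exact (reachable_fromRel (Step.left h1)).trans (reachable_fromRel (Step.glue i))
    · exact SimpleGraph.Reachable.refl _
  constructor
  · rintro (i | i) <;> rfl
  · intro p
    rfl
  · rintro u v (h | h | i)
    · left
      rw [(idDiagram_link_eq_node.1 h).2]
      simp [level_swap]
    · exact Or.inr h
    · exact Or.inl rfl
  · intro p q h
    exact ((hout p (by simp [h])).trans (reachable_fromRel (Step.right h))).trans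
      (hout q (by simp [hd.link_symm _ _ h])).symm
  · intro p s h
    exact hout p (by simp [h])
  · intro s
    simp [cWord, idDiagram]
  · rintro (p | p) q h
    · obtain ⟨_, rfl⟩ := idDiagram_link_eq_node.1 h
      rcases p with i | i
      · exact ⟨Sum.inl i, SimpleGraph.Reachable.refl _⟩
      · exact ⟨Sum.inl i, reachable_fromRel (Step.left h)⟩
    · have h' : d.link p = Link.node q := h
      exact ⟨p, (hout p (by simp [h'])).symm⟩

theorem isExtension_right {d : RawDiagram n} (hd : d.IsDiagram) :
    IsExtension d (idDiagram (rightLevels d)) d (Sum.elim id fun p => Sum.inr (level p))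
      Sum.inl := by
  have hout : ∀ p, d.link p ≠ Link.empty →
      (stringGraph d (idDiagram (rightLevels d))).Reachable (outer p) (Sum.inl p) := by
    rintro (i | i) hp
    · exact SimpleGraph.Reachable.refl _
    · have h1 : (idDiagram (rightLevels d)).link (Sum.inr i) = Link.node (Sum.inl i) :=
        idDiagram_link_eq_node.2 ⟨by simpa [rightLevels, level] using hp, rfl⟩
      exact (reachable_fromRel (Step.right h1)).trans (reachable_fromRel (Step.glue i)).symm
  constructor
  · rintro (i | i) <;> rfl
  · intro p
    rfl
  · rintro u v (h | h | i)
    · exact Or.inr h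
    · left
      rw [(idDiagram_link_eq_node.1 h).2]
      simp [level_swap]
    · exact Or.inl rfl
  · intro p q h
    exact ((hout p (by simp [h])).trans (reachable_fromRel (Step.left h))).trans
      (hout q (by simp [hd.link_symm _ _ h])).symm
  · intro p s h
    exact hout p (by simp [h])
  · intro s
    simp [cWord, idDiagram]
  · rintro (p | p) q h
    · have h' : d.link p = Link.node q := h
      exact ⟨p, (hout p (by simp [h'])).symm⟩
    · obtain ⟨_, rfl⟩ := idDiagram_link_eq_node.1 h
      rcases p with i | i
      · exact ⟨Sum.inr i, reachable_fromRel (Step.right h)⟩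
      · exact ⟨Sum.inr i, SimpleGraph.Reachable.refl _⟩

/-- The sum of all diagrams consisting of horizontal strings. -/
def identity (R : Type*) [CommRing R] (n : ℕ) : RawDiagram n →₀ R := ∑ S : Finset (Fin n), Finsupp.single (idDiagram S) 1

variable {R : Type*} [CommRing R] (P : Params R)

theorem identity_mem_dGh1 : identity R n ∈ dGh1 R n :=
  Submodule.sum_mem _ fun S _ => Finsupp.single_mem_supported R _
    ⟨isDiagram_idDiagram S, noBottomString_idDiagram S⟩

/-- Only the summand whose strings match the nonempty left nodes of `d` survives, and it leaves `d`
unchanged with factor one. -/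
theorem identity_mul_single {d : RawDiagram n} (hd : d.IsDiagram) (r : R) :
    mul P (identity R n) (Finsupp.single d r) = Finsupp.single d r := by
  rw [identity, mul_sum_left, Finset.sum_eq_single (leftLevels d)]
  · rw [mul_single_single, if_neg (by simp [meetsEmpty_idDiagram_left]),
      (isExtension_left hd).concat_eq (isDiagram_idDiagram _) hd hd,
      (isExtension_left hd).factor_eq_one P (isDiagram_idDiagram _) hd hd, one_mul, mul_one]
  · intro S _ hS
    rw [mul_single_single, if_pos (meetsEmpty_idDiagram_left.2 hS)]
  · simp

theorem single_mul_identity {d : RawDiagram n} (hd : d.IsDiagram) (r : R) :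
    mul P (Finsupp.single d r) (identity R n) = Finsupp.single d r := by
  rw [identity, mul_sum_right, Finset.sum_eq_single (rightLevels d)]
  · rw [mul_single_single, if_neg (by simp [meetsEmpty_idDiagram_right]),
      (isExtension_right hd).concat_eq hd (isDiagram_idDiagram _) hd,
      (isExtension_right hd).factor_eq_one P hd (isDiagram_idDiagram _) hd, mul_one, mul_one]
  · intro S _ hS
    rw [mul_single_single, if_pos (meetsEmpty_idDiagram_right.2 hS)]
  · simp

theorem containsIdentity_dGh1 : ContainsIdentityOf P (dGh1 R n) (dGh2 R n) := by
  refine ⟨identity R n, identity_mem_dGh1, dGh1_le_dGh2 identity_mem_dGh1, fun a ha => ⟨?_, ?_⟩⟩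
  · refine supported_induction (p := fun a => mul P (identity R n) a = a) (mul_zero_right P _) ?_
      (fun x hx r => identity_mul_single P hx r) ha
    intro a b h h'
    rw [mul_add_right, h, h']
  · refine supported_induction (p := fun a => mul P a (identity R n) = a) (mul_zero_left P _) ?_
      (fun x hx r => single_mul_identity P hx r) ha
    intro a b h h'
    rw [mul_add_left, h, h']

/-- Diagrams without empty nodes annihilate the empty diagram. -/
theorem mul_emptyDiagram (hn : 1 ≤ n) {e : RawDiagram n →₀ R} (he : e ∈ Gh2 R n) :
    mul P e (Finsupp.single (idDiagram ∅) 1) = 0 := by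
  refine supported_induction (p := fun e => mul P e (Finsupp.single (idDiagram ∅) 1) = 0)
    (mul_zero_left P _) ?_ ?_ he
  · intro a b h h'
    rw [mul_add_left, h, h', add_zero]
  · intro x hx r
    rw [mul_single_single, if_pos]
    rw [meetsEmpty_idDiagram_right]
    intro h
    have : (⟨0, hn⟩ : Fin n) ∈ rightLevels x := by
      simpa [rightLevels] using hx.2 _
    rw [← h] at this
    simp at this

/-- An identity would fix the diagram without strings and marks, which is nonzero over a nontrivial
ring but annihilated by `B`. -/
theorem not_containsIdentity_of_le [Nontrivial R] (hn : 1 ≤ n)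
    {B : Submodule R (RawDiagram n →₀ R)} (hB : B ≤ Gh2 R n) :
    ¬ ContainsIdentityOf P B (dGh2 R n) := by
  rintro ⟨e, he, _, h⟩
  have hmem : Finsupp.single (idDiagram ∅) 1 ∈ dGh2 R n :=
    Finsupp.single_mem_supported R _ (isDiagram_idDiagram ∅)
  have := (h _ hmem).1
  rw [mul_emptyDiagram P hn (hB he)] at this
  exact one_ne_zero (Finsupp.single_eq_zero.1 this.symm)

end Identity

end

end GhostAlgebra

/-! ### The ghost algebras as subalgebras of the dilute ghost algebra -/

theorem corollary4 {R : Type*} [CommRing R] [Nontrivial R] (P : GhostAlgebra.Params R) (n : ℕ) :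
    -- the ambient dilute ghost algebra is an associative algebra
    GhostAlgebra.IsAssociativeAlgebra P (GhostAlgebra.dGh2 R n) ∧
    -- the three algebras are associative
    GhostAlgebra.IsAssociativeAlgebra P (GhostAlgebra.Gh2 R n) ∧
    GhostAlgebra.IsAssociativeAlgebra P (GhostAlgebra.Gh1 R n) ∧
    GhostAlgebra.IsAssociativeAlgebra P (GhostAlgebra.dGh1 R n) ∧
    -- they are subalgebras of the dilute ghost algebra
    GhostAlgebra.IsSubalgebraOf P (GhostAlgebra.Gh2 R n) (GhostAlgebra.dGh2 R n) ∧
    GhostAlgebra.IsSubalgebraOf P (GhostAlgebra.Gh1 R n) (GhostAlgebra.dGh2 R n) ∧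
    GhostAlgebra.IsSubalgebraOf P (GhostAlgebra.dGh1 R n) (GhostAlgebra.dGh2 R n) ∧
    -- non-unital, non-unital and unital, respectively
    (1 ≤ n → ¬ GhostAlgebra.ContainsIdentityOf P (GhostAlgebra.Gh2 R n) (GhostAlgebra.dGh2 R n)) ∧
    (1 ≤ n → ¬ GhostAlgebra.ContainsIdentityOf P (GhostAlgebra.Gh1 R n) (GhostAlgebra.dGh2 R n)) ∧
    GhostAlgebra.ContainsIdentityOf P (GhostAlgebra.dGh1 R n) (GhostAlgebra.dGh2 R n) := by
  have hassoc := GhostAlgebra.mulAssociative_dGh2 P (n := n)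
  exact ⟨⟨GhostAlgebra.mulClosed_dGh2 P, hassoc⟩,
    ⟨GhostAlgebra.mulClosed_Gh2 P, hassoc.mono P GhostAlgebra.Gh2_le_dGh2⟩,
    ⟨GhostAlgebra.mulClosed_Gh1 P, hassoc.mono P GhostAlgebra.Gh1_le_dGh2⟩,
    ⟨GhostAlgebra.mulClosed_dGh1 P, hassoc.mono P GhostAlgebra.dGh1_le_dGh2⟩,
    ⟨GhostAlgebra.Gh2_le_dGh2, GhostAlgebra.mulClosed_Gh2 P⟩,
    ⟨GhostAlgebra.Gh1_le_dGh2, GhostAlgebra.mulClosed_Gh1 P⟩,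
    ⟨GhostAlgebra.dGh1_le_dGh2, GhostAlgebra.mulClosed_dGh1 P⟩,
    fun hn => GhostAlgebra.not_containsIdentity_of_le P hn le_rfl,
    fun hn => GhostAlgebra.not_containsIdentity_of_le P hn GhostAlgebra.Gh1_le_Gh2,
    GhostAlgebra.containsIdentity_dGh1 P⟩
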